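/- Let $H$ be a quasi-triangular Hopf algebra over a field $\mathbf k$ with universal $R$-matrix $\mathcal R\in (H\otimes H)^\times$: $\mathcal R\,\Delta(x)=\Delta^{op}(x)\,\mathcal R$, $(\Delta\otimes \mathrm{id})(\mathcal R)=\mathcal R^{1,3}\mathcal R^{2,3}$, $(\mathrm{id}\otimes\Delta)(\mathcal R)=\mathcal R^{1,3}\mathcal R^{1,2}$. Put $D=\mathcal R^{2,1}\mathcal R^{1,2}$. Let $H^\circ$ be the restricted (finite) dual of $H$, a coalgebra under the dual of the product of $H$. For algebras $B$, $A$ let $B\,\hat\otimes\, A=\mathrm{Hom}_{\mathbf k}(A^\circ,B)$ with the convolution product; an element $b\otimes a$ of $B\otimes A$ acts by $f\mapsto f(a)\,b$ (if $A$ is finite-dimensional, $B\,\hat\otimes\, A=B\otimes A$). For $Z\in B\otimes H$ or $Z\in B\,\hat\otimes\, H$ write $Z^{0,1},Z^{0,2},Z^{0,12}$ for its images in $B\otimes H\otimes H$, resp. $B\,\hat\otimes\,(H\otimes H)$, under $x\mapsto x\otimes 1$, $x\mapsto 1\otimes x$, $x\mapsto\Delta(x)$ on the factor $H$. Say that $(X,Y)$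 is an *elliptic pair* if both $Z=X$ and $Z=Y$ satisfy the reflection axiom with parameter $1$, $$Z^{0,12}=D\,(\mathcal R^{1,2})^{-1}Z^{0,2}\,\mathcal R^{1,2}Z^{0,1},$$ and $$X^{0,1}\mathcal R^{2,1}Y^{0,2}=\mathcal R^{2,1}Y^{0,2}\mathcal R^{1,2}X^{0,1}\mathcal R^{2,1}.$$ The elliptic double $E=E_H^{(1)}$ is the algebra with underlying vector space $H^\circ\otimes H^\circ$ defined as follows. Its product is dual to the coproduct of $H\otimes H$ that sends $u\otimes v$ to $\sum (u'\otimes a)\otimes(b\otimes v'')$, where $\sum u'\otimes u''=\Delta'(u)$ and $\sum v'\otimes v''=\Delta'(v)$ with $\Delta'(u)=\sum u_1S(\bar r_1)S(r_2)\otimes r_1u_2S(\bar r_2)$, and $a\otimes b$ is obtained from $v'\otimes u''$ by applying successively $y\otimes x\mapsto \bar r_1y\otimes xS(\bar r_2)$, $\ yS(\bar r_1)\otimes xS(\bar r_2)$, $\ \bar r_1y\otimes \bar r_2x$, $\ yS(r_2)\otimes r_1x$ (with $\mathcal R=\sum r_1\otimes r_2$, $\mathcal R^{-1}=\sum\bar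 r_1\otimes\bar r_2$, independent copies). Let $X,Y\in E\,\hat\otimes\, H$ be the canonical elements, $X:f\mapsto f\otimes 1$ and $Y:g\mapsto 1\otimes g$. Let $\widetilde{SL_2(\mathbb Z)}$ be the group generated by $A,B,Z$ with relations $A^4=(AB)^3=Z$, $A^2B=BA^2$. Let $B_n=B_n(T^2\backslash disc)$, $n\ge 0$, be the braid group of the punctured torus, given by generators $X_1,\dots,X_n,Y_1,\dots,Y_n,\sigma_1,\dots,\sigma_{n-1}$ and the relations: the $X_i$ commute pairwise, the $Y_i$ commute pairwise, the braid relations for the $\sigma_i$, $X_{i+1}=\sigma_iX_i\sigma_i$, $Y_{i+1}=\sigma_iY_i\sigma_i$, $X_1Y_2=Y_2X_1\sigma_1^2$, and $\sigma_iX_1=X_1\sigma_i$, $\sigma_iY_1=Y_1\sigma_i$ for $i\ge2$. Then: 1. If $B$ is an algebra and $(X_B,Y_B)$ is an elliptic pair of invertible elements of $B\otimes H$ (or of $B\,\hat\otimes\, H$), then $(X_B,Y_BX_B^{-1})$ and $(Y_B,Y_BX_B^{-1}Y_B^{-1})$ are elliptic pairs. 2. The unit of $E$ is $\varepsilon\otimes\varepsilon$,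 $(f\otimes1)(1\otimes g)=f\otimes g$ for all $f,g\in H^\circ$ (here $1=\varepsilon$), and $(X,Y)$ is an elliptic pair of invertible elements of $E\,\hat\otimes\, H$. 3. There is exactly one action of $\widetilde{SL_2(\mathbb Z)}$ on $E$ by algebra automorphisms such that $$A\cdot X=Y,\quad A\cdot Y=YX^{-1}Y^{-1},\qquad B\cdot X=X,\quad B\cdot Y=YX^{-1},$$ where $g\cdot Z=(g\otimes\mathrm{id})(Z)$ for $Z\in E\,\hat\otimes\, H$. 4. This action is compatible with the action on $B_n$, for every $n$: there are an action of $\widetilde{SL_2(\mathbb Z)}$ on $B_n$ by group automorphisms with $A\cdot\sigma_i=B\cdot\sigma_i=\sigma_i$, $A\cdot X_1=Y_1$, $A\cdot Y_1=Y_1X_1^{-1}Y_1^{-1}$, $B\cdot X_1=X_1$, $B\cdot Y_1=Y_1X_1^{-1}$, and a group homomorphism $\phi:B_n\to (E\,\hat\otimes\, H^{\otimes n})^\times\rtimes S_n$ with $X_1\mapsto X^{0,1}$, $Y_1\mapsto Y^{0,1}$, $\sigma_i\mapsto (i,i+1)\,\mathcal R^{i,i+1}$ ($S_n$ permutes the factors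 of $H^{\otimes n}$), and $\phi(g\cdot b)=g\cdot\phi(b)$ for all $g\in\widetilde{SL_2(\mathbb Z)}$ and $b\in B_n$, where $g$ acts on the target through $g\otimes\mathrm{id}$ on $E\,\hat\otimes\, H^{\otimes n}$ and trivially on $S_n$. -/

import Mathlib

universe u v w
open TensorProduct
noncomputable section
section RestrictedDual
variable (k : Type u) [Field k] (A : Type v) [Ring A] [Algebra k A]

/-- The restricted (Sweedler, finite) dual `A°` of a `k`-algebra `A`: the functionals `f` such that
the functional `x ⊗ y ↦ f (x * y)` belongs to `A* ⊗ A*`. -/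
def RestrictedDual : Submodule k (Module.Dual k A) :=
  (LinearMap.range (TensorProduct.dualDistrib k A A)).comap (LinearMap.mul' k A).dualMap

theorem dualTensorHom_inj (M : Type v) [AddCommGroup M] [Module k M] (N : Type w) [AddCommGroup N]
    [Module k N] : Function.Injective (dualTensorHom k M N) := by
  rw [injective_iff_map_eq_zero]
  classical
  intro t ht
  let b := Module.Basis.ofVectorSpace k N
  obtain ⟨c, rfl⟩ := (TensorProduct.equivFinsuppOfBasisRight (M := Module.Dual k M) b).symm.surjective t
  suffices c = 0 by simp [this]
  ext i x
  have h := DFunLike.congr_fun ht x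
  rw [TensorProduct.equivFinsuppOfBasisRight_symm_apply] at h
  simp only [Finsupp.sum, map_sum, LinearMap.sum_apply, dualTensorHom_apply,
    LinearMap.zero_apply] at h
  have := congrArg (fun z => b.repr z i) h
  simp only [map_sum, map_smul, Module.Basis.repr_self, Finsupp.coe_finsetSum, Finset.sum_apply,
    Finsupp.smul_single, smul_eq_mul, mul_one, Finsupp.single_apply, map_zero,
    Finsupp.coe_zero, Pi.zero_apply, Finset.sum_ite_eq', Finsupp.mem_support_iff] at this
  by_cases hi : c i = 0
  · simp [hi]
  · simpa [hi] using this

variable {k A}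

theorem RestrictedDual.mem_iff {f : Module.Dual k A} :
    f ∈ RestrictedDual k A ↔ ∃ t, ∀ x y, TensorProduct.dualDistrib k A A t (x ⊗ₜ y) = f (x * y) := by
  constructor
  · rintro ⟨t, ht⟩
    exact ⟨t, fun x y => by rw [ht]; rfl⟩
  · rintro ⟨t, ht⟩
    exact ⟨t, TensorProduct.ext' fun x y => by rw [ht]; rfl⟩

theorem RestrictedDual.comp_mem {A' : Type w} [Ring A'] [Algebra k A'] (φ : A →ₐ[k] A')
    {f : Module.Dual k A'} (hf : f ∈ RestrictedDual k A') :
    f ∘ₗ φ.toLinearMap ∈ RestrictedDual k A := by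
  rw [mem_iff] at hf ⊢
  obtain ⟨t, ht⟩ := hf
  refine ⟨TensorProduct.map φ.toLinearMap.dualMap φ.toLinearMap.dualMap t, fun x y => ?_⟩
  have : ∀ s, TensorProduct.dualDistrib k A A
      (TensorProduct.map φ.toLinearMap.dualMap φ.toLinearMap.dualMap s) (x ⊗ₜ y) =
      TensorProduct.dualDistrib k A' A' s (φ x ⊗ₜ φ y) := by
    intro s
    induction s with
    | zero => simp
    | tmul a b => simp
    | add a b ha hb => simp only [map_add, LinearMap.add_apply, ha, hb]
  rw [this, ht]; simp

/-- Translates `x ↦ f (a * x * b)` of elements of `A°` are in `A°`. -/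
theorem RestrictedDual.translate_mem (a b : A) {f : Module.Dual k A}
    (hf : f ∈ RestrictedDual k A) :
    f ∘ₗ LinearMap.mulLeft k a ∘ₗ LinearMap.mulRight k b ∈ RestrictedDual k A := by
  rw [mem_iff] at hf ⊢
  obtain ⟨t, ht⟩ := hf
  refine ⟨TensorProduct.map (LinearMap.mulLeft k a).dualMap (LinearMap.mulRight k b).dualMap t,
    fun x y => ?_⟩
  have : ∀ s, TensorProduct.dualDistrib k A A
      (TensorProduct.map (LinearMap.mulLeft k a).dualMap (LinearMap.mulRight k b).dualMap s)
        (x ⊗ₜ y) =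
      TensorProduct.dualDistrib k A A s ((a * x) ⊗ₜ (y * b)) := by
    intro s
    induction s with
    | zero => simp
    | tmul a b => simp
    | add a b ha hb => simp only [map_add, LinearMap.add_apply, ha, hb]
  rw [this, ht]; simp [mul_assoc]

variable (k A)

/-- The injection of `A° ⊗ A°` into the dual of `A ⊗ A`. -/
def RestrictedDual.pair2 : RestrictedDual k A ⊗[k] RestrictedDual k A →ₗ[k] Module.Dual k (A ⊗[k] A) :=
  TensorProduct.dualDistrib k A A ∘ₗ
    TensorProduct.map (RestrictedDual k A).subtype (RestrictedDual k A).subtype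

theorem dualDistrib_injective (M : Type v) [AddCommGroup M] [Module k M] (N : Type w)
    [AddCommGroup N] [Module k N] : Function.Injective (TensorProduct.dualDistrib k M N) := by
  have h : ∀ t m n, TensorProduct.dualDistrib k M N t (m ⊗ₜ n) = dualTensorHom k M _ t m n := by
    intro t m n
    induction t with
    | zero => simp
    | tmul a b => simp
    | add a b ha hb => simp only [map_add, LinearMap.add_apply, ha, hb]
  intro s t hst
  apply dualTensorHom_inj
  ext m n
  rw [← h, ← h, hst]

instance RestrictedDual.flat : Module.Flat k (RestrictedDual k A) :=
  have : Module.Free k (RestrictedDual k A) :=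
    @Module.Free.of_divisionRing k (RestrictedDual k A) _ (Submodule.addCommGroup _) _
  Module.Flat.of_free

theorem RestrictedDual.pair2_injective : Function.Injective (RestrictedDual.pair2 k A) :=
  (dualDistrib_injective k A A).comp (TensorProduct.map_injective_of_flat_flat _ _
    (Submodule.subtype_injective _) (Submodule.subtype_injective _))

theorem RestrictedDual.exists_comul (f : RestrictedDual k A) :
    (LinearMap.mul' k A).dualMap f ∈ LinearMap.range (RestrictedDual.pair2 k A) := by
  obtain ⟨t, ht⟩ := RestrictedDual.mem_iff.1 f.2
  have hL : ∀ x, f.1 ∘ₗ LinearMap.mulLeft k x ∈ (RestrictedDual k A) := fun x => by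
    simpa using RestrictedDual.translate_mem x 1 f.2
  have hR : ∀ x, f.1 ∘ₗ LinearMap.mulRight k x ∈ (RestrictedDual k A) := fun x => by
    simpa using RestrictedDual.translate_mem 1 x f.2
  -- the second leg of `t` lies in `A°`
  have h1 : (RestrictedDual k A).mkQ.lTensor (Module.Dual k A) t = 0 := by
    apply dualTensorHom_inj
    rw [map_zero]
    ext x
    have key : ∀ s, dualTensorHom k A _ ((RestrictedDual k A).mkQ.lTensor (Module.Dual k A) s) x =
        (RestrictedDual k A).mkQ (dualTensorHom k A _ s x) := by
      intro s
      induction s with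
      | zero => simp
      | tmul a b => simp
      | add a b ha hb => simp only [map_add, LinearMap.add_apply, ha, hb]
    have key2 : ∀ s y, dualTensorHom k A (Module.Dual k A) s x y =
        TensorProduct.dualDistrib k A A s (x ⊗ₜ y) := by
      intro s y
      induction s with
      | zero => simp
      | tmul a b => simp
      | add a b ha hb => simp only [map_add, LinearMap.add_apply, ha, hb]
    rw [key, LinearMap.zero_apply, Submodule.mkQ_apply, Submodule.Quotient.mk_eq_zero]
    convert hL x using 1
    ext y
    rw [key2, ht]; rfl
  obtain ⟨t1, rfl⟩ := (lTensor_mkQ (Module.Dual k A) (RestrictedDual k A)).le h1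
  -- the first leg lies in `A°`
  have h2 : (RestrictedDual k A).mkQ.rTensor (RestrictedDual k A) t1 = 0 := by
    apply (TensorProduct.comm k _ _).injective
    rw [map_zero]
    apply (Module.Flat.rTensor_preserves_injective_linearMap (M := (Module.Dual k A ⧸ (RestrictedDual k A)))
      (RestrictedDual k A).subtype (Submodule.subtype_injective _))
    apply dualTensorHom_inj
    rw [map_zero, map_zero]
    ext x
    have key : ∀ s : Module.Dual k A ⊗[k] (RestrictedDual k A), dualTensorHom k A _ ((RestrictedDual k A).subtype.rTensor _
        (TensorProduct.comm k _ _ ((RestrictedDual k A).mkQ.rTensor (RestrictedDual k A) s))) x =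
        (RestrictedDual k A).mkQ (dualTensorHom k A _ (TensorProduct.comm k _ _ ((RestrictedDual k A).subtype.lTensor _ s)) x) := by
      intro s
      induction s with
      | zero => simp
      | tmul a b => simp
      | add a b ha hb => simp only [map_add, LinearMap.add_apply, ha, hb]
    have key2 : ∀ s y, dualTensorHom k A (Module.Dual k A) (TensorProduct.comm k _ _ s) x y =
        TensorProduct.dualDistrib k A A s (y ⊗ₜ x) := by
      intro s y
      induction s with
      | zero => simp
      | tmul a b => simp [mul_comm]
      | add a b ha hb => simp only [map_add, LinearMap.add_apply, ha, hb]
    rw [key, LinearMap.zero_apply, Submodule.mkQ_apply, Submodule.Quotient.mk_eq_zero]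
    convert hR x using 1
    ext y
    rw [key2, ht]; rfl
  obtain ⟨t2, rfl⟩ := (rTensor_mkQ (RestrictedDual k A) (RestrictedDual k A)).le h2
  refine ⟨t2, TensorProduct.ext' fun x y => ?_⟩
  have h3 : (RestrictedDual k A).subtype.lTensor (Module.Dual k A) ((RestrictedDual k A).subtype.rTensor (RestrictedDual k A) t2) =
      TensorProduct.map (RestrictedDual k A).subtype (RestrictedDual k A).subtype t2 :=
    DFunLike.congr_fun (LinearMap.lTensor_comp_rTensor _ (RestrictedDual k A).subtype (RestrictedDual k A).subtype) t2
  have h4 := ht x y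
  rw [h3] at h4
  exact h4

/-- The coproduct of `A°`, dual to the product of `A`. -/
def RestrictedDual.comulMap :
    RestrictedDual k A →ₗ[k] RestrictedDual k A ⊗[k] RestrictedDual k A :=
  (LinearEquiv.ofInjective _ (RestrictedDual.pair2_injective k A)).symm.toLinearMap ∘ₗ
    ((LinearMap.mul' k A).dualMap ∘ₗ (RestrictedDual k A).subtype).codRestrict _
      (RestrictedDual.exists_comul k A)

theorem RestrictedDual.pair2_comulMap (f : RestrictedDual k A) (x y : A) :
    RestrictedDual.pair2 k A (RestrictedDual.comulMap k A f) (x ⊗ₜ y) = f.1 (x * y) := by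
  have := LinearEquiv.apply_symm_apply
    (LinearEquiv.ofInjective _ (RestrictedDual.pair2_injective k A))
    (((LinearMap.mul' k A).dualMap ∘ₗ (RestrictedDual k A).subtype).codRestrict _
      (RestrictedDual.exists_comul k A) f)
  exact DFunLike.congr_fun (congrArg Subtype.val this) (x ⊗ₜ y)

/-- `A°` is a coalgebra, with coproduct dual to the product of `A` and counit `f ↦ f 1`. -/
instance RestrictedDual.instCoalgebra : Coalgebra k (RestrictedDual k A) where
  comul := RestrictedDual.comulMap k A
  counit := LinearMap.applyₗ (1 : A) ∘ₗ (RestrictedDual k A).subtype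
  coassoc := by
    let J : RestrictedDual k A ⊗[k] (RestrictedDual k A ⊗[k] RestrictedDual k A) →ₗ[k]
        Module.Dual k (A ⊗[k] (A ⊗[k] A)) :=
      TensorProduct.dualDistrib k A (A ⊗[k] A) ∘ₗ
        TensorProduct.map (RestrictedDual k A).subtype (RestrictedDual.pair2 k A)
    have hJ : Function.Injective J :=
      (dualDistrib_injective k _ _).comp (TensorProduct.map_injective_of_flat_flat _ _
        (Submodule.subtype_injective _) (RestrictedDual.pair2_injective k A))
    have e1 : ∀ (s : RestrictedDual k A ⊗[k] RestrictedDual k A) x y z,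
        J ((RestrictedDual.comulMap k A).lTensor _ s) (x ⊗ₜ (y ⊗ₜ z)) =
          RestrictedDual.pair2 k A s (x ⊗ₜ (y * z)) := by
      intro s x y z
      induction s with
      | zero => simp
      | tmul a b =>
        simp [J, RestrictedDual.pair2_comulMap]
        simp [RestrictedDual.pair2]
      | add a b ha hb => simp only [map_add, LinearMap.add_apply, ha, hb]
    have e3 : ∀ (s : RestrictedDual k A ⊗[k] RestrictedDual k A) (c : RestrictedDual k A) x y z,
        J (TensorProduct.assoc k _ _ _ (s ⊗ₜ c)) (x ⊗ₜ (y ⊗ₜ z)) =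
          RestrictedDual.pair2 k A s (x ⊗ₜ y) * c.1 z := by
      intro s c x y z
      induction s with
      | zero => simp
      | tmul a b => simp [J, RestrictedDual.pair2, mul_assoc]
      | add a b ha hb =>
        simp only [TensorProduct.add_tmul, map_add, LinearMap.add_apply, ha, hb, add_mul]
    have e2 : ∀ (s : RestrictedDual k A ⊗[k] RestrictedDual k A) x y z,
        J (TensorProduct.assoc k _ _ _ ((RestrictedDual.comulMap k A).rTensor _ s))
          (x ⊗ₜ (y ⊗ₜ z)) = RestrictedDual.pair2 k A s ((x * y) ⊗ₜ z) := by
      intro s x y z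
      induction s with
      | zero => simp
      | tmul a b =>
        rw [LinearMap.rTensor_tmul, e3, RestrictedDual.pair2_comulMap]
        simp [RestrictedDual.pair2]
      | add a b ha hb => simp only [map_add, LinearMap.add_apply, ha, hb]
    refine LinearMap.ext fun f => hJ ?_
    refine TensorProduct.ext <| LinearMap.ext fun x => TensorProduct.ext' fun y z => ?_
    refine (e2 _ x y z).trans (Eq.trans ?_ (e1 _ x y z).symm)
    rw [RestrictedDual.pair2_comulMap, RestrictedDual.pair2_comulMap, mul_assoc]
  rTensor_counit_comp_comul := by
    refine LinearMap.ext fun f => (TensorProduct.lid k _).injective <| Subtype.ext <|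
      LinearMap.ext fun x => ?_
    have : ∀ s : RestrictedDual k A ⊗[k] RestrictedDual k A,
        (TensorProduct.lid k _ ((LinearMap.applyₗ (1 : A) ∘ₗ
          (RestrictedDual k A).subtype).rTensor _ s)).1 x =
          RestrictedDual.pair2 k A s (1 ⊗ₜ x) := by
      intro s
      induction s with
      | zero => simp
      | tmul a b => simp [RestrictedDual.pair2]
      | add a b ha hb => simp only [map_add, LinearMap.add_apply, ← ha, ← hb]; rfl
    refine (this _).trans ?_
    rw [RestrictedDual.pair2_comulMap]; simp
  lTensor_counit_comp_comul := by
    refine LinearMap.ext fun f => (TensorProduct.rid k _).injective <| Subtype.ext <|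
      LinearMap.ext fun x => ?_
    have : ∀ s : RestrictedDual k A ⊗[k] RestrictedDual k A,
        (TensorProduct.rid k _ ((LinearMap.applyₗ (1 : A) ∘ₗ
          (RestrictedDual k A).subtype).lTensor _ s)).1 x =
          RestrictedDual.pair2 k A s (x ⊗ₜ 1) := by
      intro s
      induction s with
      | zero => simp
      | tmul a b => simp [RestrictedDual.pair2, mul_comm]
      | add a b ha hb => simp only [map_add, LinearMap.add_apply, ← ha, ← hb]; rfl
    refine (this _).trans ?_
    rw [RestrictedDual.pair2_comulMap]; simp

theorem RestrictedDual.pair2_comul (f : RestrictedDual k A) (x y : A) :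
    RestrictedDual.pair2 k A (Coalgebra.comul (R := k) f) (x ⊗ₜ y) = f.1 (x * y) :=
  RestrictedDual.pair2_comulMap k A f x y

variable {k A}

/-- Restriction of functionals along an algebra homomorphism, a morphism of coalgebras. -/
def RestrictedDual.comap {A' : Type w} [Ring A'] [Algebra k A'] (φ : A →ₐ[k] A') :
    RestrictedDual k A' →ₗc[k] RestrictedDual k A where
  toLinearMap := (φ.toLinearMap.dualMap ∘ₗ (RestrictedDual k A').subtype).codRestrict _
    fun f => RestrictedDual.comp_mem φ f.2
  counit_comp := by
    ext f
    exact congrArg f.1 (map_one φ)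
  map_comp_comul := by
    refine LinearMap.ext fun f => RestrictedDual.pair2_injective k A <|
      TensorProduct.ext' fun x y => ?_
    have : ∀ s : RestrictedDual k A' ⊗[k] RestrictedDual k A',
        RestrictedDual.pair2 k A (TensorProduct.map
          ((φ.toLinearMap.dualMap ∘ₗ (RestrictedDual k A').subtype).codRestrict _
            fun f => RestrictedDual.comp_mem φ f.2)
          ((φ.toLinearMap.dualMap ∘ₗ (RestrictedDual k A').subtype).codRestrict _
            fun f => RestrictedDual.comp_mem φ f.2) s) (x ⊗ₜ y) =
          RestrictedDual.pair2 k A' s (φ x ⊗ₜ φ y) := by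
      intro s
      induction s with
      | zero => simp
      | tmul a b => rfl
      | add a b ha hb => simp only [map_add, LinearMap.add_apply, ha, hb]
    refine (this _).trans ?_
    rw [RestrictedDual.pair2_comul]
    refine Eq.trans ?_ (RestrictedDual.pair2_comul k A _ x y).symm
    exact congrArg f.1 (map_mul φ x y).symm
end RestrictedDual
section Words
variable {G : Type*} [Group G] {ι : Type*} (r : ι → ι → G)

/-- A family of elements of a group that satisfies the Yang-Baxter equation. -/
structure IsYB : Prop where
  comm : ∀ i j k l, i ≠ k → i ≠ l → j ≠ k → j ≠ l → Commute (r i j) (r k l)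
  yb : ∀ i j k, i ≠ j → i ≠ k → j ≠ k → r i j * r i k * r j k = r j k * r i k * r i j

variable {r} {i j k : ι} (t : G)

theorem IsYB.v1 (h : IsYB r) (h1 : i ≠ j) (h2 : i ≠ k) (h3 : j ≠ k) :
    (r j k)⁻¹ * (r i j * (r i k * t)) = r i k * (r i j * ((r j k)⁻¹ * t)) := by
  have := h.yb i j k h1 h2 h3
  rw [inv_mul_eq_iff_eq_mul]
  calc _ = (r i j * r i k * r j k) * ((r j k)⁻¹ * t) := by group
    _ = _ := by rw [this]; group

theorem IsYB.v2 (h : IsYB r) (h1 : i ≠ j) (h2 : i ≠ k) (h3 : j ≠ k) :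
    (r i j)⁻¹ * ((r i k)⁻¹ * ((r j k)⁻¹ * t)) = (r j k)⁻¹ * ((r i k)⁻¹ * ((r i j)⁻¹ * t)) := by
  have := congrArg (fun z => z⁻¹) (h.yb i j k h1 h2 h3)
  simp only [mul_inv_rev] at this
  calc _ = ((r i j)⁻¹ * ((r i k)⁻¹ * (r j k)⁻¹)) * t := by group
    _ = _ := by rw [← this]; group

theorem IsYB.v3 (h : IsYB r) (h1 : i ≠ j) (h2 : i ≠ k) (h3 : j ≠ k) :
    r i k * (r j k * ((r i j)⁻¹ * t)) = (r i j)⁻¹ * (r j k * (r i k * t)) := by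
  have := h.yb i j k h1 h2 h3
  rw [eq_inv_mul_iff_mul_eq]
  calc _ = (r i j * r i k * r j k) * ((r i j)⁻¹ * t) := by group
    _ = _ := by rw [this]; group

theorem IsYB.v4 (h : IsYB r) (h1 : i ≠ j) (h2 : i ≠ k) (h3 : j ≠ k) :
    r i j * ((r j k)⁻¹ * ((r i k)⁻¹ * t)) = (r i k)⁻¹ * ((r j k)⁻¹ * (r i j * t)) := by
  have := h.yb i j k h1 h2 h3
  rw [eq_inv_mul_iff_mul_eq, eq_inv_mul_iff_mul_eq]
  calc _ = (r j k * r i k * r i j) * ((r j k)⁻¹ * ((r i k)⁻¹ * t)) := by group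
    _ = _ := by rw [← this]; group

theorem IsYB.v5 (h : IsYB r) (h1 : i ≠ j) (h2 : i ≠ k) (h3 : j ≠ k) :
    r j k * ((r i j)⁻¹ * ((r i k)⁻¹ * t)) = (r i k)⁻¹ * ((r i j)⁻¹ * (r j k * t)) := by
  have := h.yb i j k h1 h2 h3
  rw [eq_inv_mul_iff_mul_eq, eq_inv_mul_iff_mul_eq]
  calc _ = (r i j * r i k * r j k) * ((r i j)⁻¹ * ((r i k)⁻¹ * t)) := by group
    _ = _ := by rw [this]; group

variable {l : ι} 
theorem IsYB.c1 (h : IsYB r) (h1 : i ≠ k) (h2 : i ≠ l) (h3 : j ≠ k) (h4 : j ≠ l) :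
    r i j * (r k l * t) = r k l * (r i j * t) := (h.comm i j k l h1 h2 h3 h4).left_comm t
theorem IsYB.c2 (h : IsYB r) (h1 : i ≠ k) (h2 : i ≠ l) (h3 : j ≠ k) (h4 : j ≠ l) :
    (r i j)⁻¹ * (r k l * t) = r k l * ((r i j)⁻¹ * t) :=
  (h.comm i j k l h1 h2 h3 h4).inv_left.left_comm t
theorem IsYB.c3 (h : IsYB r) (h1 : i ≠ k) (h2 : i ≠ l) (h3 : j ≠ k) (h4 : j ≠ l) :
    r i j * ((r k l)⁻¹ * t) = (r k l)⁻¹ * (r i j * t) :=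
  (h.comm i j k l h1 h2 h3 h4).inv_right.left_comm t
theorem IsYB.c4 (h : IsYB r) (h1 : i ≠ k) (h2 : i ≠ l) (h3 : j ≠ k) (h4 : j ≠ l) :
    (r i j)⁻¹ * ((r k l)⁻¹ * t) = (r k l)⁻¹ * ((r i j)⁻¹ * t) :=
  (h.comm i j k l h1 h2 h3 h4).inv_inv.left_comm t
end Words

section Words2
variable {G : Type*} [Group G] 
theorem IsYB.cocycle {r : Fin 6 → Fin 6 → G} (h : IsYB r) (t : G) :
    r 2 1 * ((r 1 3)⁻¹ * (r 4 1 * (r 4 3 * ((r 1 5)⁻¹ * ((r 3 5)⁻¹ * t))))) =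
    r 4 3 * ((r 3 5)⁻¹ * (r 2 1 * (r 4 1 * ((r 1 5)⁻¹ * ((r 1 3)⁻¹ * t))))) := by
  rw [h.v1 _ (i := 4) (j := 1) (k := 3) (by decide) (by decide) (by decide),
    h.v2 _ (i := 1) (j := 3) (k := 5) (by decide) (by decide) (by decide),
    h.c1 _ (i := 2) (j := 1) (k := 4) (l := 3) (by decide) (by decide) (by decide) (by decide),
    h.c2 _ (i := 3) (j := 5) (k := 2) (l := 1) (by decide) (by decide) (by decide) (by decide),
    h.c2 _ (i := 3) (j := 5) (k := 4) (l := 1) (by decide) (by decide) (by decide) (by decide)]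

theorem IsYB.hexagon_left {r : Fin 6 → Fin 6 → G} (h : IsYB r) (t : G) :
    r 2 1 * ((r 1 3)⁻¹ * (r 4 1 * (r 4 3 * ((r 2 4)⁻¹ * ((r 0 4)⁻¹ * ((r 1 5)⁻¹ *
      ((r 3 5)⁻¹ * ((r 2 5)⁻¹ * ((r 0 5)⁻¹ * t))))))))) =
    r 4 3 * ((r 2 4)⁻¹ * ((r 3 5)⁻¹ * ((r 2 5)⁻¹ * (r 4 1 * ((r 0 4)⁻¹ * ((r 1 5)⁻¹ *
      ((r 0 5)⁻¹ * (r 2 1 * ((r 1 3)⁻¹ * t))))))))) := by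
  rw [h.v1 _ (i := 4) (j := 1) (k := 3) (by decide) (by decide) (by decide),
    h.c4 _ (i := 1) (j := 3) (k := 2) (l := 4) (by decide) (by decide) (by decide) (by decide),
    h.c4 _ (i := 1) (j := 3) (k := 0) (l := 4) (by decide) (by decide) (by decide) (by decide),
    h.v2 _ (i := 1) (j := 3) (k := 5) (by decide) (by decide) (by decide),
    h.c4 _ (i := 1) (j := 3) (k := 2) (l := 5) (by decide) (by decide) (by decide) (by decide),
    h.c4 _ (i := 1) (j := 3) (k := 0) (l := 5) (by decide) (by decide) (by decide) (by decide),
    h.c1 _ (i := 2) (j := 1) (k := 4) (l := 3) (by decide) (by decide) (by decide) (by decide),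
    h.v3 _ (i := 2) (j := 4) (k := 1) (by decide) (by decide) (by decide),
    h.c3 _ (i := 2) (j := 1) (k := 0) (l := 4) (by decide) (by decide) (by decide) (by decide),
    h.c3 _ (i := 2) (j := 1) (k := 3) (l := 5) (by decide) (by decide) (by decide) (by decide),
    h.v4 _ (i := 2) (j := 1) (k := 5) (by decide) (by decide) (by decide),
    h.c3 _ (i := 2) (j := 1) (k := 0) (l := 5) (by decide) (by decide) (by decide) (by decide),
    h.c4 _ (i := 0) (j := 4) (k := 3) (l := 5) (by decide) (by decide) (by decide) (by decide),
    h.c4 _ (i := 0) (j := 4) (k := 2) (l := 5) (by decide) (by decide) (by decide) (by decide),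
    h.c3 _ (i := 4) (j := 1) (k := 3) (l := 5) (by decide) (by decide) (by decide) (by decide),
    h.c3 _ (i := 4) (j := 1) (k := 2) (l := 5) (by decide) (by decide) (by decide) (by decide)]

theorem IsYB.hexagon_right {r : Fin 6 → Fin 6 → G} (h : IsYB r) (t : G) :
    r 2 1 * ((r 1 3)⁻¹ * (r 0 5 * (r 2 5 * ((r 4 0)⁻¹ * ((r 4 2)⁻¹ * ((r 5 3)⁻¹ *
      ((r 5 1)⁻¹ * ((r 4 3)⁻¹ * ((r 4 1)⁻¹ * t))))))))) =
    r 0 5 * ((r 4 0)⁻¹ * ((r 5 1)⁻¹ * ((r 4 1)⁻¹ * (r 2 5 * ((r 4 2)⁻¹ * ((r 5 3)⁻¹ *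
      ((r 4 3)⁻¹ * (r 2 1 * ((r 1 3)⁻¹ * t))))))))) := by
  rw [h.c2 _ (i := 1) (j := 3) (k := 0) (l := 5) (by decide) (by decide) (by decide) (by decide),
    h.c2 _ (i := 1) (j := 3) (k := 2) (l := 5) (by decide) (by decide) (by decide) (by decide),
    h.c4 _ (i := 1) (j := 3) (k := 4) (l := 0) (by decide) (by decide) (by decide) (by decide),
    h.c4 _ (i := 1) (j := 3) (k := 4) (l := 2) (by decide) (by decide) (by decide) (by decide),
    ← h.v2 _ (i := 5) (j := 1) (k := 3) (by decide) (by decide) (by decide),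
    ← h.v2 _ (i := 4) (j := 1) (k := 3) (by decide) (by decide) (by decide),
    h.c1 _ (i := 2) (j := 1) (k := 0) (l := 5) (by decide) (by decide) (by decide) (by decide),
    h.c4 _ (i := 4) (j := 2) (k := 5) (l := 1) (by decide) (by decide) (by decide) (by decide),
    h.c4 _ (i := 4) (j := 0) (k := 5) (l := 1) (by decide) (by decide) (by decide) (by decide),
    ← h.v1 _ (i := 2) (j := 5) (k := 1) (by decide) (by decide) (by decide),
    h.c3 _ (i := 2) (j := 1) (k := 4) (l := 0) (by decide) (by decide) (by decide) (by decide),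
    h.c4 _ (i := 5) (j := 3) (k := 4) (l := 1) (by decide) (by decide) (by decide) (by decide),
    h.v5 _ (i := 4) (j := 2) (k := 1) (by decide) (by decide) (by decide),
    h.c3 _ (i := 2) (j := 1) (k := 5) (l := 3) (by decide) (by decide) (by decide) (by decide),
    h.c3 _ (i := 2) (j := 1) (k := 4) (l := 3) (by decide) (by decide) (by decide) (by decide),
    h.c3 _ (i := 2) (j := 5) (k := 4) (l := 0) (by decide) (by decide) (by decide) (by decide),
    h.c3 _ (i := 2) (j := 5) (k := 4) (l := 1) (by decide) (by decide) (by decide) (by decide),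
    h.c4 _ (i := 5) (j := 1) (k := 4) (l := 0) (by decide) (by decide) (by decide) (by decide)]
end Words2

section Words3
variable {G : Type*} [Group G]

theorem IsYB.comp {ι κ : Type*} {r : ι → ι → G} (h : IsYB r) (f : κ → ι)
    (hf : Function.Injective f) : IsYB fun i j => r (f i) (f j) where
  comm _ _ _ _ h1 h2 h3 h4 := h.comm _ _ _ _ (hf.ne h1) (hf.ne h2) (hf.ne h3) (hf.ne h4)
  yb _ _ _ h1 h2 h3 := h.yb _ _ _ (hf.ne h1) (hf.ne h2) (hf.ne h3)

theorem IsYB.twist {r : Fin 3 × Fin 4 → Fin 3 × Fin 4 → G} (h : IsYB r) :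
    (r (1, 0) (0, 3) * (r (0, 2) (1, 0))⁻¹ * (r (0, 3) (1, 1))⁻¹ * (r (0, 2) (1, 1))⁻¹) *
      (r (1, 0) (0, 1) * (r (0, 1) (1, 1))⁻¹) * (r (1, 2) (0, 3) * (r (0, 3) (1, 3))⁻¹) *
    (((r (2, 0) (0, 3) * r (2, 0) (1, 3)) * ((r (1, 2) (2, 0))⁻¹ * (r (0, 2) (2, 0))⁻¹) *
      ((r (0, 3) (2, 1))⁻¹ * (r (1, 3) (2, 1))⁻¹) * ((r (1, 2) (2, 1))⁻¹ * (r (0, 2) (2, 1))⁻¹)) *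
      ((r (2, 0) (0, 1) * r (2, 0) (1, 1)) * ((r (0, 1) (2, 1))⁻¹ * (r (1, 1) (2, 1))⁻¹)) *
      ((r (2, 2) (0, 3) * r (2, 2) (1, 3)) * ((r (0, 3) (2, 3))⁻¹ * (r (1, 3) (2, 3))⁻¹))) =
    (r (2, 0) (1, 3) * (r (1, 2) (2, 0))⁻¹ * (r (1, 3) (2, 1))⁻¹ * (r (1, 2) (2, 1))⁻¹) *
      (r (2, 0) (1, 1) * (r (1, 1) (2, 1))⁻¹) * (r (2, 2) (1, 3) * (r (1, 3) (2, 3))⁻¹) *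
    (((r (1, 0) (0, 3) * r (2, 0) (0, 3)) * ((r (0, 2) (1, 0))⁻¹ * (r (0, 2) (2, 0))⁻¹) *
      ((r (0, 3) (2, 1))⁻¹ * (r (0, 3) (1, 1))⁻¹) * ((r (0, 2) (2, 1))⁻¹ * (r (0, 2) (1, 1))⁻¹)) *
      ((r (1, 0) (0, 1) * r (2, 0) (0, 1)) * ((r (0, 1) (2, 1))⁻¹ * (r (0, 1) (1, 1))⁻¹)) *
      ((r (1, 2) (0, 3) * r (2, 2) (0, 3)) * ((r (0, 3) (2, 3))⁻¹ * (r (0, 3) (1, 3))⁻¹))) := by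
  have cU := (h.comp ![(0, 0), (0, 1), (1, 0), (1, 1), (2, 0), (2, 1)] (by decide)).cocycle 1
  have cV := (h.comp ![(0, 2), (0, 3), (1, 2), (1, 3), (2, 2), (2, 3)] (by decide)).cocycle 1
  have hL := (h.comp ![(0, 2), (0, 3), (1, 2), (1, 3), (2, 0), (2, 1)] (by decide)).hexagon_left 1
  have hR := (h.comp ![(1, 0), (1, 1), (2, 0), (2, 1), (0, 2), (0, 3)] (by decide)).hexagon_right 1
  simp only [Matrix.cons_val, mul_one] at cU cV hL hR
  -- abbreviations
  generalize eX21 : (r (1, 0) (0, 3) * (r (0, 2) (1, 0))⁻¹ * (r (0, 3) (1, 1))⁻¹ *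
    (r (0, 2) (1, 1))⁻¹) = X21
  generalize eX32 : (r (2, 0) (1, 3) * (r (1, 2) (2, 0))⁻¹ * (r (1, 3) (2, 1))⁻¹ *
    (r (1, 2) (2, 1))⁻¹) = X32
  generalize eX31 : (r (2, 0) (0, 3) * (r (0, 2) (2, 0))⁻¹ * (r (0, 3) (2, 1))⁻¹ *
    (r (0, 2) (2, 1))⁻¹) = X31
  generalize eU12 : (r (1, 0) (0, 1) * (r (0, 1) (1, 1))⁻¹) = U12
  generalize eV12 : (r (1, 2) (0, 3) * (r (0, 3) (1, 3))⁻¹) = V12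
  generalize eU23 : (r (2, 0) (1, 1) * (r (1, 1) (2, 1))⁻¹) = U23
  generalize eV23 : (r (2, 2) (1, 3) * (r (1, 3) (2, 3))⁻¹) = V23
  generalize eX3 : ((r (2, 0) (0, 3) * r (2, 0) (1, 3)) *
    ((r (1, 2) (2, 0))⁻¹ * (r (0, 2) (2, 0))⁻¹) *
    ((r (0, 3) (2, 1))⁻¹ * (r (1, 3) (2, 1))⁻¹) *
    ((r (1, 2) (2, 1))⁻¹ * (r (0, 2) (2, 1))⁻¹)) = X3
  generalize eX1 : ((r (1, 0) (0, 3) * r (2, 0) (0, 3)) *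
    ((r (0, 2) (1, 0))⁻¹ * (r (0, 2) (2, 0))⁻¹) *
    ((r (0, 3) (2, 1))⁻¹ * (r (0, 3) (1, 1))⁻¹) *
    ((r (0, 2) (2, 1))⁻¹ * (r (0, 2) (1, 1))⁻¹)) = X1
  generalize eU3 : ((r (2, 0) (0, 1) * r (2, 0) (1, 1)) *
    ((r (0, 1) (2, 1))⁻¹ * (r (1, 1) (2, 1))⁻¹)) = U3
  generalize eV3 : ((r (2, 2) (0, 3) * r (2, 2) (1, 3)) *
    ((r (0, 3) (2, 3))⁻¹ * (r (1, 3) (2, 3))⁻¹)) = V3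
  generalize eU1 : ((r (1, 0) (0, 1) * r (2, 0) (0, 1)) *
    ((r (0, 1) (2, 1))⁻¹ * (r (0, 1) (1, 1))⁻¹)) = U1
  generalize eV1 : ((r (1, 2) (0, 3) * r (2, 2) (0, 3)) *
    ((r (0, 3) (2, 3))⁻¹ * (r (0, 3) (1, 3))⁻¹)) = V1
  have k1 : U12 * U3 = U23 * U1 := by
    rw [← eU12, ← eU3, ← eU23, ← eU1]; simpa only [mul_assoc] using cU
  have k2 : V12 * V3 = V23 * V1 := by
    rw [← eV12, ← eV3, ← eV23, ← eV1]; simpa only [mul_assoc] using cV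
  have k3 : V12 * X3 = X32 * X31 * V12 := by
    rw [← eV12, ← eX3, ← eX32, ← eX31]; simpa only [mul_assoc] using hL
  have k4 : U23 * X1 = X21 * X31 * U23 := by
    rw [← eU23, ← eX1, ← eX21, ← eX31]; simpa only [mul_assoc] using hR
  have c1 : Commute X21 X32 := by
    rw [← eX21, ← eX32]
    repeat' first
      | apply Commute.mul_left
      | apply Commute.mul_right
      | apply Commute.inv_left
      | apply Commute.inv_right
      | exact h.comm _ _ _ _ (by decide) (by decide) (by decide) (by decide)
  have c2 : Commute U12 X32 := by
    rw [← eU12, ← eX32]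
    repeat' first
      | apply Commute.mul_left
      | apply Commute.mul_right
      | apply Commute.inv_left
      | apply Commute.inv_right
      | exact h.comm _ _ _ _ (by decide) (by decide) (by decide) (by decide)
  have c3 : Commute U12 X31 := by
    rw [← eU12, ← eX31]
    repeat' first
      | apply Commute.mul_left
      | apply Commute.mul_right
      | apply Commute.inv_left
      | apply Commute.inv_right
      | exact h.comm _ _ _ _ (by decide) (by decide) (by decide) (by decide)
  have c4 : Commute V12 U3 := by
    rw [← eV12, ← eU3]
    repeat' first
      | apply Commute.mul_left
      | apply Commute.mul_right
      | apply Commute.inv_left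
      | apply Commute.inv_right
      | exact h.comm _ _ _ _ (by decide) (by decide) (by decide) (by decide)
  have c5 : Commute V23 X1 := by
    rw [← eV23, ← eX1]
    repeat' first
      | apply Commute.mul_left
      | apply Commute.mul_right
      | apply Commute.inv_left
      | apply Commute.inv_right
      | exact h.comm _ _ _ _ (by decide) (by decide) (by decide) (by decide)
  have c6 : Commute V23 U1 := by
    rw [← eV23, ← eU1]
    repeat' first
      | apply Commute.mul_left
      | apply Commute.mul_right
      | apply Commute.inv_left
      | apply Commute.inv_right
      | exact h.comm _ _ _ _ (by decide) (by decide) (by decide) (by decide)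
  calc X21 * U12 * V12 * (X3 * U3 * V3) = X21 * U12 * (V12 * X3) * U3 * V3 := by group
    _ = X21 * (U12 * (X32 * X31)) * (V12 * U3) * V3 := by rw [k3]; group
    _ = X21 * X32 * X31 * (U12 * U3) * (V12 * V3) := by
        rw [(c2.mul_right c3).eq, c4.eq]; group
    _ = X32 * X21 * X31 * (U23 * U1) * (V23 * V1) := by rw [k1, k2, c1.eq]
    _ = X32 * (X21 * X31 * U23) * (U1 * V23) * V1 := by group
    _ = X32 * U23 * (V23 * X1) * U1 * V1 := by rw [← k4, ← c6.eq, c5.eq]; group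
    _ = _ := by group
end Words3


/-! ### Quasi-triangular Hopf algebras -/

/-- A quasi-triangular structure (universal `R`-matrix) on a Hopf algebra `H` over a field `k`. -/
structure QuasiTriangular (k : Type u) [Field k] (H : Type v) [Ring H] [HopfAlgebra k H] where
  /-- the universal `R`-matrix -/
  R : (H ⊗[k] H)ˣ
  /-- `R Δ(x) = Δᵒᵖ(x) R` -/
  mul_comul : ∀ x : H, (R : H ⊗[k] H) * Coalgebra.comul (R := k) x =
    TensorProduct.comm k H H (Coalgebra.comul (R := k) x) * R
  /-- `(Δ ⊗ id)(R) = R¹³ R²³` in `H ⊗ (H ⊗ H)` -/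
  comul_left : TensorProduct.assoc k H H H
      (TensorProduct.map Coalgebra.comul LinearMap.id (R : H ⊗[k] H)) =
    Algebra.TensorProduct.map (AlgHom.id k H) Algebra.TensorProduct.includeRight (R : H ⊗[k] H) *
      Algebra.TensorProduct.includeRight (R : H ⊗[k] H)
  /-- `(id ⊗ Δ)(R) = R¹³ R¹²` in `H ⊗ (H ⊗ H)` -/
  comul_right : TensorProduct.map LinearMap.id Coalgebra.comul (R : H ⊗[k] H) =
    Algebra.TensorProduct.map (AlgHom.id k H) Algebra.TensorProduct.includeRight (R : H ⊗[k] H) *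
      Algebra.TensorProduct.map (AlgHom.id k H) Algebra.TensorProduct.includeLeft (R : H ⊗[k] H)

section Pairing
variable {k : Type u} [Field k] {H : Type v} [Ring H] [HopfAlgebra k H]
variable {M : Type w} [Semiring M] [Algebra k M]

/-- `evalPair p q (∑ a ⊗ b) = ∑ p a * q b`. -/
def evalPair (p q : H →ₗ[k] M) : H ⊗[k] H →ₗ[k] M :=
  LinearMap.mul' k M ∘ₗ TensorProduct.map p q

@[simp] theorem evalPair_tmul (p q : H →ₗ[k] M) (a b : H) :
    evalPair p q (a ⊗ₜ b) = p a * q b := by simp [evalPair]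

/-- the convolution product `x ↦ ∑ p x₁ * q x₂` -/
def convPair (p q : H →ₗ[k] M) : H →ₗ[k] M :=
  evalPair p q ∘ₗ Coalgebra.comul

theorem evalPair_eq_lift (p q : H →ₐ[k] M) (h : ∀ x y, Commute (p x) (q y)) (t : H ⊗[k] H) :
    evalPair p.toLinearMap q.toLinearMap t = Algebra.TensorProduct.lift p q h t := by
  induction t with
  | zero => simp
  | tmul a b => simp
  | add a b ha hb => simp only [map_add, ha, hb]

theorem map_evalPair {M' : Type*} [Semiring M'] [Algebra k M'] (φ : M →ₐ[k] M') (p q : H →ₗ[k] M)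
    (t : H ⊗[k] H) :
    φ (evalPair p q t) = evalPair (φ.toLinearMap ∘ₗ p) (φ.toLinearMap ∘ₗ q) t := by
  induction t with
  | zero => simp
  | tmul a b => simp
  | add a b ha hb => simp only [map_add, ha, hb]

end Pairing

namespace QuasiTriangular
variable {k : Type u} [Field k] {H : Type v} [Ring H] [HopfAlgebra k H] (𝓡 : QuasiTriangular k H)
variable {M : Type w} [Semiring M] [Algebra k M]

/-- `R¹²`, `R¹³`, `R²³` in `H ⊗ (H ⊗ H)`, as functions of `R`. -/
def leg12 : H ⊗[k] H →ₐ[k] H ⊗[k] (H ⊗[k] H) :=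
  Algebra.TensorProduct.map (AlgHom.id k H) Algebra.TensorProduct.includeLeft
def leg13 : H ⊗[k] H →ₐ[k] H ⊗[k] (H ⊗[k] H) :=
  Algebra.TensorProduct.map (AlgHom.id k H) Algebra.TensorProduct.includeRight
def leg23 : H ⊗[k] H →ₐ[k] H ⊗[k] (H ⊗[k] H) :=
  Algebra.TensorProduct.includeRight

theorem yangBaxter : leg12 (𝓡.R : H ⊗[k] H) * leg13 (𝓡.R : H ⊗[k] H) * leg23 (𝓡.R : H ⊗[k] H) =
    leg23 (𝓡.R : H ⊗[k] H) * leg13 (𝓡.R : H ⊗[k] H) * leg12 (𝓡.R : H ⊗[k] H) := by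
  let sw : H ⊗[k] (H ⊗[k] H) →ₐ[k] H ⊗[k] (H ⊗[k] H) :=
    ((Algebra.TensorProduct.assoc k k k H H H).toAlgHom.comp
      (Algebra.TensorProduct.map (Algebra.TensorProduct.comm k H H).toAlgHom (AlgHom.id k H))).comp
      (Algebra.TensorProduct.assoc k k k H H H).symm.toAlgHom
  have hsw : ∀ a b c : H, sw (a ⊗ₜ (b ⊗ₜ c)) = b ⊗ₜ (a ⊗ₜ c) := fun a b c => rfl
  have h13 : ∀ t : H ⊗[k] H, sw (leg13 t) = leg23 t := by
    intro t
    induction t with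
    | zero => simp
    | tmul a b => rfl
    | add a b ha hb => simp only [map_add, ha, hb]
  have h23 : ∀ t : H ⊗[k] H, sw (leg23 t) = leg13 t := by
    intro t
    induction t with
    | zero => simp
    | tmul a b => rfl
    | add a b ha hb => simp only [map_add, ha, hb]
  have hl : ∀ t b, TensorProduct.assoc k H H H (t ⊗ₜ[k] b) = leg12 t * (1 ⊗ₜ (1 ⊗ₜ b)) := by
    intro t b
    induction t with
    | zero => simp
    | tmul a c => simp [leg12]
    | add x y ha hb => simp only [TensorProduct.add_tmul, map_add, add_mul, ha, hb]
  have hswc : ∀ t : H ⊗[k] H, sw (leg12 t) = leg12 (TensorProduct.comm k H H t) := by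
    intro t
    induction t with
    | zero => simp
    | tmul a b => rfl
    | add a b ha hb => simp only [map_add, ha, hb]
  have key : ∀ t : H ⊗[k] H, leg12 (𝓡.R : H ⊗[k] H) * TensorProduct.assoc k H H H
      (TensorProduct.map Coalgebra.comul LinearMap.id t) =
      sw (TensorProduct.assoc k H H H (TensorProduct.map Coalgebra.comul LinearMap.id t)) *
        leg12 (𝓡.R : H ⊗[k] H) := by
    intro t
    induction t with
    | zero => simp
    | tmul a b =>
      have hc : leg12 (𝓡.R : H ⊗[k] H) * ((1 : H) ⊗ₜ[k] ((1 : H) ⊗ₜ[k] b)) =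
          ((1 : H) ⊗ₜ[k] ((1 : H) ⊗ₜ[k] b)) * leg12 (𝓡.R : H ⊗[k] H) := by
        generalize (𝓡.R : H ⊗[k] H) = t
        induction t with
        | zero => simp
        | tmul a c => simp [leg12]
        | add x y ha hb => simp only [map_add, add_mul, mul_add, ha, hb]
      rw [TensorProduct.map_tmul, LinearMap.id_apply, hl, map_mul, hswc, hsw, mul_assoc, ← hc,
        ← mul_assoc, ← mul_assoc, ← map_mul, ← map_mul, 𝓡.mul_comul]
    | add a b ha hb => simp only [map_add, mul_add, add_mul, ha, hb]
  have h := key 𝓡.R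
  rw [𝓡.comul_left] at h
  change leg12 _ * (leg13 _ * leg23 _) = sw (leg13 _ * leg23 _) * leg12 _ at h
  rw [map_mul, h13, h23, ← mul_assoc] at h
  exact h

/-- `(ε ⊗ id)(R) = 1`. -/
theorem counit_left : TensorProduct.lid k H
    (TensorProduct.map Coalgebra.counit LinearMap.id (𝓡.R : H ⊗[k] H)) = 1 := by
  let f : H ⊗[k] H →ₐ[k] H := (Algebra.TensorProduct.lid k H).toAlgHom.comp
    (Algebra.TensorProduct.map (Bialgebra.counitAlgHom k H) (AlgHom.id k H))
  let g : H ⊗[k] (H ⊗[k] H) →ₐ[k] (H ⊗[k] H) := (Algebra.TensorProduct.lid k _).toAlgHom.comp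
    (Algebra.TensorProduct.map (Bialgebra.counitAlgHom k H) (AlgHom.id k _))
  have h1 : ∀ t : H ⊗[k] H, g (TensorProduct.assoc k H H H
      (TensorProduct.map Coalgebra.comul LinearMap.id t)) = t := by
    intro t
    induction t with
    | zero => simp
    | tmul a b =>
      have : ∀ s : H ⊗[k] H, g (TensorProduct.assoc k H H H (s ⊗ₜ b)) =
          (TensorProduct.lid k H (Coalgebra.counit.rTensor H s)) ⊗ₜ b := by
        intro s
        induction s with
        | zero => simp
        | tmul a c => simp [g, TensorProduct.smul_tmul']
        | add x y ha hb => simp only [TensorProduct.add_tmul, map_add, ha, hb]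
      rw [TensorProduct.map_tmul, LinearMap.id_apply, this, Coalgebra.rTensor_counit_comul]; simp
    | add a b ha hb => simp only [map_add, ha, hb]
  have h2 : ∀ t : H ⊗[k] H, g (leg13 t) = 1 ⊗ₜ f t := by
    intro t
    induction t with
    | zero => simp
    | tmul a b => simp [g, f, leg13]
    | add a b ha hb => simp only [map_add, ha, hb, TensorProduct.tmul_add]
  have h3 : ∀ t : H ⊗[k] H, g (leg23 t) = t := by
    intro t; simp [g, leg23]
  have h := congrArg g 𝓡.comul_left
  rw [h1, map_mul] at h
  change _ = g (leg13 _) * g (leg23 _) at h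
  rw [h2, h3] at h
  have h4 : (1 : H) ⊗ₜ[k] f 𝓡.R = 1 := by
    have := congrArg (fun z => z * (↑𝓡.R⁻¹ : H ⊗[k] H)) h
    simpa [mul_assoc] using this.symm
  have h5 := congrArg f h4
  have h6 : f ((1 : H) ⊗ₜ[k] f 𝓡.R) = f 𝓡.R := by simp [f]
  rw [h6, map_one] at h5
  have : ∀ t : H ⊗[k] H, f t = TensorProduct.lid k H
    (TensorProduct.map Coalgebra.counit LinearMap.id t) := by
    intro t
    induction t with
    | zero => simp
    | tmul a b => simp [f]
    | add a b ha hb => simp only [map_add, ha, hb]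
  rw [← this, h5]

/-- `(id ⊗ ε)(R) = 1`. -/
theorem counit_right : TensorProduct.rid k H
    (TensorProduct.map LinearMap.id Coalgebra.counit (𝓡.R : H ⊗[k] H)) = 1 := by
  let f : H ⊗[k] H →ₐ[k] H := (Algebra.TensorProduct.rid k k H).toAlgHom.comp
    (Algebra.TensorProduct.map (AlgHom.id k H) (Bialgebra.counitAlgHom k H))
  let g : H ⊗[k] (H ⊗[k] H) →ₐ[k] (H ⊗[k] H) := Algebra.TensorProduct.map (AlgHom.id k H) f
  have h1 : ∀ t : H ⊗[k] H, g 
      (TensorProduct.map LinearMap.id Coalgebra.comul t) = t := by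
    intro t
    induction t with
    | zero => simp
    | tmul a b =>
      have : ∀ s : H ⊗[k] H, f s =
          (TensorProduct.rid k H (Coalgebra.counit.lTensor H s)) := by
        intro s
        induction s with
        | zero => simp
        | tmul a c => simp [f]
        | add x y ha hb => simp only [map_add, ha, hb]
      rw [TensorProduct.map_tmul, Algebra.TensorProduct.map_tmul, this,
        Coalgebra.lTensor_counit_comul]; simp
    | add a b ha hb => simp only [map_add, ha, hb]
  have h2 : ∀ t : H ⊗[k] H, g (leg13 t) = f t ⊗ₜ 1 := by
    intro t
    induction t with
    | zero => simp
    | tmul a b => simp [g, f, leg13, TensorProduct.smul_tmul]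
    | add a b ha hb => simp only [map_add, ha, hb, TensorProduct.add_tmul]
  have h3 : ∀ t : H ⊗[k] H, g (leg12 t) = t := by
    intro t
    induction t with
    | zero => simp
    | tmul a b => simp [g, f, leg12]
    | add a b ha hb => simp only [map_add, ha, hb]
  have h := congrArg g 𝓡.comul_right
  rw [h1, map_mul] at h
  change _ = g (leg13 _) * g (leg12 _) at h
  rw [h2, h3] at h
  have h4 : f 𝓡.R ⊗ₜ[k] (1 : H) = 1 := by
    have := congrArg (fun z => z * (↑𝓡.R⁻¹ : H ⊗[k] H)) h
    simpa [mul_assoc] using this.symm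
  have h5 := congrArg f h4
  have h6 : f (f 𝓡.R ⊗ₜ[k] (1 : H)) = f 𝓡.R := by simp [f]
  rw [h6, map_one] at h5
  have : ∀ t : H ⊗[k] H, f t = TensorProduct.rid k H
    (TensorProduct.map LinearMap.id Coalgebra.counit t) := by
    intro t
    induction t with
    | zero => simp
    | tmul a b => simp [f]
    | add a b ha hb => simp only [map_add, ha, hb]
  rw [← this, h5]

end QuasiTriangular

namespace QuasiTriangular
variable {k : Type u} [Field k] {H : Type v} [Ring H] [HopfAlgebra k H] (𝓡 : QuasiTriangular k H)
variable {M : Type w} [Semiring M] [Algebra k M]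

/-- `∑ p r₁ * q r₂` as a unit, for commuting algebra homomorphisms `p`, `q`. -/
def pairUnit (p q : H →ₐ[k] M) (h : ∀ x y, Commute (p x) (q y)) : Mˣ :=
  Units.map (Algebra.TensorProduct.lift p q h).toMonoidHom 𝓡.R

theorem pairUnit_val (p q : H →ₐ[k] M) (h : ∀ x y, Commute (p x) (q y)) :
    (𝓡.pairUnit p q h : M) = evalPair p.toLinearMap q.toLinearMap (𝓡.R : H ⊗[k] H) :=
  (evalPair_eq_lift p q h _).symm

theorem pairUnit_inv (p q : H →ₐ[k] M) (h : ∀ x y, Commute (p x) (q y)) :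
    (↑(𝓡.pairUnit p q h)⁻¹ : M) =
      evalPair p.toLinearMap q.toLinearMap (↑𝓡.R⁻¹ : H ⊗[k] H) :=
  (evalPair_eq_lift p q h _).symm

section three
variable (p q s : H →ₐ[k] M)

theorem exists_lift3 (hpq : ∀ x y, Commute (p x) (q y))
    (hps : ∀ x y, Commute (p x) (s y)) (hqs : ∀ x y, Commute (q x) (s y)) : ∃ Φ : H ⊗[k] (H ⊗[k] H) →ₐ[k] M,
    ∀ a b c, Φ (a ⊗ₜ (b ⊗ₜ c)) = p a * (q b * s c) := by
  have h : ∀ x y, Commute (p x) (Algebra.TensorProduct.lift q s hqs y) := by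
    intro x y
    induction y with
    | zero => simp
    | tmul a b => exact (hpq x a).mul_right (hps x b)
    | add a b ha hb => rw [map_add]; exact ha.add_right hb
  exact ⟨Algebra.TensorProduct.lift p _ h, fun a b c => rfl⟩

theorem pairUnit_yb (hpq : ∀ x y, Commute (p x) (q y))
    (hps : ∀ x y, Commute (p x) (s y)) (hqs : ∀ x y, Commute (q x) (s y)) : 𝓡.pairUnit p q hpq * 𝓡.pairUnit p s hps * 𝓡.pairUnit q s hqs =
    𝓡.pairUnit q s hqs * 𝓡.pairUnit p s hps * 𝓡.pairUnit p q hpq := by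
  obtain ⟨Φ, hΦ⟩ := exists_lift3 p q s hpq hps hqs
  have h12 : ∀ t, Φ (leg12 t) = Algebra.TensorProduct.lift p q hpq t := by
    intro t
    induction t with
    | zero => simp
    | tmul a b => simp [leg12, hΦ]
    | add a b ha hb => simp only [map_add, ha, hb]
  have h13 : ∀ t, Φ (leg13 t) = Algebra.TensorProduct.lift p s hps t := by
    intro t
    induction t with
    | zero => simp
    | tmul a b => simp [leg13, hΦ]
    | add a b ha hb => simp only [map_add, ha, hb]
  have h23 : ∀ t, Φ (leg23 t) = Algebra.TensorProduct.lift q s hqs t := by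
    intro t
    induction t with
    | zero => simp
    | tmul a b => simp [leg23, hΦ]
    | add a b ha hb => simp only [map_add, ha, hb]
  have h := congrArg Φ 𝓡.yangBaxter
  simp only [map_mul, h12, h13, h23] at h
  exact Units.ext h

theorem conv_left (t : H ⊗[k] H) (Φ : H ⊗[k] (H ⊗[k] H) →ₐ[k] M)
    (hΦ : ∀ a b c, Φ (a ⊗ₜ (b ⊗ₜ c)) = p a * (q b * s c)) :
    evalPair (convPair p.toLinearMap q.toLinearMap) s.toLinearMap t =
      Φ (TensorProduct.assoc k H H H (TensorProduct.map Coalgebra.comul LinearMap.id t)) := by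
  induction t with
  | zero => simp
  | tmul a b =>
    have : ∀ z : H ⊗[k] H, evalPair p.toLinearMap q.toLinearMap z * s b =
        Φ (TensorProduct.assoc k H H H (z ⊗ₜ b)) := by
      intro z
      induction z with
      | zero => simp
      | tmul x y => simp [hΦ, mul_assoc]
      | add x y ha hb => simp only [map_add, TensorProduct.add_tmul, add_mul, ha, hb]
    simpa [convPair] using this _
  | add a b ha hb => simp only [map_add, ha, hb]

theorem conv_right (t : H ⊗[k] H) (Φ : H ⊗[k] (H ⊗[k] H) →ₐ[k] M)
    (hΦ : ∀ a b c, Φ (a ⊗ₜ (b ⊗ₜ c)) = p a * (q b * s c)) :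
    evalPair p.toLinearMap (convPair q.toLinearMap s.toLinearMap) t =
      Φ (TensorProduct.map LinearMap.id Coalgebra.comul t) := by
  induction t with
  | zero => simp
  | tmul a b =>
    have : ∀ z : H ⊗[k] H, p a * evalPair q.toLinearMap s.toLinearMap z =
        Φ (a ⊗ₜ z) := by
      intro z
      induction z with
      | zero => simp
      | tmul x y => simp [hΦ]
      | add x y ha hb => simp only [map_add, TensorProduct.tmul_add, mul_add, ha, hb]
    simpa [convPair] using this _
  | add a b ha hb => simp only [map_add, ha, hb]

theorem evalPair_conv_left (hpq : ∀ x y, Commute (p x) (q y))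
    (hps : ∀ x y, Commute (p x) (s y)) (hqs : ∀ x y, Commute (q x) (s y)) :
    evalPair (convPair p.toLinearMap q.toLinearMap) s.toLinearMap (𝓡.R : H ⊗[k] H) =
        ↑(𝓡.pairUnit p s hps * 𝓡.pairUnit q s hqs) ∧
    evalPair (convPair p.toLinearMap q.toLinearMap) s.toLinearMap (↑𝓡.R⁻¹ : H ⊗[k] H) =
        ↑((𝓡.pairUnit q s hqs)⁻¹ * (𝓡.pairUnit p s hps)⁻¹) := by
  obtain ⟨Φ, hΦ⟩ := exists_lift3 p q s hpq hps hqs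
  let Ψ : H ⊗[k] H →ₐ[k] M := Φ.comp ((Algebra.TensorProduct.assoc k k k H H H).toAlgHom.comp
    (Algebra.TensorProduct.map (Bialgebra.comulAlgHom k H) (AlgHom.id k H)))
  have hΨ : ∀ t, evalPair (convPair p.toLinearMap q.toLinearMap) s.toLinearMap t = Ψ t :=
    fun t => conv_left p q s t Φ hΦ
  have h13 : ∀ t, Φ (leg13 t) = Algebra.TensorProduct.lift p s hps t := by
    intro t
    induction t with
    | zero => simp
    | tmul a b => simp [leg13, hΦ]
    | add a b ha hb => simp only [map_add, ha, hb]
  have h23 : ∀ t, Φ (leg23 t) = Algebra.TensorProduct.lift q s hqs t := by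
    intro t
    induction t with
    | zero => simp
    | tmul a b => simp [leg23, hΦ]
    | add a b ha hb => simp only [map_add, ha, hb]
  have key : Ψ 𝓡.R = ↑(𝓡.pairUnit p s hps * 𝓡.pairUnit q s hqs) := by
    change Φ (TensorProduct.assoc k H H H
      (TensorProduct.map Coalgebra.comul LinearMap.id (𝓡.R : H ⊗[k] H))) = _
    rw [𝓡.comul_left, map_mul]
    exact congrArg₂ (· * ·) (h13 _) (h23 _)
  have key2 : Units.map Ψ.toMonoidHom 𝓡.R = 𝓡.pairUnit p s hps * 𝓡.pairUnit q s hqs :=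
    Units.ext key
  refine ⟨(hΨ _).trans key, (hΨ _).trans ?_⟩
  rw [← mul_inv_rev, ← key2]; rfl

theorem evalPair_conv_right (hpq : ∀ x y, Commute (p x) (q y))
    (hps : ∀ x y, Commute (p x) (s y)) (hqs : ∀ x y, Commute (q x) (s y)) :
    evalPair p.toLinearMap (convPair q.toLinearMap s.toLinearMap) (𝓡.R : H ⊗[k] H) =
        ↑(𝓡.pairUnit p s hps * 𝓡.pairUnit p q hpq) ∧
    evalPair p.toLinearMap (convPair q.toLinearMap s.toLinearMap) (↑𝓡.R⁻¹ : H ⊗[k] H) =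
        ↑((𝓡.pairUnit p q hpq)⁻¹ * (𝓡.pairUnit p s hps)⁻¹) := by
  obtain ⟨Φ, hΦ⟩ := exists_lift3 p q s hpq hps hqs
  let Ψ : H ⊗[k] H →ₐ[k] M := Φ.comp
    (Algebra.TensorProduct.map (AlgHom.id k H) (Bialgebra.comulAlgHom k H))
  have hΨ : ∀ t, evalPair p.toLinearMap (convPair q.toLinearMap s.toLinearMap) t = Ψ t :=
    fun t => conv_right p q s t Φ hΦ
  have h13 : ∀ t, Φ (leg13 t) = Algebra.TensorProduct.lift p s hps t := by
    intro t
    induction t with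
    | zero => simp
    | tmul a b => simp [leg13, hΦ]
    | add a b ha hb => simp only [map_add, ha, hb]
  have h12 : ∀ t, Φ (leg12 t) = Algebra.TensorProduct.lift p q hpq t := by
    intro t
    induction t with
    | zero => simp
    | tmul a b => simp [leg12, hΦ]
    | add a b ha hb => simp only [map_add, ha, hb]
  have key : Ψ 𝓡.R = ↑(𝓡.pairUnit p s hps * 𝓡.pairUnit p q hpq) := by
    change Φ (TensorProduct.map LinearMap.id Coalgebra.comul (𝓡.R : H ⊗[k] H)) = _
    rw [𝓡.comul_right, map_mul]
    exact congrArg₂ (· * ·) (h13 _) (h12 _)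
  have key2 : Units.map Ψ.toMonoidHom 𝓡.R = 𝓡.pairUnit p s hps * 𝓡.pairUnit p q hpq :=
    Units.ext key
  refine ⟨(hΨ _).trans key, (hΨ _).trans ?_⟩
  rw [← mul_inv_rev, ← key2]; rfl
end three

section family
variable {ι : Type*} (p : ι → H →ₐ[k] M)
  (hp : ∀ i j, i ≠ j → ∀ x y, Commute (p i x) (p j y))

open Classical in
/-- the units `R(pᵢ, pⱼ)` for a family of commuting homomorphisms -/
def famUnit (i j : ι) : Mˣ :=
  if h : i ≠ j then 𝓡.pairUnit (p i) (p j) (hp i j h) else 1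

theorem famUnit_of_ne {i j : ι} (h : i ≠ j) :
    𝓡.famUnit p hp i j = 𝓡.pairUnit (p i) (p j) (hp i j h) := by
  simp [famUnit, h]

theorem famUnit_isYB : IsYB (𝓡.famUnit p hp) where
  comm i j a b h1 h2 h3 h4 := by
    by_cases hij : i = j
    · simp [famUnit, hij]
    by_cases hab : a = b
    · simp [famUnit, hab]
    rw [famUnit_of_ne _ _ _ hij, famUnit_of_ne _ _ _ hab]
    have key : ∀ s t, Commute (Algebra.TensorProduct.lift (p i) (p j) (hp i j hij) s)
        (Algebra.TensorProduct.lift (p a) (p b) (hp a b hab) t) := by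
      intro s t
      induction s with
      | zero => simp
      | add x y hx hy => rw [map_add]; exact hx.add_left hy
      | tmul x y =>
        induction t with
        | zero => simp
        | add z w hz hw => rw [map_add]; exact hz.add_right hw
        | tmul z w =>
          exact ((hp i a h1 x z).mul_right (hp i b h2 x w)).mul_left
            ((hp j a h3 y z).mul_right (hp j b h4 y w))
    exact Units.ext (key _ _)
  yb i j l h1 h2 h3 := by
    rw [famUnit_of_ne _ _ _ h1, famUnit_of_ne _ _ _ h2, famUnit_of_ne _ _ _ h3]
    exact 𝓡.pairUnit_yb _ _ _ _ _ _

end family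
end QuasiTriangular

section Twist
variable {k : Type u} [Field k] {H : Type v} [Ring H] [HopfAlgebra k H] (𝓡 : QuasiTriangular k H)
variable {M : Type w} [Semiring M] [Algebra k M]

/-- The element `∑ w` built from `R` and eight families of elements `p a x`, `q a x` (`a = 0, …, 3`,
`x` in `H`) of an algebra, in which `R(p a, q b)` stands for `∑ p a r₁ * q b r₂`:
the operator that turns the usual coproduct of `H ⊗ H` into the one dual to the product of the
elliptic double. -/
def QuasiTriangular.twistWord (p q : Fin 4 → H →ₗ[k] M) : M :=
  (evalPair (q 0) (p 3) (𝓡.R : H ⊗[k] H) * evalPair (p 2) (q 0) (↑𝓡.R⁻¹ : H ⊗[k] H) *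
      evalPair (p 3) (q 1) (↑𝓡.R⁻¹ : H ⊗[k] H) * evalPair (p 2) (q 1) (↑𝓡.R⁻¹ : H ⊗[k] H)) *
    (evalPair (q 0) (p 1) (𝓡.R : H ⊗[k] H) * evalPair (p 1) (q 1) (↑𝓡.R⁻¹ : H ⊗[k] H)) *
    (evalPair (q 2) (p 3) (𝓡.R : H ⊗[k] H) * evalPair (p 3) (q 3) (↑𝓡.R⁻¹ : H ⊗[k] H))

/-- The four convolution products of the families `p` and `q`; the second and fourth members, which
stand for actions through the antipode, are multiplied in the opposite order. -/
def convFour (p q : Fin 4 → H →ₗ[k] M) : Fin 4 → H →ₗ[k] M :=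
  ![convPair (p 0) (q 0), convPair (q 1) (p 1), convPair (p 2) (q 2), convPair (q 3) (p 3)]

theorem QuasiTriangular.twistWord_cocycle (f : Fin 3 → Fin 4 → H →ₐ[k] M)
    (hf : ∀ i j : Fin 3 × Fin 4, i ≠ j → ∀ x y, Commute (f i.1 i.2 x) (f j.1 j.2 y)) :
    𝓡.twistWord (fun a => (f 0 a).toLinearMap) (fun a => (f 1 a).toLinearMap) *
      𝓡.twistWord (convFour (fun a => (f 0 a).toLinearMap) (fun a => (f 1 a).toLinearMap))
        (fun a => (f 2 a).toLinearMap) =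
    𝓡.twistWord (fun a => (f 1 a).toLinearMap) (fun a => (f 2 a).toLinearMap) *
      𝓡.twistWord (fun a => (f 0 a).toLinearMap)
        (convFour (fun a => (f 1 a).toLinearMap) (fun a => (f 2 a).toLinearMap)) := by
  let p : Fin 3 × Fin 4 → H →ₐ[k] M := fun i => f i.1 i.2
  have hv : ∀ i j, i ≠ j → evalPair (f i.1 i.2).toLinearMap (f j.1 j.2).toLinearMap
      (𝓡.R : H ⊗[k] H) = ↑(𝓡.famUnit p hf i j) := fun i j h => by
    rw [𝓡.famUnit_of_ne p hf h, pairUnit_val]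
  have hi : ∀ i j, i ≠ j → evalPair (f i.1 i.2).toLinearMap (f j.1 j.2).toLinearMap
      (↑𝓡.R⁻¹ : H ⊗[k] H) = ↑(𝓡.famUnit p hf i j)⁻¹ := fun i j h => by
    rw [𝓡.famUnit_of_ne p hf h, pairUnit_inv]
  have hL : ∀ i j l, i ≠ j → i ≠ l → j ≠ l → 
      evalPair (convPair (f i.1 i.2).toLinearMap (f j.1 j.2).toLinearMap) (f l.1 l.2).toLinearMap
        (𝓡.R : H ⊗[k] H) = ↑(𝓡.famUnit p hf i l * 𝓡.famUnit p hf j l) := fun i j l h1 h2 h3 => by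
    rw [𝓡.famUnit_of_ne p hf h2, 𝓡.famUnit_of_ne p hf h3]
    exact (𝓡.evalPair_conv_left _ _ _ (hf _ _ h1) (hf _ _ h2) (hf _ _ h3)).1
  have hL' : ∀ i j l, i ≠ j → i ≠ l → j ≠ l → 
      evalPair (convPair (f i.1 i.2).toLinearMap (f j.1 j.2).toLinearMap) (f l.1 l.2).toLinearMap
        (↑𝓡.R⁻¹ : H ⊗[k] H) = ↑((𝓡.famUnit p hf j l)⁻¹ * (𝓡.famUnit p hf i l)⁻¹) :=
    fun i j l h1 h2 h3 => by
    rw [𝓡.famUnit_of_ne p hf h2, 𝓡.famUnit_of_ne p hf h3]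
    exact (𝓡.evalPair_conv_left _ _ _ (hf _ _ h1) (hf _ _ h2) (hf _ _ h3)).2
  have hR : ∀ i j l, i ≠ j → i ≠ l → j ≠ l → 
      evalPair (f i.1 i.2).toLinearMap (convPair (f j.1 j.2).toLinearMap (f l.1 l.2).toLinearMap)
        (𝓡.R : H ⊗[k] H) = ↑(𝓡.famUnit p hf i l * 𝓡.famUnit p hf i j) := fun i j l h1 h2 h3 => by
    rw [𝓡.famUnit_of_ne p hf h2, 𝓡.famUnit_of_ne p hf h1]
    exact (𝓡.evalPair_conv_right _ _ _ (hf _ _ h1) (hf _ _ h2) (hf _ _ h3)).1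
  have hR' : ∀ i j l, i ≠ j → i ≠ l → j ≠ l → 
      evalPair (f i.1 i.2).toLinearMap (convPair (f j.1 j.2).toLinearMap (f l.1 l.2).toLinearMap)
        (↑𝓡.R⁻¹ : H ⊗[k] H) = ↑((𝓡.famUnit p hf i j)⁻¹ * (𝓡.famUnit p hf i l)⁻¹) :=
    fun i j l h1 h2 h3 => by
    rw [𝓡.famUnit_of_ne p hf h2, 𝓡.famUnit_of_ne p hf h1]
    exact (𝓡.evalPair_conv_right _ _ _ (hf _ _ h1) (hf _ _ h2) (hf _ _ h3)).2
  have key := congrArg (Units.val) (𝓡.famUnit_isYB p hf).twist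
  simp only [Units.val_mul] at hL hL' hR hR' key
  simp only [QuasiTriangular.twistWord, convFour, Matrix.cons_val]
  rw [hv (1, 0) (0, 3) (by decide), hi (0, 2) (1, 0) (by decide), hi (0, 3) (1, 1) (by decide),
    hi (0, 2) (1, 1) (by decide), hv (1, 0) (0, 1) (by decide), hi (0, 1) (1, 1) (by decide),
    hv (1, 2) (0, 3) (by decide), hi (0, 3) (1, 3) (by decide),
    hv (2, 0) (1, 3) (by decide), hi (1, 2) (2, 0) (by decide), hi (1, 3) (2, 1) (by decide),
    hi (1, 2) (2, 1) (by decide), hv (2, 0) (1, 1) (by decide), hi (1, 1) (2, 1) (by decide),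
    hv (2, 2) (1, 3) (by decide), hi (1, 3) (2, 3) (by decide),
    hR (2, 0) (1, 3) (0, 3) (by decide) (by decide) (by decide),
    hL' (0, 2) (1, 2) (2, 0) (by decide) (by decide) (by decide),
    hL' (1, 3) (0, 3) (2, 1) (by decide) (by decide) (by decide),
    hL' (0, 2) (1, 2) (2, 1) (by decide) (by decide) (by decide),
    hR (2, 0) (1, 1) (0, 1) (by decide) (by decide) (by decide),
    hL' (1, 1) (0, 1) (2, 1) (by decide) (by decide) (by decide),
    hR (2, 2) (1, 3) (0, 3) (by decide) (by decide) (by decide),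
    hL' (1, 3) (0, 3) (2, 3) (by decide) (by decide) (by decide),
    hL (1, 0) (2, 0) (0, 3) (by decide) (by decide) (by decide),
    hR' (0, 2) (1, 0) (2, 0) (by decide) (by decide) (by decide),
    hR' (0, 3) (2, 1) (1, 1) (by decide) (by decide) (by decide),
    hR' (0, 2) (2, 1) (1, 1) (by decide) (by decide) (by decide),
    hL (1, 0) (2, 0) (0, 1) (by decide) (by decide) (by decide),
    hR' (0, 1) (2, 1) (1, 1) (by decide) (by decide) (by decide),
    hL (1, 2) (2, 2) (0, 3) (by decide) (by decide) (by decide),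
    hR' (0, 3) (2, 3) (1, 3) (by decide) (by decide) (by decide)]
  exact key

theorem QuasiTriangular.map_twistWord {M' : Type*} [Semiring M'] [Algebra k M'] (φ : M →ₐ[k] M')
    (p q : Fin 4 → H →ₗ[k] M) : φ (𝓡.twistWord p q) =
      𝓡.twistWord (fun a => φ.toLinearMap ∘ₗ p a) (fun a => φ.toLinearMap ∘ₗ q a) := by
  simp only [QuasiTriangular.twistWord, map_mul, map_evalPair]

section intertwine
variable {V : Type*} [AddCommGroup V] [Module k V] {W : Type*} [AddCommGroup W] [Module k W]

theorem evalPair_intertwine (D : V →ₗ[k] W) (p q : H →ₗ[k] Module.End k V)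
    (p' q' : H →ₗ[k] Module.End k W) (hp : ∀ x, D ∘ₗ p x = p' x ∘ₗ D)
    (hq : ∀ x, D ∘ₗ q x = q' x ∘ₗ D) (t : H ⊗[k] H) :
    D ∘ₗ evalPair p q t = evalPair p' q' t ∘ₗ D := by
  induction t with
  | zero => simp
  | tmul a b =>
    simp only [evalPair_tmul, Module.End.mul_eq_comp]
    rw [← LinearMap.comp_assoc, hp, LinearMap.comp_assoc, hq, LinearMap.comp_assoc]
  | add a b ha hb => simp only [map_add, LinearMap.comp_add, LinearMap.add_comp, ha, hb]

theorem mul_intertwine (D : V →ₗ[k] W) {a b : Module.End k V} {a' b' : Module.End k W}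
    (ha : D ∘ₗ a = a' ∘ₗ D) (hb : D ∘ₗ b = b' ∘ₗ D) : D ∘ₗ (a * b) = (a' * b') ∘ₗ D := by
  simp only [Module.End.mul_eq_comp]
  rw [← LinearMap.comp_assoc, ha, LinearMap.comp_assoc, hb, LinearMap.comp_assoc]

theorem QuasiTriangular.twistWord_intertwine (D : V →ₗ[k] W) (p q : Fin 4 → H →ₗ[k] Module.End k V)
    (p' q' : Fin 4 → H →ₗ[k] Module.End k W) (hp : ∀ a x, D ∘ₗ p a x = p' a x ∘ₗ D)
    (hq : ∀ a x, D ∘ₗ q a x = q' a x ∘ₗ D) :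
    D ∘ₗ 𝓡.twistWord p q = 𝓡.twistWord p' q' ∘ₗ D := by
  have e1 := fun a b t => evalPair_intertwine D (p a) (q b) (p' a) (q' b) (hp a) (hq b) t
  have e2 := fun a b t => evalPair_intertwine D (q a) (p b) (q' a) (p' b) (hq a) (hp b) t
  exact mul_intertwine D (mul_intertwine D
    (mul_intertwine D (mul_intertwine D (mul_intertwine D (e2 0 3 _) (e1 2 0 _)) (e1 3 1 _))
      (e1 2 1 _))
    (mul_intertwine D (e2 0 1 _) (e1 1 1 _))) (mul_intertwine D (e2 2 3 _) (e1 3 3 _))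
end intertwine
end Twist

section Antipode
variable {k : Type u} [Field k] {H : Type v} [Ring H] [HopfAlgebra k H]
open WithConv

theorem comul_antipode_eq (x : H) : Coalgebra.comul (R := k) (HopfAlgebra.antipode k x) =
    TensorProduct.map (HopfAlgebra.antipode k) (HopfAlgebra.antipode k)
      (TensorProduct.comm k H H (Coalgebra.comul x)) := by
  let i1 : H →ₐ[k] H ⊗[k] H := Algebra.TensorProduct.includeLeft
  let i2 : H →ₐ[k] H ⊗[k] H := Algebra.TensorProduct.includeRight
  let S : H →ₗ[k] H := HopfAlgebra.antipode k
  have h12 : (toConv i1.toLinearMap * toConv i2.toLinearMap : WithConv (H →ₗ[k] H ⊗[k] H)) =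
      toConv Coalgebra.comul := by
    ext x
    have : ∀ t : H ⊗[k] H, LinearMap.mul' k _ (TensorProduct.map i1.toLinearMap i2.toLinearMap t)
        = t := by
      intro t
      induction t with
      | zero => simp
      | tmul a b => simp [i1, i2]
      | add a b ha hb => simp only [map_add, ha, hb]
    exact this _
  have h21 : (toConv (i2.toLinearMap ∘ₗ S) * toConv (i1.toLinearMap ∘ₗ S) :
      WithConv (H →ₗ[k] H ⊗[k] H)) = toConv (TensorProduct.map S S ∘ₗ
        (TensorProduct.comm k H H).toLinearMap ∘ₗ Coalgebra.comul) := by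
    ext x
    have : ∀ t : H ⊗[k] H, LinearMap.mul' k _ (TensorProduct.map (i2.toLinearMap ∘ₗ S)
        (i1.toLinearMap ∘ₗ S) t) = TensorProduct.map S S (TensorProduct.comm k H H t) := by
      intro t
      induction t with
      | zero => simp
      | tmul a b => simp [i1, i2]
      | add a b ha hb => simp only [map_add, ha, hb]
    exact this _
  have hS : ∀ i : H →ₐ[k] H ⊗[k] H, (toConv (i.toLinearMap ∘ₗ S) * toConv i.toLinearMap :
      WithConv (H →ₗ[k] H ⊗[k] H)) = 1 := by
    intro i
    have := LinearMap.algHom_comp_convMul_distrib i (toConv S) (toConv LinearMap.id)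
    rw [LinearMap.antipode_mul_id] at this
    apply WithConv.ext
    refine Eq.trans this.symm ?_
    ext x; simp
  have hl : (toConv (TensorProduct.map S S ∘ₗ
        (TensorProduct.comm k H H).toLinearMap ∘ₗ Coalgebra.comul) : WithConv (H →ₗ[k] H ⊗[k] H)) *
      toConv Coalgebra.comul = 1 := by
    rw [← h12, ← h21]
    calc _ = toConv (i2.toLinearMap ∘ₗ S) * (toConv (i1.toLinearMap ∘ₗ S) *
          toConv i1.toLinearMap) * toConv i2.toLinearMap := by simp only [mul_assoc]
      _ = 1 := by rw [hS, mul_one, hS]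
  have := left_inv_eq_right_inv hl LinearMap.comul_right_inv
  exact (DFunLike.congr_fun (congrArg WithConv.ofConv this) x).symm

end Antipode

section Actions

section EndTensor
variable (k : Type u) [Field k] (V : Type*) [AddCommGroup V] [Module k V]
  (W : Type*) [AddCommGroup W] [Module k W]

/-- `T ↦ T ⊗ id` as an algebra homomorphism `End V → End (V ⊗ W)`. -/
def endLeft : Module.End k V →ₐ[k] Module.End k (V ⊗[k] W) :=
  AlgHom.ofLinearMap (LinearMap.rTensorHom W) (LinearMap.rTensor_id W V) (LinearMap.rTensor_mul W)

/-- `T ↦ id ⊗ T` as an algebra homomorphism `End V → End (W ⊗ V)`. -/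
def endRight : Module.End k V →ₐ[k] Module.End k (W ⊗[k] V) :=
  AlgHom.ofLinearMap (LinearMap.lTensorHom W) (LinearMap.lTensor_id W V) (LinearMap.lTensor_mul W)

theorem endLeft_apply (T : Module.End k V) : endLeft k V W T = LinearMap.rTensor W T := rfl
theorem endRight_apply (T : Module.End k V) : endRight k V W T = LinearMap.lTensor W T := rfl

@[simp] theorem endLeft_tmul (T : Module.End k V) (v : V) (w : W) :
    endLeft k V W T (v ⊗ₜ w) = T v ⊗ₜ w := rfl
@[simp] theorem endRight_tmul (T : Module.End k V) (v : V) (w : W) :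
    endRight k V W T (w ⊗ₜ v) = w ⊗ₜ T v := rfl
end EndTensor
variable (k : Type u) [Field k] {H : Type v} [Ring H] [HopfAlgebra k H]
variable {A : Type w} [Ring A] [Algebra k A]

/-- The left action of `H` on an algebra `A` by left multiplication `a ↦ i(x) a`. -/
def leftMulAction (i : H →ₐ[k] A) : H →ₐ[k] Module.End k A :=
  (Algebra.lmul k A).comp i

/-- The left action of `H` on an algebra `A` by `a ↦ a i(S(x))`. -/
def rightMulAction (i : H →ₐ[k] A) : H →ₐ[k] Module.End k A :=
  AlgHom.ofLinearMap
    ((LinearMap.mul k A).flip ∘ₗ i.toLinearMap ∘ₗ HopfAlgebra.antipode k)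
    (by ext; simp)
    (fun x y => by ext a; simp [HopfAlgebra.antipode_mul_antidistrib, mul_assoc])

@[simp] theorem leftMulAction_apply (i : H →ₐ[k] A) (x : H) (a : A) :
    leftMulAction k i x a = i x * a := rfl

@[simp] theorem rightMulAction_apply (i : H →ₐ[k] A) (x : H) (a : A) :
    rightMulAction k i x a = a * i (HopfAlgebra.antipode k x) := rfl

variable (H)
/-- The four pairwise commuting left actions of `x` in `H` on `u ⊗ v` in `H ⊗ H`:
`x u ⊗ v`, `u S(x) ⊗ v`, `u ⊗ x v` and `u ⊗ v S(x)`. -/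
def fourActions : Fin 4 → H →ₐ[k] Module.End k (H ⊗[k] H) :=
  ![leftMulAction k Algebra.TensorProduct.includeLeft,
    rightMulAction k Algebra.TensorProduct.includeLeft,
    leftMulAction k Algebra.TensorProduct.includeRight,
    rightMulAction k Algebra.TensorProduct.includeRight]

theorem fourActions_commute (a b : Fin 4) (hab : a ≠ b) (x y : H) :
    Commute (fourActions k H a x) (fourActions k H b y) := by
  refine LinearMap.ext fun c => ?_
  induction c with
  | zero => simp
  | add c d hc hd => simp only [map_add, hc, hd]
  | tmul c d =>
    fin_cases a <;> fin_cases b <;> first | exact absurd rfl hab | simp [fourActions, mul_assoc]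

/-- The four actions of `H` on each of the two factors of `(H ⊗ H) ⊗ (H ⊗ H)`. -/
def copies2 : Fin 2 → Fin 4 → H →ₐ[k] Module.End k ((H ⊗[k] H) ⊗[k] (H ⊗[k] H)) :=
  ![fun a => (endLeft k (H ⊗[k] H) (H ⊗[k] H)).comp (fourActions k H a),
    fun a => (endRight k (H ⊗[k] H) (H ⊗[k] H)).comp (fourActions k H a)]

/-- The four actions of `H` on each of the three factors of `(H ⊗ H) ⊗ ((H ⊗ H) ⊗ (H ⊗ H))`. -/
def copies3 : Fin 3 → Fin 4 →
    H →ₐ[k] Module.End k ((H ⊗[k] H) ⊗[k] ((H ⊗[k] H) ⊗[k] (H ⊗[k] H))) :=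
  ![fun a => (endLeft k (H ⊗[k] H) ((H ⊗[k] H) ⊗[k] (H ⊗[k] H))).comp
      (fourActions k H a),
    fun a => (endRight k ((H ⊗[k] H) ⊗[k] (H ⊗[k] H)) (H ⊗[k] H)).comp
      (copies2 k H 0 a),
    fun a => (endRight k ((H ⊗[k] H) ⊗[k] (H ⊗[k] H)) (H ⊗[k] H)).comp
      (copies2 k H 1 a)]

theorem copies2_commute (i j : Fin 2 × Fin 4) (h : i ≠ j) (x y : H) :
    Commute (copies2 k H i.1 i.2 x) (copies2 k H j.1 j.2 y) := by
  obtain ⟨i, a⟩ := i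
  obtain ⟨j, b⟩ := j
  have key : i = j → Commute (fourActions k H a x) (fourActions k H b y) := fun hij =>
    fourActions_commute k H a b (fun hab => h (by rw [hij, hab])) x y
  fin_cases i <;> fin_cases j
  · exact (key rfl).map (endLeft k (H ⊗[k] H) (H ⊗[k] H))
  · exact (LinearMap.rTensor_comp_lTensor _ _ _).trans (LinearMap.lTensor_comp_rTensor _ _ _).symm
  · exact (LinearMap.lTensor_comp_rTensor _ _ _).trans (LinearMap.rTensor_comp_lTensor _ _ _).symm
  · exact (key rfl).map (endRight k (H ⊗[k] H) (H ⊗[k] H))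

theorem copies3_commute (i j : Fin 3 × Fin 4) (h : i ≠ j) (x y : H) :
    Commute (copies3 k H i.1 i.2 x) (copies3 k H j.1 j.2 y) := by
  obtain ⟨i, a⟩ := i
  obtain ⟨j, b⟩ := j
  have key : i = j → Commute (fourActions k H a x) (fourActions k H b y) := fun hij =>
    fourActions_commute k H a b (fun hab => h (by rw [hij, hab])) x y
  have key2 : ∀ i' j' : Fin 2, (i' = j' → i = j) →
      Commute (copies2 k H i' a x) (copies2 k H j' b y) := fun i' j' hij =>
    copies2_commute k H (i', a) (j', b) (fun h' => h (by
      rw [Prod.mk.injEq] at h' ⊢; exact ⟨hij h'.1, h'.2⟩)) x y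
  fin_cases i <;> fin_cases j
  · exact (key rfl).map (endLeft k (H ⊗[k] H) ((H ⊗[k] H) ⊗[k] (H ⊗[k] H)))
  · exact (LinearMap.rTensor_comp_lTensor _ _ _).trans (LinearMap.lTensor_comp_rTensor _ _ _).symm
  · exact (LinearMap.rTensor_comp_lTensor _ _ _).trans (LinearMap.lTensor_comp_rTensor _ _ _).symm
  · exact (LinearMap.lTensor_comp_rTensor _ _ _).trans (LinearMap.rTensor_comp_lTensor _ _ _).symm
  · exact (key2 0 0 fun _ => rfl).map
      (endRight k ((H ⊗[k] H) ⊗[k] (H ⊗[k] H)) (H ⊗[k] H))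
  · exact (key2 0 1 (by decide)).map
      (endRight k ((H ⊗[k] H) ⊗[k] (H ⊗[k] H)) (H ⊗[k] H))
  · exact (LinearMap.lTensor_comp_rTensor _ _ _).trans (LinearMap.rTensor_comp_lTensor _ _ _).symm
  · exact (key2 1 0 (by decide)).map
      (endRight k ((H ⊗[k] H) ⊗[k] (H ⊗[k] H)) (H ⊗[k] H))
  · exact (key2 1 1 fun _ => rfl).map
      (endRight k ((H ⊗[k] H) ⊗[k] (H ⊗[k] H)) (H ⊗[k] H))

theorem comul_includeLeft (x : H) :
    Coalgebra.comul (R := k) ((Algebra.TensorProduct.includeLeft : H →ₐ[k] H ⊗[k] H) x) =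
      TensorProduct.map (Algebra.TensorProduct.includeLeft : H →ₐ[k] H ⊗[k] H).toLinearMap
        (Algebra.TensorProduct.includeLeft : H →ₐ[k] H ⊗[k] H).toLinearMap
        (Coalgebra.comul x) := by
  have : ∀ t : H ⊗[k] H, TensorProduct.AlgebraTensorModule.tensorTensorTensorComm k k k k H H H H
      (t ⊗ₜ (1 : H ⊗[k] H)) =
      TensorProduct.map (Algebra.TensorProduct.includeLeft : H →ₐ[k] H ⊗[k] H).toLinearMap
        (Algebra.TensorProduct.includeLeft : H →ₐ[k] H ⊗[k] H).toLinearMap t := by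
    intro t
    induction t with
    | zero => simp
    | tmul a b => simp [Algebra.TensorProduct.one_def]
    | add a b ha hb => simp only [map_add, TensorProduct.add_tmul, ha, hb]
  rw [← this]
  simp

theorem comul_includeRight (x : H) :
    Coalgebra.comul (R := k) ((Algebra.TensorProduct.includeRight : H →ₐ[k] H ⊗[k] H) x) =
      TensorProduct.map (Algebra.TensorProduct.includeRight : H →ₐ[k] H ⊗[k] H).toLinearMap
        (Algebra.TensorProduct.includeRight : H →ₐ[k] H ⊗[k] H).toLinearMap
        (Coalgebra.comul x) := by
  have : ∀ t : H ⊗[k] H, TensorProduct.AlgebraTensorModule.tensorTensorTensorComm k k k k H H H H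
      ((1 : H ⊗[k] H) ⊗ₜ t) =
      TensorProduct.map (Algebra.TensorProduct.includeRight : H →ₐ[k] H ⊗[k] H).toLinearMap
        (Algebra.TensorProduct.includeRight : H →ₐ[k] H ⊗[k] H).toLinearMap t := by
    intro t
    induction t with
    | zero => simp
    | tmul a b => simp [Algebra.TensorProduct.one_def]
    | add a b ha hb => simp only [map_add, TensorProduct.tmul_add, ha, hb]
  rw [← this]
  simp

theorem comul_leftMulAction (i : H →ₐ[k] H ⊗[k] H) (hi : ∀ x, Coalgebra.comul (R := k) (i x) =
      TensorProduct.map i.toLinearMap i.toLinearMap (Coalgebra.comul x)) (x : H) :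
    (Coalgebra.comul : H ⊗[k] H →ₗ[k] _) ∘ₗ leftMulAction k i x =
      convPair ((endLeft k (H ⊗[k] H) (H ⊗[k] H)).comp
          (leftMulAction k i)).toLinearMap
        ((endRight k (H ⊗[k] H) (H ⊗[k] H)).comp (leftMulAction k i)).toLinearMap x
        ∘ₗ (Coalgebra.comul : H ⊗[k] H →ₗ[k] _) := by
  have : ∀ (t : H ⊗[k] H) (z : (H ⊗[k] H) ⊗[k] (H ⊗[k] H)),
      evalPair (M := Module.End k ((H ⊗[k] H) ⊗[k] (H ⊗[k] H))) ((endLeft k (H ⊗[k] H) (H ⊗[k] H)).comp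
          (leftMulAction k i)).toLinearMap
        ((endRight k (H ⊗[k] H) (H ⊗[k] H)).comp
          (leftMulAction k i)).toLinearMap t z =
      TensorProduct.map i.toLinearMap i.toLinearMap t * z := by
    intro t z
    induction t with
    | zero => simp
    | add a b ha hb => simp only [map_add, LinearMap.add_apply, add_mul, ha, hb]
    | tmul a b =>
      induction z with
      | zero => simp
      | add c d hc hd => simp only [map_add, mul_add, hc, hd]
      | tmul c d => simp
  refine LinearMap.ext fun c => ?_
  rw [LinearMap.comp_apply, LinearMap.comp_apply, leftMulAction_apply, Bialgebra.comul_mul, hi]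
  exact (this _ _).symm

theorem comul_rightMulAction (i : H →ₐ[k] H ⊗[k] H) (hi : ∀ x, Coalgebra.comul (R := k) (i x) =
      TensorProduct.map i.toLinearMap i.toLinearMap (Coalgebra.comul x)) (x : H) :
    (Coalgebra.comul : H ⊗[k] H →ₗ[k] _) ∘ₗ rightMulAction k i x =
      convPair ((endRight k (H ⊗[k] H) (H ⊗[k] H)).comp
          (rightMulAction k i)).toLinearMap
        ((endLeft k (H ⊗[k] H) (H ⊗[k] H)).comp
          (rightMulAction k i)).toLinearMap x
        ∘ₗ (Coalgebra.comul : H ⊗[k] H →ₗ[k] _) := by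
  have : ∀ (t : H ⊗[k] H) (z : (H ⊗[k] H) ⊗[k] (H ⊗[k] H)),
      evalPair (M := Module.End k ((H ⊗[k] H) ⊗[k] (H ⊗[k] H))) ((endRight k (H ⊗[k] H) (H ⊗[k] H)).comp
          (rightMulAction k i)).toLinearMap
        ((endLeft k (H ⊗[k] H) (H ⊗[k] H)).comp
          (rightMulAction k i)).toLinearMap t z =
      z * TensorProduct.map i.toLinearMap i.toLinearMap
        (TensorProduct.map (HopfAlgebra.antipode k) (HopfAlgebra.antipode k)
          (TensorProduct.comm k H H t)) := by
    intro t z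
    induction t with
    | zero => simp
    | add a b ha hb => simp only [map_add, LinearMap.add_apply, mul_add, ha, hb]
    | tmul a b =>
      induction z with
      | zero => simp
      | add c d hc hd => simp only [map_add, add_mul, hc, hd]
      | tmul c d => simp
  refine LinearMap.ext fun c => ?_
  rw [LinearMap.comp_apply, LinearMap.comp_apply, rightMulAction_apply, Bialgebra.comul_mul, hi,
    comul_antipode_eq]
  exact (this _ _).symm

theorem comul_fourActions (a : Fin 4) (x : H) :
    (Coalgebra.comul : H ⊗[k] H →ₗ[k] _) ∘ₗ fourActions k H a x =
      convFour (fun a => (copies2 k H 0 a).toLinearMap) (fun a => (copies2 k H 1 a).toLinearMap) a x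
        ∘ₗ (Coalgebra.comul : H ⊗[k] H →ₗ[k] _) := by
  fin_cases a
  · exact comul_leftMulAction k H _ (comul_includeLeft k H) x
  · exact comul_rightMulAction k H _ (comul_includeLeft k H) x
  · exact comul_leftMulAction k H _ (comul_includeRight k H) x
  · exact comul_rightMulAction k H _ (comul_includeRight k H) x

theorem counit_fourActions (a : Fin 4) (x : H) :
    (Coalgebra.counit : H ⊗[k] H →ₗ[k] k) ∘ₗ fourActions k H a x =
      Coalgebra.counit (R := k) x • (Coalgebra.counit : H ⊗[k] H →ₗ[k] k) := by
  refine TensorProduct.ext' fun c d => ?_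
  fin_cases a <;> simp [fourActions] <;> ring
end Actions

section EllipticCoalgebra
variable {k : Type u} [Field k] {H : Type v} [Ring H] [HopfAlgebra k H]

/-- The vector space `H ⊗ H`, to be equipped with the coalgebra structure dual to the product of the
elliptic double. -/
def EllipticCoalgebra (_𝓡 : QuasiTriangular k H) : Type _ := H ⊗[k] H

variable (𝓡 : QuasiTriangular k H)

instance : AddCommGroup (EllipticCoalgebra 𝓡) := inferInstanceAs (AddCommGroup (H ⊗[k] H))
instance : Module k (EllipticCoalgebra 𝓡) := inferInstanceAs (Module k (H ⊗[k] H))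

/-- The coproduct of `H ⊗ H` dual to the product of the elliptic double. Write
`R = ∑ r₁ ⊗ r₂`, `R⁻¹ = ∑ r'₁ ⊗ r'₂`. For the product of the twisted braided dual put
`Δ'(u) = ∑ u₁ S(r'₁) S(r₂) ⊗ r₁ u₂ S(r'₂)`, with independent copies of `R` and `R⁻¹`. Then
`u ⊗ v` goes to `∑ (u' ⊗ a) ⊗ (b ⊗ v'')`, where `Δ'(u) = ∑ u' ⊗ u''`, `Δ'(v) = ∑ v' ⊗ v''` and
`a ⊗ b` is obtained from `v' ⊗ u''` by the braiding of the two copies of the braided dual: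
one applies, in this order, the operators
`v' ⊗ u'' ↦ r'₁ v' ⊗ u'' S(r'₂)`, `v' S(r'₁) ⊗ u'' S(r'₂)`, `r'₁ v' ⊗ r'₂ u''`,
`v' S(r₂) ⊗ r₁ u''`. -/
def ellipticComul : H ⊗[k] H →ₗ[k] (H ⊗[k] H) ⊗[k] (H ⊗[k] H) :=
  𝓡.twistWord (fun a => (copies2 k H 0 a).toLinearMap) (fun a => (copies2 k H 1 a).toLinearMap) ∘ₗ
    Coalgebra.comul

theorem assoc_rTensor_comul : (TensorProduct.assoc k _ _ _).toLinearMap ∘ₗ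
    (ellipticComul 𝓡).rTensor (H ⊗[k] H) ∘ₗ ellipticComul 𝓡 =
    (ellipticComul 𝓡).lTensor (H ⊗[k] H) ∘ₗ ellipticComul 𝓡 := by
  let C := H ⊗[k] H
  let δ : C →ₗ[k] C ⊗[k] C := Coalgebra.comul
  let T : Module.End k (C ⊗[k] C) := 𝓡.twistWord (fun a => (copies2 k H 0 a).toLinearMap)
    (fun a => (copies2 k H 1 a).toLinearMap)
  let f := copies3 k H
  let as : (C ⊗[k] C) ⊗[k] C ≃ₗ[k] C ⊗[k] (C ⊗[k] C) := TensorProduct.assoc k C C C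
  let E12 : Module.End k (C ⊗[k] C) →ₐ[k] Module.End k (C ⊗[k] (C ⊗[k] C)) :=
    (as.conjAlgEquiv k).toAlgHom.comp (endLeft k (C ⊗[k] C) C)
  let E23 : Module.End k (C ⊗[k] C) →ₐ[k] Module.End k (C ⊗[k] (C ⊗[k] C)) :=
    endRight k (C ⊗[k] C) C
  let D12 : C ⊗[k] C →ₗ[k] C ⊗[k] (C ⊗[k] C) := as.toLinearMap ∘ₗ δ.rTensor C
  let D23 : C ⊗[k] C →ₗ[k] C ⊗[k] (C ⊗[k] C) := δ.lTensor C
  have e12_0 : ∀ a x, E12 (copies2 k H 0 a x) = f 0 a x := fun a x =>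
    TensorProduct.ext' fun c d => by
      induction d with
      | zero => simp
      | add d e hd he => simp only [TensorProduct.tmul_add, map_add, hd, he]
      | tmul d e => simp [E12, f, copies2, copies3, as, LinearEquiv.conjAlgEquiv_apply]
  have e12_1 : ∀ a x, E12 (copies2 k H 1 a x) = f 1 a x := fun a x =>
    TensorProduct.ext' fun c d => by
      induction d with
      | zero => simp
      | add d e hd he => simp only [TensorProduct.tmul_add, map_add, hd, he]
      | tmul d e => simp [E12, f, copies2, copies3, as, LinearEquiv.conjAlgEquiv_apply]
  have hE12 : E12 T = 𝓡.twistWord (fun a => (f 0 a).toLinearMap)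
      (fun a => (f 1 a).toLinearMap) := by
    rw [QuasiTriangular.map_twistWord]
    congr 1
    · funext a; exact LinearMap.ext fun x => e12_0 a x
    · funext a; exact LinearMap.ext fun x => e12_1 a x
  have hE23 : E23 T = 𝓡.twistWord (fun a => (f 1 a).toLinearMap)
      (fun a => (f 2 a).toLinearMap) := by
    rw [QuasiTriangular.map_twistWord]
    rfl
  have cf12 : ∀ a x, E12 (convFour (fun a => (copies2 k H 0 a).toLinearMap)
      (fun a => (copies2 k H 1 a).toLinearMap) a x) =
      convFour (fun a => (f 0 a).toLinearMap) (fun a => (f 1 a).toLinearMap) a x := by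
    intro a x
    have h0 : ∀ a, E12.toLinearMap ∘ₗ (copies2 k H 0 a).toLinearMap = (f 0 a).toLinearMap :=
      fun a => LinearMap.ext fun x => e12_0 a x
    have h1 : ∀ a, E12.toLinearMap ∘ₗ (copies2 k H 1 a).toLinearMap = (f 1 a).toLinearMap :=
      fun a => LinearMap.ext fun x => e12_1 a x
    fin_cases a <;> refine (map_evalPair E12 _ _ _).trans ?_ <;> simp only [h0, h1] <;> rfl
  have cf23 : ∀ a x, E23 (convFour (fun a => (copies2 k H 0 a).toLinearMap)
      (fun a => (copies2 k H 1 a).toLinearMap) a x) =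
      convFour (fun a => (f 1 a).toLinearMap) (fun a => (f 2 a).toLinearMap) a x := by
    intro a x
    fin_cases a <;> exact map_evalPair E23 _ _ _
  have hD12 : ∀ U V, δ ∘ₗ U = V ∘ₗ δ → D12 ∘ₗ U.rTensor C = E12 V ∘ₗ D12 := by
    intro U V h
    refine LinearMap.ext fun z => ?_
    have := LinearMap.congr_fun (congrArg (LinearMap.rTensor C) h) z
    simp only [LinearMap.rTensor_comp, LinearMap.comp_apply] at this
    simp [D12, E12, LinearEquiv.conjAlgEquiv_apply, endLeft_apply, this]
  have hD23 : ∀ U V, δ ∘ₗ U = V ∘ₗ δ → D23 ∘ₗ U.lTensor C = E23 V ∘ₗ D23 := by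
    intro U V h
    have := (congrArg (LinearMap.lTensor C) h)
    rw [LinearMap.lTensor_comp, LinearMap.lTensor_comp] at this
    exact this
  have i12 : D12 ∘ₗ T = 𝓡.twistWord
      (convFour (fun a => (f 0 a).toLinearMap) (fun a => (f 1 a).toLinearMap))
      (fun a => (f 2 a).toLinearMap) ∘ₗ D12 := by
    apply QuasiTriangular.twistWord_intertwine
    · intro a x
      refine (hD12 _ _ (comul_fourActions k H a x)).trans ?_
      rw [cf12]
    · intro a x
      refine LinearMap.ext fun z => ?_
      induction z with
      | zero => simp
      | add a b ha hb => simp only [map_add, ha, hb]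
      | tmul c d =>
        have : ∀ w : C ⊗[k] C, as (w ⊗ₜ (fourActions k H a x d)) = f 2 a x (as (w ⊗ₜ d)) := by
          intro w
          induction w with
          | zero => simp
          | add a b ha hb => simp only [TensorProduct.add_tmul, map_add, ha, hb]
          | tmul e g => simp [as, f, copies3, copies2]
        exact this _
  have i23 : D23 ∘ₗ T = 𝓡.twistWord (fun a => (f 0 a).toLinearMap)
      (convFour (fun a => (f 1 a).toLinearMap) (fun a => (f 2 a).toLinearMap)) ∘ₗ D23 := by
    apply QuasiTriangular.twistWord_intertwine
    · intro a x
      refine TensorProduct.ext' fun c d => ?_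
      simp [D23, f, copies3, copies2]
    · intro a x
      refine (hD23 _ _ (comul_fourActions k H a x)).trans ?_
      rw [cf23]
  have coa : D12 ∘ₗ δ = D23 ∘ₗ δ := Coalgebra.coassoc
  have l1 : as.toLinearMap ∘ₗ (T ∘ₗ δ).rTensor C = E12 T ∘ₗ D12 := by
    refine LinearMap.ext fun z => ?_
    simp [D12, E12, LinearEquiv.conjAlgEquiv_apply, endLeft_apply, LinearMap.rTensor_comp]
  have l2 : (T ∘ₗ δ).lTensor C = E23 T ∘ₗ D23 := LinearMap.lTensor_comp _ _ _
  have key := 𝓡.twistWord_cocycle f (copies3_commute k H)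
  rw [← hE12, ← hE23] at key
  refine LinearMap.ext fun z => ?_
  have m1 := LinearMap.congr_fun l1 (T (δ z))
  have m2 := LinearMap.congr_fun l2 (T (δ z))
  have m3 := LinearMap.congr_fun i12 (δ z)
  have m4 := LinearMap.congr_fun i23 (δ z)
  have m5 := LinearMap.congr_fun coa z
  have m6 := LinearMap.congr_fun key (D23 (δ z))
  simp only [LinearMap.comp_apply] at m1 m2 m3 m4 m5
  simp only [Module.End.mul_apply] at m6
  rw [m3, m5] at m1
  rw [m4, ← m6] at m2
  exact m1.trans m2.symm
end EllipticCoalgebra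

section Counit
variable {k : Type u} [Field k] {H : Type v} [Ring H] [HopfAlgebra k H] (𝓡 : QuasiTriangular k H)
variable {M : Type w} [Semiring M] [Algebra k M]

variable (k H M) in
/-- the homomorphism `x ↦ ε(x) 1` -/
def trivHom : H →ₐ[k] M := (Algebra.ofId k M).comp (Bialgebra.counitAlgHom k H)

theorem trivHom_apply (x : H) : trivHom k H M x = algebraMap k M (Coalgebra.counit x) := rfl

theorem trivHom_commute (x : H) (m : M) : Commute (trivHom k H M x) m :=
  Algebra.commutes _ _

theorem pairUnit_triv_left (q : H →ₐ[k] M) :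
    𝓡.pairUnit (trivHom k H M) q (fun x y => trivHom_commute x (q y)) = 1 := by
  refine Units.ext ?_
  rw [QuasiTriangular.pairUnit_val]
  have : ∀ t : H ⊗[k] H, evalPair (trivHom k H M).toLinearMap q.toLinearMap t =
      q (TensorProduct.lid k H (TensorProduct.map Coalgebra.counit LinearMap.id t)) := by
    intro t
    induction t with
    | zero => simp
    | tmul a b => simp [trivHom_apply, Algebra.smul_def]
    | add a b ha hb => simp only [map_add, ha, hb]
  rw [this, 𝓡.counit_left, map_one]; rfl

theorem pairUnit_triv_right (q : H →ₐ[k] M) :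
    𝓡.pairUnit q (trivHom k H M) (fun x y => (trivHom_commute y (q x)).symm) = 1 := by
  refine Units.ext ?_
  rw [QuasiTriangular.pairUnit_val]
  have : ∀ t : H ⊗[k] H, evalPair q.toLinearMap (trivHom k H M).toLinearMap t =
      q (TensorProduct.rid k H (TensorProduct.map LinearMap.id Coalgebra.counit t)) := by
    intro t
    induction t with
    | zero => simp
    | tmul a b => simp [trivHom_apply, Algebra.smul_def, Algebra.commutes]
    | add a b ha hb => simp only [map_add, ha, hb]
  rw [this, 𝓡.counit_right, map_one]; rfl

theorem evalPair_triv (q : H →ₐ[k] M) :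
    evalPair (trivHom k H M).toLinearMap q.toLinearMap (𝓡.R : H ⊗[k] H) = 1 ∧
    evalPair (trivHom k H M).toLinearMap q.toLinearMap (↑𝓡.R⁻¹ : H ⊗[k] H) = 1 ∧
    evalPair q.toLinearMap (trivHom k H M).toLinearMap (𝓡.R : H ⊗[k] H) = 1 ∧
    evalPair q.toLinearMap (trivHom k H M).toLinearMap (↑𝓡.R⁻¹ : H ⊗[k] H) = 1 := by
  have hl := pairUnit_triv_left 𝓡 q
  have hr := pairUnit_triv_right 𝓡 q
  refine ⟨?_, ?_, ?_, ?_⟩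
  · rw [← QuasiTriangular.pairUnit_val 𝓡 _ _ (fun x y => trivHom_commute x (q y)), hl]; rfl
  · rw [← QuasiTriangular.pairUnit_inv 𝓡 _ _ (fun x y => trivHom_commute x (q y)), hl, inv_one]; rfl
  · rw [← QuasiTriangular.pairUnit_val 𝓡 _ _ (fun x y => (trivHom_commute y (q x)).symm), hr]; rfl
  · rw [← QuasiTriangular.pairUnit_inv 𝓡 _ _ (fun x y => (trivHom_commute y (q x)).symm), hr, inv_one]; rfl

theorem twistWord_triv_left (q : Fin 4 → H →ₐ[k] M) :
    𝓡.twistWord (fun _ => (trivHom k H M).toLinearMap) (fun a => (q a).toLinearMap) = 1 := by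
  simp [QuasiTriangular.twistWord, evalPair_triv]

theorem twistWord_triv_right (q : Fin 4 → H →ₐ[k] M) :
    𝓡.twistWord (fun a => (q a).toLinearMap) (fun _ => (trivHom k H M).toLinearMap) = 1 := by
  simp [QuasiTriangular.twistWord, evalPair_triv]

theorem rTensor_counit_ellipticComul :
    (Coalgebra.counit : H ⊗[k] H →ₗ[k] k).rTensor (H ⊗[k] H) ∘ₗ ellipticComul 𝓡 =
      TensorProduct.mk k k (H ⊗[k] H) 1 := by
  let L : (H ⊗[k] H) ⊗[k] (H ⊗[k] H) →ₗ[k] H ⊗[k] H := (TensorProduct.lid k _).toLinearMap ∘ₗ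
    (Coalgebra.counit : H ⊗[k] H →ₗ[k] k).rTensor (H ⊗[k] H)
  have h := 𝓡.twistWord_intertwine L (fun a => (copies2 k H 0 a).toLinearMap)
    (fun a => (copies2 k H 1 a).toLinearMap) (fun _ => (trivHom k H _).toLinearMap)
    (fun a => (fourActions k H a).toLinearMap) ?_ ?_
  · rw [twistWord_triv_left] at h
    refine LinearMap.ext fun z => (TensorProduct.lid k _).injective ?_
    refine (LinearMap.congr_fun h (Coalgebra.comul z)).trans ?_
    change TensorProduct.lid k _ ((Coalgebra.counit : H ⊗[k] H →ₗ[k] k).rTensor (H ⊗[k] H)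
      (Coalgebra.comul z)) = _
    rw [Coalgebra.rTensor_counit_comul]
    rfl
  · intro a x
    refine TensorProduct.ext' fun c d => ?_
    have := LinearMap.congr_fun (counit_fourActions k H a x) c
    simp only [LinearMap.comp_apply, LinearMap.smul_apply, smul_eq_mul] at this
    simp [L, copies2, trivHom_apply, this, mul_smul, smul_comm (Coalgebra.counit (R := k) x)]
  · intro a x
    refine TensorProduct.ext' fun c d => ?_
    simp [L, copies2]

theorem lTensor_counit_ellipticComul :
    (Coalgebra.counit : H ⊗[k] H →ₗ[k] k).lTensor (H ⊗[k] H) ∘ₗ ellipticComul 𝓡 =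
      (TensorProduct.mk k (H ⊗[k] H) k).flip 1 := by
  let L : (H ⊗[k] H) ⊗[k] (H ⊗[k] H) →ₗ[k] H ⊗[k] H := (TensorProduct.rid k _).toLinearMap ∘ₗ
    (Coalgebra.counit : H ⊗[k] H →ₗ[k] k).lTensor (H ⊗[k] H)
  have h := 𝓡.twistWord_intertwine L (fun a => (copies2 k H 0 a).toLinearMap)
    (fun a => (copies2 k H 1 a).toLinearMap) (fun a => (fourActions k H a).toLinearMap)
    (fun _ => (trivHom k H _).toLinearMap) ?_ ?_
  · rw [twistWord_triv_right] at h
    refine LinearMap.ext fun z => (TensorProduct.rid k _).injective ?_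
    refine (LinearMap.congr_fun h (Coalgebra.comul z)).trans ?_
    change TensorProduct.rid k _ ((Coalgebra.counit : H ⊗[k] H →ₗ[k] k).lTensor (H ⊗[k] H)
      (Coalgebra.comul z)) = _
    rw [Coalgebra.lTensor_counit_comul]
    rfl
  · intro a x
    refine TensorProduct.ext' fun c d => ?_
    simp [L, copies2]
  · intro a x
    refine TensorProduct.ext' fun c d => ?_
    have := LinearMap.congr_fun (counit_fourActions k H a x) d
    simp only [LinearMap.comp_apply, LinearMap.smul_apply, smul_eq_mul] at this
    simp [L, copies2, trivHom_apply, this, mul_smul, smul_comm (Coalgebra.counit (R := k) x)]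

instance EllipticCoalgebra.instCoalgebra : Coalgebra k (EllipticCoalgebra 𝓡) where
  comul := ellipticComul 𝓡
  counit := (Coalgebra.counit : H ⊗[k] H →ₗ[k] k)
  coassoc := assoc_rTensor_comul 𝓡
  rTensor_counit_comp_comul := rTensor_counit_ellipticComul 𝓡
  lTensor_counit_comp_comul := lTensor_counit_ellipticComul 𝓡
end Counit

section EllipticDouble
variable {k : Type u} [Field k] {H : Type v} [Ring H] [HopfAlgebra k H]
open WithConv

theorem RestrictedDual.tensor_mem {A : Type v} [Ring A] [Algebra k A] {B : Type w} [Ring B]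
    [Algebra k B] {f : Module.Dual k A} (hf : f ∈ RestrictedDual k A) {g : Module.Dual k B}
    (hg : g ∈ RestrictedDual k B) :
    TensorProduct.dualDistrib k A B (f ⊗ₜ g) ∈ RestrictedDual k (A ⊗[k] B) := by
  rw [mem_iff] at hf hg ⊢
  obtain ⟨s, hs⟩ := hf
  obtain ⟨t, ht⟩ := hg
  refine ⟨TensorProduct.map (TensorProduct.dualDistrib k A B) (TensorProduct.dualDistrib k A B)
    (TensorProduct.tensorTensorTensorComm k _ _ _ _ (s ⊗ₜ t)), fun x y => ?_⟩
  induction x with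
  | zero => simp
  | add x x' hx hx' => simp only [TensorProduct.add_tmul, map_add, add_mul, hx, hx']
  | tmul a b =>
    induction y with
    | zero => simp
    | add y y' hy hy' => simp only [TensorProduct.tmul_add, map_add, mul_add, hy, hy']
    | tmul c d =>
      have : ∀ s t, TensorProduct.dualDistrib k (A ⊗[k] B) (A ⊗[k] B)
          (TensorProduct.map (TensorProduct.dualDistrib k A B) (TensorProduct.dualDistrib k A B)
          (TensorProduct.tensorTensorTensorComm k _ _ _ _ (s ⊗ₜ t)))
          ((a ⊗ₜ b) ⊗ₜ (c ⊗ₜ d)) =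
          TensorProduct.dualDistrib k A A s (a ⊗ₜ c) *
            TensorProduct.dualDistrib k B B t (b ⊗ₜ d) := by
        intro s t
        induction s with
        | zero => simp
        | add s s' h h' =>
          simp only [TensorProduct.add_tmul, map_add, LinearMap.add_apply, add_mul, h, h']
        | tmul p q =>
          induction t with
          | zero => simp
          | add t t' h h' =>
            simp only [TensorProduct.tmul_add, map_add, LinearMap.add_apply, mul_add, h, h']
          | tmul r u => simp; ring
      rw [this, hs, ht]; simp

variable (k H) in
/-- The functionals `u ⊗ v ↦ ∑ f(u) g(v)`, with `f`, `g` in `H°`. -/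
def tensorFunctionals : Submodule k (H ⊗[k] H →ₗ[k] k) :=
  LinearMap.range (RestrictedDual.pair2 k H)

theorem tmul_mem_tensorFunctionals (f g : RestrictedDual k H) :
    TensorProduct.dualDistrib k H H (f.1 ⊗ₜ g.1) ∈ tensorFunctionals k H :=
  ⟨f ⊗ₜ g, rfl⟩

theorem tensorFunctionals_induction {p : (H ⊗[k] H →ₗ[k] k) → Prop} (h0 : p 0)
    (hadd : ∀ φ ψ, p φ → p ψ → p (φ + ψ))
    (h : ∀ f g : RestrictedDual k H, p (TensorProduct.dualDistrib k H H (f.1 ⊗ₜ g.1)))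
    {φ : H ⊗[k] H →ₗ[k] k} (hφ : φ ∈ tensorFunctionals k H) : p φ := by
  obtain ⟨t, rfl⟩ := hφ
  induction t with
  | zero => simpa using h0
  | tmul a b => exact h a b
  | add a b ha hb => rw [map_add]; exact hadd _ _ ha hb

theorem comp_fourActions_mem (a : Fin 4) (x : H) {φ : H ⊗[k] H →ₗ[k] k}
    (hφ : φ ∈ tensorFunctionals k H) :
    φ ∘ₗ (fourActions k H a x : Module.End k (H ⊗[k] H)) ∈ tensorFunctionals k H := by
  refine tensorFunctionals_induction (p := fun φ =>
    φ ∘ₗ (fourActions k H a x : Module.End k (H ⊗[k] H)) ∈ tensorFunctionals k H) ?_ ?_ ?_ hφ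
  · rw [LinearMap.zero_comp]; exact zero_mem _
  · intro φ ψ h1 h2
    rw [LinearMap.add_comp]; exact add_mem h1 h2
  · intro f g
    have key : ∀ f' g' : Module.Dual k H, f' ∈ RestrictedDual k H → g' ∈ RestrictedDual k H →
        (∀ c d, TensorProduct.dualDistrib k H H (f.1 ⊗ₜ g.1) (fourActions k H a x (c ⊗ₜ d)) =
          f' c * g' d) → TensorProduct.dualDistrib k H H (f.1 ⊗ₜ g.1) ∘ₗ
            (fourActions k H a x : Module.End k (H ⊗[k] H)) ∈ tensorFunctionals k H := by
      intro f' g' hf hg h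
      refine ⟨(⟨f', hf⟩ : RestrictedDual k H) ⊗ₜ (⟨g', hg⟩ : RestrictedDual k H),
        TensorProduct.ext' fun c d => ?_⟩
      exact (h c d).symm
    have hl : ∀ f : RestrictedDual k H, ∀ x, f.1 ∘ₗ LinearMap.mulLeft k x ∈ RestrictedDual k H :=
      fun f x => by simpa using RestrictedDual.translate_mem x 1 f.2
    have hr : ∀ f : RestrictedDual k H, ∀ x, f.1 ∘ₗ LinearMap.mulRight k x ∈ RestrictedDual k H :=
      fun f x => by simpa using RestrictedDual.translate_mem 1 x f.2
    fin_cases a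
    · exact key _ _ (hl f x) g.2 (fun c d => by simp [fourActions])
    · exact key _ _ (hr f (HopfAlgebra.antipode k x)) g.2 (fun c d => by simp [fourActions])
    · exact key _ _ f.2 (hl g x) (fun c d => by simp [fourActions])
    · exact key _ _ f.2 (hr g (HopfAlgebra.antipode k x)) (fun c d => by simp [fourActions])

variable (k H) in
/-- The operators on `(H ⊗ H) ⊗ (H ⊗ H)` whose transpose preserves the span of products of
functionals in `tensorFunctionals`. -/
def preservingOps : Submodule k (Module.End k ((H ⊗[k] H) ⊗[k] (H ⊗[k] H))) where
  carrier := {T | ∀ φ ∈ tensorFunctionals k H, ∀ ψ ∈ tensorFunctionals k H,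
    TensorProduct.dualDistrib k _ _ (φ ⊗ₜ ψ) ∘ₗ T ∈ Submodule.span k
      {χ | ∃ φ ∈ tensorFunctionals k H, ∃ ψ ∈ tensorFunctionals k H,
        χ = TensorProduct.dualDistrib k (H ⊗[k] H) (H ⊗[k] H) (φ ⊗ₜ ψ)}}
  add_mem' hS hT φ hφ ψ hψ := by
    rw [LinearMap.comp_add]; exact add_mem (hS φ hφ ψ hψ) (hT φ hφ ψ hψ)
  zero_mem' φ hφ ψ hψ := by rw [LinearMap.comp_zero]; exact zero_mem _
  smul_mem' c T hT φ hφ ψ hψ := by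
    rw [LinearMap.comp_smul]; exact Submodule.smul_mem _ c (hT φ hφ ψ hψ)

theorem preservingOps_mul {S T : Module.End k ((H ⊗[k] H) ⊗[k] (H ⊗[k] H))}
    (hS : S ∈ preservingOps k H) (hT : T ∈ preservingOps k H) : S * T ∈ preservingOps k H := by
  intro φ hφ ψ hψ
  have h := hS φ hφ ψ hψ
  rw [Module.End.mul_eq_comp, ← LinearMap.comp_assoc]
  generalize TensorProduct.dualDistrib k (H ⊗[k] H) (H ⊗[k] H) (φ ⊗ₜ ψ) ∘ₗ S = χ at h ⊢
  induction h using Submodule.span_induction with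
  | mem χ h =>
    obtain ⟨φ', hφ', ψ', hψ', rfl⟩ := h
    exact hT φ' hφ' ψ' hψ'
  | zero => rw [LinearMap.zero_comp]; exact zero_mem _
  | add χ χ' _ _ h h' => rw [LinearMap.add_comp]; exact add_mem h h'
  | smul c χ _ h => rw [LinearMap.smul_comp]; exact Submodule.smul_mem _ c h

theorem copies2_mem (i : Fin 2) (a : Fin 4) (x : H) : copies2 k H i a x ∈ preservingOps k H := by
  intro φ hφ ψ hψ
  apply Submodule.subset_span
  fin_cases i
  · exact ⟨_, comp_fourActions_mem a x hφ, ψ, hψ, TensorProduct.ext' fun c d => rfl⟩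
  · exact ⟨φ, hφ, _, comp_fourActions_mem a x hψ, TensorProduct.ext' fun c d => rfl⟩

theorem evalPair_copies2_mem (i j : Fin 2) (a b : Fin 4) (t : H ⊗[k] H) :
    evalPair (copies2 k H i a).toLinearMap (copies2 k H j b).toLinearMap t ∈
      preservingOps k H := by
  induction t with
  | zero => rw [map_zero]; exact zero_mem _
  | tmul x y =>
    rw [evalPair_tmul]
    exact preservingOps_mul (copies2_mem i a x) (copies2_mem j b y)
  | add s t hs ht => rw [map_add]; exact add_mem hs ht

theorem twistWord_mem (𝓡 : QuasiTriangular k H) :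
    𝓡.twistWord (fun a => (copies2 k H 0 a).toLinearMap) (fun a => (copies2 k H 1 a).toLinearMap) ∈
      preservingOps k H := by
  have e := fun i j a b t => evalPair_copies2_mem (k := k) (H := H) i j a b t
  exact preservingOps_mul (preservingOps_mul (preservingOps_mul (preservingOps_mul
    (preservingOps_mul (e _ _ _ _ _) (e _ _ _ _ _)) (e _ _ _ _ _)) (e _ _ _ _ _))
    (preservingOps_mul (e _ _ _ _ _) (e _ _ _ _ _)))
    (preservingOps_mul (e _ _ _ _ _) (e _ _ _ _ _))

theorem comp_comul_mem {φ ψ : H ⊗[k] H →ₗ[k] k} (hφ : φ ∈ tensorFunctionals k H)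
    (hψ : ψ ∈ tensorFunctionals k H) :
    TensorProduct.dualDistrib k _ _ (φ ⊗ₜ ψ) ∘ₗ
      (Coalgebra.comul : H ⊗[k] H →ₗ[k] (H ⊗[k] H) ⊗[k] (H ⊗[k] H)) ∈ tensorFunctionals k H := by
  refine tensorFunctionals_induction (p := fun φ => TensorProduct.dualDistrib k _ _ (φ ⊗ₜ ψ) ∘ₗ
      (Coalgebra.comul : H ⊗[k] H →ₗ[k] (H ⊗[k] H) ⊗[k] (H ⊗[k] H)) ∈ tensorFunctionals k H)
    ?_ ?_ ?_ hφ
  · rw [TensorProduct.zero_tmul, map_zero, LinearMap.zero_comp]; exact zero_mem _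
  · intro φ φ' h1 h2
    rw [TensorProduct.add_tmul, map_add, LinearMap.add_comp]; exact add_mem h1 h2
  intro f g
  refine tensorFunctionals_induction (p := fun ψ => TensorProduct.dualDistrib k _ _
      (TensorProduct.dualDistrib k H H (f.1 ⊗ₜ g.1) ⊗ₜ ψ) ∘ₗ
      (Coalgebra.comul : H ⊗[k] H →ₗ[k] (H ⊗[k] H) ⊗[k] (H ⊗[k] H)) ∈ tensorFunctionals k H)
    ?_ ?_ ?_ hψ
  · rw [TensorProduct.tmul_zero, map_zero, LinearMap.zero_comp]; exact zero_mem _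
  · intro φ φ' h1 h2
    rw [TensorProduct.tmul_add, map_add, LinearMap.add_comp]; exact add_mem h1 h2
  intro f' g'
  have hconv : ∀ f f' : RestrictedDual k H, TensorProduct.dualDistrib k H H (f.1 ⊗ₜ f'.1) ∘ₗ
      (Bialgebra.comulAlgHom k H).toLinearMap ∈ RestrictedDual k H := fun f f' =>
    RestrictedDual.comp_mem _ (RestrictedDual.tensor_mem f.2 f'.2)
  refine ⟨(⟨_, hconv f f'⟩ : RestrictedDual k H) ⊗ₜ (⟨_, hconv g g'⟩ : RestrictedDual k H),
    TensorProduct.ext' fun u v => ?_⟩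
  have : ∀ s t : H ⊗[k] H, TensorProduct.dualDistrib k H H (f.1 ⊗ₜ f'.1) s *
      TensorProduct.dualDistrib k H H (g.1 ⊗ₜ g'.1) t =
      TensorProduct.dualDistrib k _ _ (TensorProduct.dualDistrib k H H (f.1 ⊗ₜ g.1) ⊗ₜ
        TensorProduct.dualDistrib k H H (f'.1 ⊗ₜ g'.1))
        (TensorProduct.AlgebraTensorModule.tensorTensorTensorComm k k k k H H H H (s ⊗ₜ t)) := by
    intro s t
    induction s with
    | zero => simp
    | add s s' h h' => simp only [TensorProduct.add_tmul, map_add, add_mul, h, h']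
    | tmul p q =>
      induction t with
      | zero => simp
      | add t t' h h' => simp only [TensorProduct.tmul_add, map_add, mul_add, h, h']
      | tmul r u => simp; ring
  exact this _ _

theorem conv_mem (𝓡 : QuasiTriangular k H) {φ ψ : WithConv (EllipticCoalgebra 𝓡 →ₗ[k] k)}
    (hφ : φ.ofConv ∈ tensorFunctionals k H) (hψ : ψ.ofConv ∈ tensorFunctionals k H) :
    (φ * ψ).ofConv ∈ tensorFunctionals k H := by
  have h1 := twistWord_mem 𝓡 _ hφ _ hψ
  have hm : ∀ t : (H ⊗[k] H) ⊗[k] (H ⊗[k] H),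
      LinearMap.mul' k k (TensorProduct.map φ.ofConv ψ.ofConv t) =
        TensorProduct.dualDistrib k (H ⊗[k] H) (H ⊗[k] H) (φ.ofConv ⊗ₜ ψ.ofConv) t := by
    let L : (H ⊗[k] H) ⊗[k] (H ⊗[k] H) →ₗ[k] k :=
      LinearMap.mul' k k ∘ₗ TensorProduct.map
        (φ.ofConv : H ⊗[k] H →ₗ[k] k) (ψ.ofConv : H ⊗[k] H →ₗ[k] k)
    have hL : L = TensorProduct.dualDistrib k (H ⊗[k] H) (H ⊗[k] H) (φ.ofConv ⊗ₜ ψ.ofConv) :=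
      TensorProduct.ext' fun a b => by
        simp only [L, LinearMap.comp_apply]; rfl
    exact fun t => LinearMap.congr_fun hL t
  have h2 : (φ * ψ).ofConv = (TensorProduct.dualDistrib k (H ⊗[k] H) (H ⊗[k] H)
      (φ.ofConv ⊗ₜ ψ.ofConv) ∘ₗ
        𝓡.twistWord (fun a => (copies2 k H 0 a).toLinearMap)
        (fun a => (copies2 k H 1 a).toLinearMap)) ∘ₗ
      (Coalgebra.comul : H ⊗[k] H →ₗ[k] (H ⊗[k] H) ⊗[k] (H ⊗[k] H)) :=
    LinearMap.ext fun c => hm _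
  rw [h2]
  generalize (TensorProduct.dualDistrib k (H ⊗[k] H) (H ⊗[k] H) (φ.ofConv ⊗ₜ ψ.ofConv) ∘ₗ
    𝓡.twistWord (fun a => (copies2 k H 0 a).toLinearMap)
      (fun a => (copies2 k H 1 a).toLinearMap)) = χ at h1 ⊢
  induction h1 using Submodule.span_induction with
  | mem χ h =>
    obtain ⟨φ', hφ', ψ', hψ', rfl⟩ := h
    exact comp_comul_mem hφ' hψ'
  | zero => rw [LinearMap.zero_comp]; exact zero_mem _
  | add χ χ' _ _ h h' => rw [LinearMap.add_comp]; exact add_mem h h'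
  | smul c χ _ h => rw [LinearMap.smul_comp]; exact Submodule.smul_mem _ c h

theorem counit_mem_restrictedDual : (Coalgebra.counit : H →ₗ[k] k) ∈ RestrictedDual k H :=
  RestrictedDual.mem_iff.2 ⟨Coalgebra.counit ⊗ₜ Coalgebra.counit, fun x y => by simp⟩

/-- The elliptic double `E` (with parameter `1`). As a vector space it is `H° ⊗ H°`, an element
`f ⊗ g` being viewed as the functional `u ⊗ v ↦ f(u) g(v)` on `H ⊗ H`; the product is the
convolution of functionals for the coproduct `ellipticComul`. The subspaces `H° ⊗ 1` and
`1 ⊗ H°` (where `1` is the counit of `H`) are two copies of the twisted braided dual of `H`, and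
the product of `f ⊗ 1` and `1 ⊗ g` is `f ⊗ g`. -/
def EllipticDouble (𝓡 : QuasiTriangular k H) :
    Subalgebra k (WithConv (EllipticCoalgebra 𝓡 →ₗ[k] k)) where
  carrier := {φ | φ.ofConv ∈ tensorFunctionals k H}
  mul_mem' := conv_mem 𝓡
  add_mem' h h' := (tensorFunctionals k H).add_mem h h'
  algebraMap_mem' r := by
    have h : (Coalgebra.counit : H ⊗[k] H →ₗ[k] k) ∈ tensorFunctionals k H :=
      ⟨(⟨_, counit_mem_restrictedDual⟩ : RestrictedDual k H) ⊗ₜ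
        (⟨_, counit_mem_restrictedDual⟩ : RestrictedDual k H),
        TensorProduct.ext' fun c d => by simp [RestrictedDual.pair2, mul_comm]⟩
    have h2 := Submodule.smul_mem _ r h
    exact h2
end EllipticDouble

section CompletedTensor
open WithConv

/-- The completed tensor product `B ⊗̂ A` of two algebras: the linear maps `A° → B`, with the
convolution product (`A°` being a coalgebra). An element `∑ bᵢ ⊗ aᵢ` of `B ⊗ A` corresponds to
the linear map `f ↦ ∑ f(aᵢ) bᵢ`. -/
abbrev CompletedTensor (k : Type u) [Field k] (B : Type v) [Ring B] [Algebra k B] (A : Type w)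
    [Ring A] [Algebra k A] : Type _ :=
  WithConv (RestrictedDual k A →ₗ[k] B)

namespace CompletedTensor
variable {k : Type u} [Field k] {B : Type v} [Ring B] [Algebra k B] {A : Type w} [Ring A]
  [Algebra k A]

/-- `id ⊗ φ : B ⊗̂ A → B ⊗̂ A'`, for an algebra homomorphism `φ : A → A'`. -/
def mapRight {A' : Type*} [Ring A'] [Algebra k A'] (φ : A →ₐ[k] A') :
    CompletedTensor k B A →ₐ[k] CompletedTensor k B A' :=
  AlgHom.ofLinearMap
    { toFun := fun F => toConv (F.ofConv ∘ₗ (RestrictedDual.comap φ).toLinearMap)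
      map_add' := fun _ _ => rfl
      map_smul' := fun _ _ => rfl }
    (by
      refine WithConv.ext (LinearMap.ext fun f => ?_)
      exact congrArg (algebraMap k B) (congrArg f.1 (map_one φ)))
    (fun F G => WithConv.ext <|
      LinearMap.convMul_comp_coalgHom_distrib F G (RestrictedDual.comap φ))

/-- `α ⊗ id : B ⊗̂ A → B' ⊗̂ A`, for an algebra homomorphism `α : B → B'`. -/
def mapLeft {B' : Type*} [Ring B'] [Algebra k B'] (α : B →ₐ[k] B') :
    CompletedTensor k B A →ₐ[k] CompletedTensor k B' A :=
  AlgHom.ofLinearMap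
    { toFun := fun F => toConv (α.toLinearMap ∘ₗ F.ofConv)
      map_add' := fun _ _ => WithConv.ext (LinearMap.ext fun _ => map_add α _ _)
      map_smul' := fun c _ => WithConv.ext (LinearMap.ext fun _ => map_smul α c _) }
    (WithConv.ext (LinearMap.ext fun _ => α.commutes _))
    (fun F G => WithConv.ext <| LinearMap.algHom_comp_convMul_distrib α F G)

/-- `a ↦ 1 ⊗ a`, as an algebra homomorphism `A → B ⊗̂ A`. -/
def const : A →ₐ[k] CompletedTensor k B A :=
  AlgHom.ofLinearMap
    { toFun := fun a => toConv (Algebra.linearMap k B ∘ₗ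
        (LinearMap.applyₗ a ∘ₗ (RestrictedDual k A).subtype))
      map_add' := fun a b => WithConv.ext (LinearMap.ext fun f => by simp)
      map_smul' := fun c b => WithConv.ext (LinearMap.ext fun f => by
        simp only [map_smul]
        exact (map_smul (Algebra.linearMap k B) c (f.1 b))) }
    rfl
    (fun a b => by
      refine WithConv.ext (LinearMap.ext fun f => ?_)
      have : ∀ t : RestrictedDual k A ⊗[k] RestrictedDual k A,
          algebraMap k B (RestrictedDual.pair2 k A t (a ⊗ₜ b)) = LinearMap.mul' k B
            (TensorProduct.map (Algebra.linearMap k B ∘ₗ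
                (LinearMap.applyₗ a ∘ₗ (RestrictedDual k A).subtype))
              (Algebra.linearMap k B ∘ₗ
                (LinearMap.applyₗ b ∘ₗ (RestrictedDual k A).subtype)) t) := by
        intro t
        induction t with
        | zero => simp
        | tmul f g => simp [RestrictedDual.pair2]
        | add s t hs ht => simp only [map_add, LinearMap.add_apply, hs, ht]
      refine Eq.trans ?_ (this (Coalgebra.comul f))
      rw [RestrictedDual.pair2_comul]
      rfl)

/-- Functoriality of `B ⊗̂ A` in `A`, on the group of units. -/
def unitsAut : (A ≃ₐ[k] A) →* MulAut (CompletedTensor k B A)ˣ where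
  toFun e := Units.mapEquiv
    { toFun := mapRight (e : A →ₐ[k] A)
      invFun := mapRight (e.symm : A →ₐ[k] A)
      left_inv := fun F => WithConv.ext (LinearMap.ext fun f =>
        congrArg F.ofConv (Subtype.ext (LinearMap.ext fun a =>
          congrArg f.1 (e.symm_apply_apply a))))
      right_inv := fun F => WithConv.ext (LinearMap.ext fun f =>
        congrArg F.ofConv (Subtype.ext (LinearMap.ext fun a =>
          congrArg f.1 (e.apply_symm_apply a))))
      map_mul' := map_mul _ }
  map_one' := rfl
  map_mul' _ _ := rfl
end CompletedTensor
end CompletedTensor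

section TensorPower
variable (k : Type u) [Field k] (H : Type v) [Ring H] [Algebra k H] (n : ℕ)

/-- The algebra `H ⊗ ⋯ ⊗ H` with `n` factors. -/
abbrev TensorPow : Type _ := ⨂[k] _ : Fin n, H

variable {n} in
theorem reindex_mul (s : Equiv.Perm (Fin n)) (x y : TensorPow k H n) :
    PiTensorProduct.reindex k (fun _ : Fin n => H) s (x * y) =
      PiTensorProduct.reindex k (fun _ : Fin n => H) s x *
        PiTensorProduct.reindex k (fun _ : Fin n => H) s y := by
  induction x using PiTensorProduct.induction_on with
  | add a b ha hb => simp only [add_mul, map_add, ha, hb]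
  | smul_tprod r a =>
    induction y using PiTensorProduct.induction_on with
    | add c d hc hd => simp only [mul_add, map_add, hc, hd]
    | smul_tprod r' b =>
      rw [PiTensorProduct.smul_tprod_mul_smul_tprod, map_smul, map_smul, map_smul,
        PiTensorProduct.reindex_tprod, PiTensorProduct.reindex_tprod,
        PiTensorProduct.reindex_tprod, PiTensorProduct.smul_tprod_mul_smul_tprod]
      rfl

/-- The action of the symmetric group on `H ⊗ ⋯ ⊗ H` by permutation of the factors: the factor
in position `i` moves to position `s i`. -/
def permAut : Equiv.Perm (Fin n) →* (TensorPow k H n ≃ₐ[k] TensorPow k H n) where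
  toFun s := AlgEquiv.ofLinearEquiv (PiTensorProduct.reindex k (fun _ : Fin n => H) s)
    (by rw [PiTensorProduct.one_def, PiTensorProduct.reindex_tprod]; rfl)
    (reindex_mul k H s)
  map_one' := AlgEquiv.ext fun x =>
    LinearEquiv.congr_fun (PiTensorProduct.reindex_refl (R := k) (s := fun _ : Fin n => H)) x
  map_mul' s t := AlgEquiv.ext fun x =>
    (PiTensorProduct.reindex_reindex (R := k) (s := fun _ : Fin n => H) t s x).symm

theorem permAut_tprod (s : Equiv.Perm (Fin n)) (h : Fin n → H) :
    permAut k H n s (PiTensorProduct.tprod k h) = PiTensorProduct.tprod k (fun i => h (s.symm i)) :=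
  PiTensorProduct.reindex_tprod (R := k) (s := fun _ : Fin n => H) s h

variable {n} in
/-- The homomorphism `H → H ⊗ ⋯ ⊗ H` to the factor in position `i`. -/
def factorHom (i : Fin n) : H →ₐ[k] TensorPow k H n :=
  PiTensorProduct.singleAlgHom (A := fun _ : Fin n => H) i

variable {n} in
theorem factorHom_commute (i j : Fin n) (hij : i ≠ j) (x y : H) :
    Commute (factorHom k H i x) (factorHom k H j y) :=
  Commute.tprod (R := k) (A := fun _ : Fin n => H) (Pi.mulSingle_commute (f := fun _ : Fin n => H) hij x y)
end TensorPower

section Relations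
variable {k : Type u} [Field k] {H : Type v} [Ring H] [HopfAlgebra k H] (𝓡 : QuasiTriangular k H)

/-- `R²¹` as a unit of `H ⊗ H`. -/
def QuasiTriangular.R21 : (H ⊗[k] H)ˣ :=
  Units.map (Algebra.TensorProduct.comm k H H).toAlgHom.toMonoidHom 𝓡.R

/-- The double braiding `D = R²¹ R¹²`. -/
def QuasiTriangular.D : (H ⊗[k] H)ˣ := 𝓡.R21 * 𝓡.R

/-- The relations imposed on a pair `X`, `Y` of elements of an algebra `P`, thought of as
`B ⊗ H`. Here `Q` is thought of as `B ⊗ (H ⊗ H)`, the homomorphisms `leg1`, `leg2`, `cop` from `P`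
to `Q` are `Z ↦ Z⁰¹`, `Z ↦ Z⁰²`, `Z ↦ Z⁰¹²`, and `c : H ⊗ H → Q` is `t ↦ 1 ⊗ t`. -/
structure QuasiTriangular.EllipticRelations {P Q : Type*} [Ring P] [Algebra k P] [Ring Q]
    [Algebra k Q] (leg1 leg2 cop : P →ₐ[k] Q) (c : H ⊗[k] H →ₐ[k] Q) (m : ℤ) (X Y : P) :
    Prop where
  /-- `X⁰¹² = Dᵐ R⁻¹ X⁰² R X⁰¹` -/
  reflection_left : cop X =
    c ↑(𝓡.D ^ m * 𝓡.R⁻¹) * leg2 X * c 𝓡.R * leg1 X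
  /-- `Y⁰¹² = Dᵐ R⁻¹ Y⁰² R Y⁰¹` -/
  reflection_right : cop Y =
    c ↑(𝓡.D ^ m * 𝓡.R⁻¹) * leg2 Y * c 𝓡.R * leg1 Y
  /-- `X⁰¹ R²¹ Y⁰² = R²¹ Y⁰² R¹² X⁰¹ R²¹` -/
  elliptic : leg1 X * c 𝓡.R21 * leg2 Y =
    c 𝓡.R21 * leg2 Y * c 𝓡.R * leg1 X * c 𝓡.R21

/-- A pair `X`, `Y` in `B ⊗ H` satisfies the reflection axiom with parameter `m` and the elliptic
commutation relation. -/
def QuasiTriangular.IsEllipticPair {B : Type w} [Ring B] [Algebra k B] (m : ℤ)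
    (X Y : B ⊗[k] H) : Prop :=
  𝓡.EllipticRelations
    (Algebra.TensorProduct.map (AlgHom.id k B) Algebra.TensorProduct.includeLeft)
    (Algebra.TensorProduct.map (AlgHom.id k B) Algebra.TensorProduct.includeRight)
    (Algebra.TensorProduct.map (AlgHom.id k B) (Bialgebra.comulAlgHom k H))
    (Algebra.TensorProduct.includeRight : H ⊗[k] H →ₐ[k] B ⊗[k] (H ⊗[k] H)) m X Y

/-- The same relations for a pair in the completed tensor product. -/
def QuasiTriangular.IsCompletedEllipticPair {B : Type w} [Ring B] [Algebra k B] (m : ℤ)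
    (X Y : CompletedTensor k B H) : Prop :=
  𝓡.EllipticRelations
    (CompletedTensor.mapRight (Algebra.TensorProduct.includeLeft : H →ₐ[k] H ⊗[k] H))
    (CompletedTensor.mapRight (Algebra.TensorProduct.includeRight : H →ₐ[k] H ⊗[k] H))
    (CompletedTensor.mapRight (Bialgebra.comulAlgHom k H))
    (CompletedTensor.const : H ⊗[k] H →ₐ[k] CompletedTensor k B (H ⊗[k] H)) m X Y

/-- The counit of `H`, as an element of `H°`. -/
def counitFunctional : RestrictedDual k H := ⟨Coalgebra.counit, counit_mem_restrictedDual⟩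

/-- The linear bijection `H° ⊗ H° → E`. -/
def EllipticDouble.ofTensor :
    RestrictedDual k H ⊗[k] RestrictedDual k H →ₗ[k] EllipticDouble 𝓡 where
  toFun t := ⟨WithConv.toConv (RestrictedDual.pair2 k H t), ⟨t, rfl⟩⟩
  map_add' _ _ := Subtype.ext (congrArg WithConv.toConv (map_add _ _ _))
  map_smul' _ _ := Subtype.ext (congrArg WithConv.toConv (map_smul _ _ _))

/-- The canonical element `X`, i.e. the linear map `f ↦ f ⊗ 1`. -/
def EllipticDouble.X : CompletedTensor k (EllipticDouble 𝓡) H :=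
  WithConv.toConv (EllipticDouble.ofTensor 𝓡 ∘ₗ (TensorProduct.mk k _ _).flip counitFunctional)

/-- The canonical element `Y`, i.e. the linear map `g ↦ 1 ⊗ g`. -/
def EllipticDouble.Y : CompletedTensor k (EllipticDouble 𝓡) H :=
  WithConv.toConv (EllipticDouble.ofTensor 𝓡 ∘ₗ TensorProduct.mk k _ _ counitFunctional)
end Relations

section Groups

/-- Names of the generators of the central extension of `SL₂(ℤ)`. -/
inductive SL2TildeGen
  | A
  | B
  | Z

open SL2TildeGen FreeGroup in
/-- The relators of the relations `A⁴ = Z`, `(AB)³ = Z` and `A² B = B A²`. -/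
def sl2TildeRels : Set (FreeGroup SL2TildeGen) :=
  {of A ^ 4 * (of Z)⁻¹, (of A * of B) ^ 3 * (of Z)⁻¹,
    (of A ^ 2 * of B) * (of B * of A ^ 2)⁻¹}

/-- The group `⟨A, B, Z ∣ A⁴ = (AB)³ = Z, (A², B) = 1⟩`. -/
abbrev SL2Tilde : Type := PresentedGroup sl2TildeRels

namespace SL2Tilde
/-- The generator `A`. -/
def A : SL2Tilde := PresentedGroup.of SL2TildeGen.A
/-- The generator `B`. -/
def B : SL2Tilde := PresentedGroup.of SL2TildeGen.B
end SL2Tilde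

/-- Names of the generators of the braid group of the punctured torus on `n` strands
(the indices start from `0`). -/
inductive EllipticBraidGen (n : ℕ)
  | X (i : Fin n)
  | Y (i : Fin n)
  | s (i : ℕ) (h : i + 1 < n)

open EllipticBraidGen FreeGroup in
/-- The defining relations of the braid group of the punctured torus on `n` strands. -/
inductive EllipticBraidRel (n : ℕ) :
    FreeGroup (EllipticBraidGen n) → FreeGroup (EllipticBraidGen n) → Prop
  | X_comm (i j : Fin n) : EllipticBraidRel n (of (X i) * of (X j)) (of (X j) * of (X i))
  | Y_comm (i j : Fin n) : EllipticBraidRel n (of (Y i) * of (Y j)) (of (Y j) * of (Y i))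
  | s_comm (i j : ℕ) (hi : i + 1 < n) (hj : j + 1 < n) (hij : i + 2 ≤ j) :
      EllipticBraidRel n (of (s i hi) * of (s j hj)) (of (s j hj) * of (s i hi))
  | braid (i : ℕ) (hi : i + 1 < n) (hi' : i + 1 + 1 < n) :
      EllipticBraidRel n (of (s i hi) * of (s (i + 1) hi') * of (s i hi))
        (of (s (i + 1) hi') * of (s i hi) * of (s (i + 1) hi'))
  | X_succ (i : ℕ) (hi : i + 1 < n) : EllipticBraidRel n (of (X ⟨i + 1, hi⟩))
      (of (s i hi) * of (X ⟨i, Nat.lt_of_succ_lt hi⟩) * of (s i hi))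
  | Y_succ (i : ℕ) (hi : i + 1 < n) : EllipticBraidRel n (of (Y ⟨i + 1, hi⟩))
      (of (s i hi) * of (Y ⟨i, Nat.lt_of_succ_lt hi⟩) * of (s i hi))
  | XY (h : 0 + 1 < n) : EllipticBraidRel n
      (of (X ⟨0, Nat.lt_of_succ_lt h⟩) * of (Y ⟨0 + 1, h⟩))
      (of (Y ⟨0 + 1, h⟩) * of (X ⟨0, Nat.lt_of_succ_lt h⟩) * of (s 0 h) ^ 2)
  | s_X (i : ℕ) (hi : i + 1 < n) (h1 : 1 ≤ i) : EllipticBraidRel n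
      (of (s i hi) * of (X ⟨0, Nat.zero_lt_of_lt hi⟩))
      (of (X ⟨0, Nat.zero_lt_of_lt hi⟩) * of (s i hi))
  | s_Y (i : ℕ) (hi : i + 1 < n) (h1 : 1 ≤ i) : EllipticBraidRel n
      (of (s i hi) * of (Y ⟨0, Nat.zero_lt_of_lt hi⟩))
      (of (Y ⟨0, Nat.zero_lt_of_lt hi⟩) * of (s i hi))

/-- The braid group of the punctured torus on `n` strands. -/
abbrev EllipticBraidGroup (n : ℕ) : Type :=
  PresentedGroup {w | ∃ a b, EllipticBraidRel n a b ∧ w = a * b⁻¹}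

namespace EllipticBraidGroup
variable {n : ℕ}
/-- The generators `Xᵢ`. -/
def X (i : Fin n) : EllipticBraidGroup n := PresentedGroup.of (EllipticBraidGen.X i)
/-- The generators `Yᵢ`. -/
def Y (i : Fin n) : EllipticBraidGroup n := PresentedGroup.of (EllipticBraidGen.Y i)
/-- The generators `σᵢ`. -/
def s (i : ℕ) (h : i + 1 < n) : EllipticBraidGroup n :=
  PresentedGroup.of (EllipticBraidGen.s i h)
end EllipticBraidGroup
end Groups

section BraidTarget
variable {k : Type u} [Field k] {H : Type v} [Ring H] [HopfAlgebra k H] (𝓡 : QuasiTriangular k H)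

/-- `R^{i,j}` in `H ⊗ ⋯ ⊗ H`, for `i ≠ j`, as a unit. -/
def QuasiTriangular.RUnit {n : ℕ} (i j : Fin n) (hij : i ≠ j) : (TensorPow k H n)ˣ :=
  𝓡.pairUnit (factorHom k H i) (factorHom k H j) (factorHom_commute k H i j hij)

/-- The group `(E ⊗̂ H ⊗ ⋯ ⊗ H)ˣ ⋊ Sₙ`. -/
abbrev QuasiTriangular.BraidTarget (n : ℕ) : Type _ :=
  (CompletedTensor k (EllipticDouble 𝓡) (TensorPow k H n))ˣ
    ⋊[CompletedTensor.unitsAut.comp (permAut k H n)] Equiv.Perm (Fin n)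

end BraidTarget

section Main
variable {k : Type u} [Field k] {H : Type v} [Ring H] [HopfAlgebra k H] (𝓡 : QuasiTriangular k H)

/-- The image of an element of `E ⊗̂ H` under `α ⊗ id`, for an automorphism `α` of `E`. -/
def QuasiTriangular.applyAut (α : EllipticDouble 𝓡 ≃ₐ[k] EllipticDouble 𝓡) :
    CompletedTensor k (EllipticDouble 𝓡) H →ₐ[k] CompletedTensor k (EllipticDouble 𝓡) H :=
  CompletedTensor.mapLeft (α : EllipticDouble 𝓡 →ₐ[k] EllipticDouble 𝓡)

/-- `A · X = Y`, `A · Y = Y X⁻¹ Y⁻¹`, `B · X = X` and `B · Y = Y X⁻¹`. -/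
structure QuasiTriangular.IsCanonicalAction (X Y : (CompletedTensor k (EllipticDouble 𝓡) H)ˣ)
    (act : SL2Tilde →* (EllipticDouble 𝓡 ≃ₐ[k] EllipticDouble 𝓡)) : Prop where
  A_X : 𝓡.applyAut (act SL2Tilde.A) X = Y
  A_Y : 𝓡.applyAut (act SL2Tilde.A) Y = ↑(Y * X⁻¹ * Y⁻¹)
  B_X : 𝓡.applyAut (act SL2Tilde.B) X = X
  B_Y : 𝓡.applyAut (act SL2Tilde.B) Y = ↑(Y * X⁻¹)

/-- The action of the central extension of `SL₂(ℤ)` on the braid group of the punctured torus. -/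
structure IsCanonicalBraidAction {n : ℕ}
    (act : SL2Tilde →* MulAut (EllipticBraidGroup n)) : Prop where
  A_s (i : ℕ) (h : i + 1 < n) :
    act SL2Tilde.A (EllipticBraidGroup.s i h) = EllipticBraidGroup.s i h
  B_s (i : ℕ) (h : i + 1 < n) :
    act SL2Tilde.B (EllipticBraidGroup.s i h) = EllipticBraidGroup.s i h
  A_X (h : 0 < n) : act SL2Tilde.A (EllipticBraidGroup.X ⟨0, h⟩) = EllipticBraidGroup.Y ⟨0, h⟩
  A_Y (h : 0 < n) : act SL2Tilde.A (EllipticBraidGroup.Y ⟨0, h⟩) =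
    EllipticBraidGroup.Y ⟨0, h⟩ * (EllipticBraidGroup.X ⟨0, h⟩)⁻¹ *
      (EllipticBraidGroup.Y ⟨0, h⟩)⁻¹
  B_X (h : 0 < n) : act SL2Tilde.B (EllipticBraidGroup.X ⟨0, h⟩) = EllipticBraidGroup.X ⟨0, h⟩
  B_Y (h : 0 < n) : act SL2Tilde.B (EllipticBraidGroup.Y ⟨0, h⟩) =
    EllipticBraidGroup.Y ⟨0, h⟩ * (EllipticBraidGroup.X ⟨0, h⟩)⁻¹

/-- `Z ↦ Z^{0,i}`, from the units of `E ⊗̂ H` to those of `E ⊗̂ H ⊗ ⋯ ⊗ H`. -/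
def QuasiTriangular.legUnit {n : ℕ} (i : Fin n) :
    (CompletedTensor k (EllipticDouble 𝓡) H)ˣ →*
      (CompletedTensor k (EllipticDouble 𝓡) (TensorPow k H n))ˣ :=
  Units.map (CompletedTensor.mapRight (factorHom k H i) :
    CompletedTensor k (EllipticDouble 𝓡) H →ₐ[k]
      CompletedTensor k (EllipticDouble 𝓡) (TensorPow k H n)).toMonoidHom

/-- `t ↦ 1 ⊗ t`, from the units of `H ⊗ ⋯ ⊗ H` to those of `E ⊗̂ H ⊗ ⋯ ⊗ H`. -/
def QuasiTriangular.constUnit {n : ℕ} : (TensorPow k H n)ˣ →*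
    (CompletedTensor k (EllipticDouble 𝓡) (TensorPow k H n))ˣ :=
  Units.map (CompletedTensor.const : TensorPow k H n →ₐ[k]
    CompletedTensor k (EllipticDouble 𝓡) (TensorPow k H n)).toMonoidHom

/-- The homomorphism with `X₁ ↦ X^{0,1}`, `Y₁ ↦ Y^{0,1}` and `σᵢ ↦ (i, i+1) R^{i,i+1}`. -/
structure QuasiTriangular.IsCanonicalBraidRep (X Y : (CompletedTensor k (EllipticDouble 𝓡) H)ˣ)
    {n : ℕ} (φ : EllipticBraidGroup n →* 𝓡.BraidTarget n) : Prop where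
  map_X (h : 0 < n) :
    φ (EllipticBraidGroup.X ⟨0, h⟩) = SemidirectProduct.inl (𝓡.legUnit ⟨0, h⟩ X)
  map_Y (h : 0 < n) :
    φ (EllipticBraidGroup.Y ⟨0, h⟩) = SemidirectProduct.inl (𝓡.legUnit ⟨0, h⟩ Y)
  map_s (i : ℕ) (h : i + 1 < n) : φ (EllipticBraidGroup.s i h) =
    SemidirectProduct.inr (Equiv.swap ⟨i, Nat.lt_of_succ_lt h⟩ ⟨i + 1, h⟩) *
      SemidirectProduct.inl (𝓡.constUnit
        (𝓡.RUnit ⟨i, Nat.lt_of_succ_lt h⟩ ⟨i + 1, h⟩ (by simp)))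
end Main
end

/-!
Elliptic pairs and the universal property of the elliptic double.

*Stability of elliptic pairs.* For invertible `Z` the element `R²¹ Z⁰² R Z⁰¹`, which the reflection
axiom equates with `Z⁰¹²`, is multiplicative on elliptic pairs (`cop_mul_of_elliptic`). Since `R`
intertwines `Δ` and `Δᵒᵖ`, the axioms for a pair of units imply relations between `R`, `R²¹`,
`X⁰ⁱ` and `Y⁰ⁱ` in a group (`IsEllipticTuple`, `QuasiTriangular.IsLegSystem.relations_iff`), and
these relations are stable under `(X, Y) ↦ (X, Y X⁻¹)` and `(X, Y) ↦ (Y, Y X⁻¹)`, as well as under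
the inverse substitutions. Together the two give `(Y, Y X⁻¹ Y⁻¹)`. This argument is the same in
`B ⊗ H`, in `B ⊗̂ H` and in the braid group of the punctured torus, where `R¹²` and `R²¹` both
become `σ₁`; so it also gives the action on the braid group.

*The canonical pair.* An element of `E ⊗̂ A` is often given by a linear map `H ⊗ H → A`
(`Represents`), and products become convolutions for the coproduct `ellipticComul` of `H ⊗ H`. The
canonical elements correspond to `id ⊗ ε` and `ε ⊗ id`. Applying `ε` to one copy of `H` makes the
copies of `R` that act through it trivial, so of the eight copies of `R^{±1}` in `ellipticComul`
there remain two, four or none (`map_counitSnd_counitSnd_ellipticComul` and its companions). By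
`R = (id ⊗ S)(R⁻¹)` the factor `R` between two legs cancels one of them (`mulAcrossR_eq`), and the
elliptic relations follow. The inverses of the canonical elements come from a convolution inverse of
the identity of the twisted braided dual (`braidedAntipode`). It is explicit in terms of
`γ = ∑ r₁ S(r₂)`, and that it is an inverse uses `x γ = γ S²(x)`
(`QuasiTriangular.mul_drinfeldElement`).

*The universal property.* Conversely, the factor `R` in `V⁰² R U⁰¹` can be stripped off, so that
this product determines all products of a value of `V` and a value of `U`
(`map_mul_eq_of_postcomp_eq`). The reflection axioms and the elliptic relation are therefore
straightening rules that rewrite every product of values of `X` and of `Y` in terms of the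
`X(f) Y(g)`. As `f ⊗ g ↦ X(f) Y(g)` is bijective onto `E`, an invertible elliptic pair in `B ⊗̂ H`
is the image of the canonical one under exactly one homomorphism `E → B` (`IsEllipticDouble.lift`,
`IsEllipticDouble.algHom_ext`). Existence and uniqueness of the action on `E` follow.

*The braid group.* Permutations of the legs, multiplied by `R^{i,i+1}`, satisfy the braid relations
by the Yang–Baxter equation, and the relations with `X₁` and `Y₁` reduce to an elliptic tuple
(`IsEllipticFamily.isBraidDatum`). Both actions are given by the same formulas in `X` and `Y`, so
compatibility only has to be compared on generators (`map_braidAction`).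
-/

/-! ### The elliptic relations in a group -/

section EllipticTuples
variable {G : Type*} [Group G]

/-- The reflection equation and the elliptic commutation relation between elements of a group:
`r`, `s` stand for `R¹²`, `R²¹` and `x₁`, `x₂`, `y₁`, `y₂` for `X⁰¹`, `X⁰²`, `Y⁰¹`, `Y⁰²`. Each
relation is imposed along with its image under the exchange of the two legs. With `r = s = σ`,
`x₁ = x₂` and `y₁ = y₂` these are relations in the braid group of the punctured torus. -/
structure IsEllipticTuple (r s x₁ x₂ y₁ y₂ : G) : Prop where
  refl_x : r * (s * x₂ * r * x₁) = r * x₁ * s * x₂ * r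
  refl_x' : s * (r * x₁ * s * x₂) = s * x₂ * r * x₁ * s
  refl_y : r * (s * y₂ * r * y₁) = r * y₁ * s * y₂ * r
  refl_y' : s * (r * y₁ * s * y₂) = s * y₂ * r * y₁ * s
  ell : x₁ * s * y₂ = s * y₂ * r * x₁ * s
  ell' : x₂ * r * y₁ = r * y₁ * s * x₂ * r

/-- The word `R²¹ Z⁰² R¹² Z⁰¹`, which the reflection axiom equates with `Z⁰¹²`, is multiplicative
on elliptic pairs. -/
theorem cop_mul_of_elliptic {r s u₁ u₂ v₁ v₂ : G} (h : u₂ * r * v₁ = r * v₁ * s * u₂ * r) :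
    s * (v₂ * u₂) * r * (v₁ * u₁) = (s * v₂ * r * v₁) * (s * u₂ * r * u₁) := by
  calc _ = s * v₂ * (u₂ * r * v₁) * u₁ := by group
    _ = _ := by rw [h]; group

/-- The reflection equation says that `R` intertwines `R²¹ Z⁰² R¹² Z⁰¹` and its image under the
exchange of legs, so it passes to quotients. -/
theorem intertwine_mul_inv {r a b a' b' : G} (ha : r * a = a' * r) (hb : r * b = b' * r) :
    r * (a * b⁻¹) = a' * b'⁻¹ * r := by
  have : b⁻¹ = r⁻¹ * b'⁻¹ * r := by
    rw [eq_comm, ← mul_inv_eq_one, inv_inv, mul_assoc, mul_assoc, hb]; group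
  rw [← mul_assoc, ha, this]; group

/-- The variant of `intertwine_mul_inv` for left quotients. -/
theorem intertwine_inv_mul {r a b a' b' : G} (ha : r * a = a' * r) (hb : r * b = b' * r) :
    r * (a⁻¹ * b) = a'⁻¹ * b' * r := by
  have h := intertwine_mul_inv (a := 1) (a' := 1) (r := r) (by simp) ha
  simp only [one_mul] at h
  rw [← mul_assoc, h, mul_assoc, hb, mul_assoc]

namespace IsEllipticTuple
variable {r s x₁ x₂ y₁ y₂ : G}

theorem swap (h : IsEllipticTuple r s x₁ x₂ y₁ y₂) : IsEllipticTuple s r x₂ x₁ y₂ y₁ :=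
  ⟨h.refl_x', h.refl_x, h.refl_y', h.refl_y, h.ell', h.ell⟩

theorem map {G' : Type*} [Group G'] (f : G →* G') (h : IsEllipticTuple r s x₁ x₂ y₁ y₂) :
    IsEllipticTuple (f r) (f s) (f x₁) (f x₂) (f y₁) (f y₂) where
  refl_x := by simpa only [map_mul] using congrArg f h.refl_x
  refl_x' := by simpa only [map_mul] using congrArg f h.refl_x'
  refl_y := by simpa only [map_mul] using congrArg f h.refl_y
  refl_y' := by simpa only [map_mul] using congrArg f h.refl_y'
  ell := by simpa only [map_mul] using congrArg f h.ell
  ell' := by simpa only [map_mul] using congrArg f h.ell'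

/-- The reflection equation as a commutation relation: with `r = s = σ` it says that `x` commutes
with `σ x σ`. -/
theorem comm_x (h : IsEllipticTuple r s x₁ x₂ y₁ y₂) :
    x₁ * (s * x₂ * r) = s * x₂ * r * x₁ := by
  rw [← mul_right_inj r, h.refl_x]; group

theorem comm_y (h : IsEllipticTuple r s x₁ x₂ y₁ y₂) :
    r * y₁ * s * y₂ = y₂ * (r * y₁ * s) := by
  rw [← mul_right_inj s, h.refl_y']; group

/-- The elliptic commutation relation for `(X, Y X⁻¹)`. -/
theorem ell_mul_inv (h : IsEllipticTuple r s x₁ x₂ y₁ y₂) :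
    x₂ * r * (y₁ * x₁⁻¹) = r * (y₁ * x₁⁻¹) * s * x₂ * r := by
  have h1 : s * x₂ * r * x₁⁻¹ = x₁⁻¹ * (s * x₂ * r) := by
    rw [mul_inv_eq_iff_eq_mul, mul_assoc x₁⁻¹, ← h.comm_x]; group
  calc _ = (x₂ * r * y₁) * x₁⁻¹ := by group
    _ = r * y₁ * (s * x₂ * r * x₁⁻¹) := by rw [h.ell']; group
    _ = _ := by rw [h1]; group

/-- The elliptic commutation relation for `(X, Y X)`. -/
theorem ell_mul (h : IsEllipticTuple r s x₁ x₂ y₁ y₂) :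
    x₂ * r * (y₁ * x₁) = r * (y₁ * x₁) * s * x₂ * r := by
  calc _ = (x₂ * r * y₁) * x₁ := by group
    _ = r * y₁ * (s * x₂ * r * x₁) := by rw [h.ell']; group
    _ = _ := by rw [← h.comm_x]; group

/-- The elliptic commutation relation for `(Y, Y X⁻¹)`. -/
theorem ell_shear (h : IsEllipticTuple r s x₁ x₂ y₁ y₂) :
    y₂ * r * (y₁ * x₁⁻¹) = r * (y₁ * x₁⁻¹) * s * y₂ * r := by
  have h1 : x₁⁻¹ * (s * y₂ * r) = s * y₂ * s⁻¹ * x₁⁻¹ := by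
    rw [inv_mul_eq_iff_eq_mul, eq_comm]
    calc _ = (x₁ * s * y₂) * s⁻¹ * x₁⁻¹ := by group
      _ = _ := by rw [h.ell]; group
  calc _ = y₂ * (r * y₁ * s) * s⁻¹ * x₁⁻¹ := by group
    _ = r * y₁ * (s * y₂ * s⁻¹ * x₁⁻¹) := by rw [← h.comm_y]; group
    _ = _ := by rw [← h1]; group

/-- The elliptic commutation relation for `(Y⁻¹ X, X)`. -/
theorem ell_unshear (h : IsEllipticTuple r s x₁ x₂ y₁ y₂) :
    (y₂⁻¹ * x₂) * r * x₁ = r * x₁ * s * (y₂⁻¹ * x₂) * r := by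
  have h1 : r * x₁ * s * y₂⁻¹ = y₂⁻¹ * s⁻¹ * x₁ * s := by
    rw [mul_inv_eq_iff_eq_mul, eq_comm]
    calc _ = y₂⁻¹ * s⁻¹ * (x₁ * s * y₂) := by group
      _ = _ := by rw [h.ell]; group
  calc _ = y₂⁻¹ * s⁻¹ * (s * x₂ * r * x₁) := by group
    _ = (y₂⁻¹ * s⁻¹ * x₁ * s) * x₂ * r := by rw [← h.comm_x]; group
    _ = _ := by rw [← h1]; group

/-- The word `R²¹ Z⁰² R¹² Z⁰¹` for `Z = Y X` is the product of those for `Y` and `X`. -/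
theorem cop_mul (h : IsEllipticTuple r s x₁ x₂ y₁ y₂) :
    s * (y₂ * x₂) * r * (y₁ * x₁) = (s * y₂ * r * y₁) * (s * x₂ * r * x₁) :=
  cop_mul_of_elliptic h.ell'

theorem cop_mul_inv (h : IsEllipticTuple r s x₁ x₂ y₁ y₂) :
    s * (y₂ * x₂⁻¹) * r * (y₁ * x₁⁻¹) = (s * y₂ * r * y₁) * (s * x₂ * r * x₁)⁻¹ := by
  have := cop_mul_of_elliptic (u₁ := x₁) (v₂ := y₂ * x₂⁻¹) h.ell_mul_inv
  rw [inv_mul_cancel_right, inv_mul_cancel_right] at this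
  rw [eq_mul_inv_iff_mul_eq, ← this]

theorem cop_inv_mul (h : IsEllipticTuple r s x₁ x₂ y₁ y₂) :
    s * (y₂⁻¹ * x₂) * r * (y₁⁻¹ * x₁) = (s * y₂ * r * y₁)⁻¹ * (s * x₂ * r * x₁) := by
  have h1 : (y₂⁻¹ * x₂) * r * y₁ = r * y₁ * s * (y₂⁻¹ * x₂) * r := by
    have h2 : r * y₁ * s * y₂⁻¹ = y₂⁻¹ * (r * y₁ * s) := by
      rw [mul_inv_eq_iff_eq_mul, mul_assoc y₂⁻¹, eq_inv_mul_iff_mul_eq, ← h.comm_y]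
    calc _ = y₂⁻¹ * (x₂ * r * y₁) := by group
      _ = (y₂⁻¹ * (r * y₁ * s)) * x₂ * r := by rw [h.ell']; group
      _ = _ := by rw [← h2]; group
  have := cop_mul_of_elliptic (u₁ := y₁⁻¹ * x₁) (v₂ := y₂) h1
  rw [mul_inv_cancel_left, mul_inv_cancel_left] at this
  rw [eq_inv_mul_iff_mul_eq, ← this]

theorem refl_mul_inv (h : IsEllipticTuple r s x₁ x₂ y₁ y₂) :
    r * (s * (y₂ * x₂⁻¹) * r * (y₁ * x₁⁻¹)) = r * (y₁ * x₁⁻¹) * s * (y₂ * x₂⁻¹) * r := by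
  rw [h.cop_mul_inv, h.swap.cop_mul_inv, intertwine_mul_inv h.refl_y h.refl_x]

theorem refl_mul (h : IsEllipticTuple r s x₁ x₂ y₁ y₂) :
    r * (s * (y₂ * x₂) * r * (y₁ * x₁)) = r * (y₁ * x₁) * s * (y₂ * x₂) * r := by
  rw [h.cop_mul, h.swap.cop_mul, ← mul_assoc, h.refl_y, mul_assoc, h.refl_x]
  simp only [mul_assoc]

theorem refl_inv_mul (h : IsEllipticTuple r s x₁ x₂ y₁ y₂) :
    r * (s * (y₂⁻¹ * x₂) * r * (y₁⁻¹ * x₁)) = r * (y₁⁻¹ * x₁) * s * (y₂⁻¹ * x₂) * r := by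
  rw [h.cop_inv_mul, h.swap.cop_inv_mul, intertwine_inv_mul h.refl_y h.refl_x]

/-- The pair `(X, Y X⁻¹)`. -/
theorem actB (h : IsEllipticTuple r s x₁ x₂ y₁ y₂) :
    IsEllipticTuple r s x₁ x₂ (y₁ * x₁⁻¹) (y₂ * x₂⁻¹) :=
  ⟨h.refl_x, h.refl_x', h.refl_mul_inv, h.swap.refl_mul_inv, h.swap.ell_mul_inv, h.ell_mul_inv⟩

/-- The pair `(X, Y X)`. -/
theorem actBInv (h : IsEllipticTuple r s x₁ x₂ y₁ y₂) :
    IsEllipticTuple r s x₁ x₂ (y₁ * x₁) (y₂ * x₂) :=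
  ⟨h.refl_x, h.refl_x', h.refl_mul, h.swap.refl_mul, h.swap.ell_mul, h.ell_mul⟩

/-- The pair `(Y, Y X⁻¹)`. -/
theorem shear (h : IsEllipticTuple r s x₁ x₂ y₁ y₂) :
    IsEllipticTuple r s y₁ y₂ (y₁ * x₁⁻¹) (y₂ * x₂⁻¹) :=
  ⟨h.refl_y, h.refl_y', h.refl_mul_inv, h.swap.refl_mul_inv, h.swap.ell_shear, h.ell_shear⟩

/-- The pair `(Y⁻¹ X, X)`. -/
theorem unshear (h : IsEllipticTuple r s x₁ x₂ y₁ y₂) :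
    IsEllipticTuple r s (y₁⁻¹ * x₁) (y₂⁻¹ * x₂) x₁ x₂ :=
  ⟨h.refl_inv_mul, h.swap.refl_inv_mul, h.refl_x, h.refl_x', h.swap.ell_unshear, h.ell_unshear⟩

/-- The pair `(Y, Y X⁻¹ Y⁻¹)`. -/
theorem actA (h : IsEllipticTuple r s x₁ x₂ y₁ y₂) :
    IsEllipticTuple r s y₁ y₂ (y₁ * x₁⁻¹ * y₁⁻¹) (y₂ * x₂⁻¹ * y₂⁻¹) := h.shear.actB

/-- The pair `(X⁻¹ Y⁻¹ X, X)`. -/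
theorem actAInv (h : IsEllipticTuple r s x₁ x₂ y₁ y₂) :
    IsEllipticTuple r s (x₁⁻¹ * y₁⁻¹ * x₁) (x₂⁻¹ * y₂⁻¹ * x₂) x₁ x₂ := by
  simpa only [mul_inv_rev] using h.actBInv.unshear

/-- The word `R²¹ Z⁰² R¹² Z⁰¹` for `Z = Y X⁻¹ Y⁻¹`, by two applications of multiplicativity. -/
theorem cop_actA (h : IsEllipticTuple r s x₁ x₂ y₁ y₂) :
    s * (y₂ * x₂⁻¹ * y₂⁻¹) * r * (y₁ * x₁⁻¹ * y₁⁻¹) =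
      (s * y₂ * r * y₁) * (s * x₂ * r * x₁)⁻¹ * (s * y₂ * r * y₁)⁻¹ := by
  rw [h.shear.cop_mul_inv, h.cop_mul_inv]

theorem cop_actAInv (h : IsEllipticTuple r s x₁ x₂ y₁ y₂) :
    s * (x₂⁻¹ * y₂⁻¹ * x₂) * r * (x₁⁻¹ * y₁⁻¹ * x₁) =
      (s * x₂ * r * x₁)⁻¹ * (s * y₂ * r * y₁)⁻¹ * (s * x₂ * r * x₁) := by
  have := h.actBInv.cop_inv_mul
  rw [h.cop_mul] at this
  simpa only [mul_inv_rev] using this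

end IsEllipticTuple
end EllipticTuples

/-! ### Homomorphisms from the braid group of the punctured torus -/

section BraidLift
variable {G : Type*} [Group G] {n : ℕ}

/-- The elements `z`, `σ₀ z σ₀`, `σ₁ σ₀ z σ₀ σ₁`, … of a group. -/
def murphy (σ : ∀ i, i + 1 < n → G) (z : G) : ∀ i, i < n → G
  | 0, _ => z
  | i + 1, h => σ i h * murphy σ z i (Nat.lt_of_succ_lt h) * σ i h

/-- Elements of a group that satisfy the defining relations of the braid group of the punctured
torus, stated for the generators `X₁ = x`, `Y₁ = y` and `σᵢ` only. The relations that involve `X₂`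
or `Y₂` say that `σ₁`, `x` and `y` form an elliptic tuple; those between the other `Xᵢ` and between
the other `Yᵢ` are consequences, by `murphy_commute`. -/
structure IsBraidDatum (x y : G) (σ : ∀ i, i + 1 < n → G) : Prop where
  comm : ∀ i j hi hj, i + 2 ≤ j → Commute (σ i hi) (σ j hj)
  braid : ∀ i hi hi', σ i hi * σ (i + 1) hi' * σ i hi = σ (i + 1) hi' * σ i hi * σ (i + 1) hi'
  comm_x : ∀ i hi, 1 ≤ i → Commute (σ i hi) x
  comm_y : ∀ i hi, 1 ≤ i → Commute (σ i hi) y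
  tuple : ∀ h : 0 + 1 < n, IsEllipticTuple (σ 0 h) (σ 0 h) x x y y

section Murphy
variable {σ : ∀ i, i + 1 < n → G} {z : G}
  (comm : ∀ i j hi hj, i + 2 ≤ j → Commute (σ i hi) (σ j hj))
  (braid : ∀ i hi hi', σ i hi * σ (i + 1) hi' * σ i hi = σ (i + 1) hi' * σ i hi * σ (i + 1) hi')
  (comm_z : ∀ i hi, 1 ≤ i → Commute (σ i hi) z)

include comm comm_z in
theorem murphy_commute_of_lt (i : ℕ) (hi : i < n) (j : ℕ) (hj : j + 1 < n) (hij : i < j) :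
    Commute (σ j hj) (murphy σ z i hi) := by
  induction i with
  | zero => exact comm_z j hj hij
  | succ i ih =>
    have h := (comm i j hi hj (by omega)).symm
    exact (h.mul_right (ih _ (by omega))).mul_right h

include comm braid comm_z in
theorem murphy_commute_of_gt (j : ℕ) (hj : j + 1 < n) (i : ℕ) (hi : i < n) (hij : j + 2 ≤ i) :
    Commute (σ j hj) (murphy σ z i hi) := by
  induction i, hij using Nat.le_induction with
  | base =>
    have h := murphy_commute_of_lt comm comm_z j (by omega) (j + 1) hi (by omega)
    have b := braid j hj hi
    change σ j hj * (σ (j + 1) hi * (σ j hj * murphy σ z j _ * σ j hj) * σ (j + 1) hi) =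
      (σ (j + 1) hi * (σ j hj * murphy σ z j _ * σ j hj) * σ (j + 1) hi) * σ j hj
    generalize σ j hj = a at b ⊢
    generalize σ (j + 1) hi = c at b h ⊢
    generalize murphy σ z j _ = m at h ⊢
    calc a * (c * (a * m * a) * c) = (a * c * a) * m * (a * c) := by simp only [mul_assoc]
      _ = c * a * (c * m) * (a * c) := by rw [b]; simp only [mul_assoc]
      _ = c * a * m * (c * a * c) := by rw [h.eq]; simp only [mul_assoc]
      _ = _ := by rw [← b]; simp only [mul_assoc]
  | succ i hij ih =>
    have h := comm j i hj hi hij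
    exact (h.mul_right (ih _)).mul_right h

include comm_z in
theorem murphy_zero_commute (h0 : ∀ h : 0 + 1 < n, Commute z (σ 0 h * z * σ 0 h))
    (i : ℕ) (hi : i + 1 < n) : Commute z (murphy σ z (i + 1) hi) := by
  induction i with
  | zero => exact h0 hi
  | succ i ih =>
    have h := (comm_z (i + 1) hi (by omega)).symm
    exact (h.mul_right (ih _)).mul_right h

include comm braid comm_z in
/-- The Murphy elements commute pairwise as soon as the first two of them do. -/
theorem murphy_commute (h0 : ∀ h : 0 + 1 < n, Commute z (σ 0 h * z * σ 0 h))
    (i j : ℕ) (hi : i < n) (hj : j < n) : Commute (murphy σ z i hi) (murphy σ z j hj) := by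
  have key : ∀ (i j : ℕ) (hi : i < n) (hj : j < n), i < j →
      Commute (murphy σ z i hi) (murphy σ z j hj) := by
    intro i
    induction i with
    | zero =>
      intro j hi hj hij
      obtain ⟨j, rfl⟩ : ∃ j', j = j' + 1 := ⟨j - 1, by omega⟩
      exact murphy_zero_commute comm_z h0 j hj
    | succ i ih =>
      intro j hi hj hij
      have h := murphy_commute_of_gt comm braid comm_z i hi j hj (by omega)
      exact (h.mul_left (ih j _ hj (by omega))).mul_left h
  rcases lt_trichotomy i j with h | rfl | h
  · exact key i j hi hj h
  · exact Commute.refl _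
  · exact (key j i hj hi h).symm
end Murphy

namespace IsEllipticTuple

theorem commute_murphy_x {σ x y : G} (h : IsEllipticTuple σ σ x x y y) : Commute x (σ * x * σ) :=
  h.comm_x

theorem commute_murphy_y {σ x y : G} (h : IsEllipticTuple σ σ x x y y) : Commute y (σ * y * σ) := by
  have := h.refl_y
  rw [Commute, SemiconjBy, ← mul_right_inj σ, this]
  group

end IsEllipticTuple

namespace IsBraidDatum
variable {x y : G} {σ : ∀ i, i + 1 < n → G}

theorem map {G' : Type*} [Group G'] (f : G →* G') (h : IsBraidDatum x y σ) :
    IsBraidDatum (f x) (f y) (fun i hi => f (σ i hi)) where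
  comm i j hi hj hij := (h.comm i j hi hj hij).map f
  braid i hi hi' := by simpa only [map_mul] using congrArg f (h.braid i hi hi')
  comm_x i hi h1 := (h.comm_x i hi h1).map f
  comm_y i hi h1 := (h.comm_y i hi h1).map f
  tuple hn := (h.tuple hn).map f

/-- The datum with `(x, y)` replaced by `(y, y x⁻¹ y⁻¹)`. -/
theorem actA (h : IsBraidDatum x y σ) : IsBraidDatum y (y * x⁻¹ * y⁻¹) σ :=
  ⟨h.comm, h.braid, h.comm_y, fun i hi h1 =>
    ((h.comm_y i hi h1).mul_right (h.comm_x i hi h1).inv_right).mul_right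
      (h.comm_y i hi h1).inv_right, fun hn => (h.tuple hn).actA⟩

/-- The datum with `(x, y)` replaced by `(x⁻¹ y⁻¹ x, x)`. -/
theorem actAInv (h : IsBraidDatum x y σ) : IsBraidDatum (x⁻¹ * y⁻¹ * x) x σ :=
  ⟨h.comm, h.braid, fun i hi h1 =>
    ((h.comm_x i hi h1).inv_right.mul_right (h.comm_y i hi h1).inv_right).mul_right
      (h.comm_x i hi h1), h.comm_x, fun hn => (h.tuple hn).actAInv⟩

/-- The datum with `(x, y)` replaced by `(x, y x⁻¹)`. -/
theorem actB (h : IsBraidDatum x y σ) : IsBraidDatum x (y * x⁻¹) σ :=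
  ⟨h.comm, h.braid, h.comm_x, fun i hi h1 =>
    (h.comm_y i hi h1).mul_right (h.comm_x i hi h1).inv_right, fun hn => (h.tuple hn).actB⟩

/-- The datum with `(x, y)` replaced by `(x, y x)`. -/
theorem actBInv (h : IsBraidDatum x y σ) : IsBraidDatum x (y * x) σ :=
  ⟨h.comm, h.braid, h.comm_x, fun i hi h1 =>
    (h.comm_y i hi h1).mul_right (h.comm_x i hi h1), fun hn => (h.tuple hn).actBInv⟩

end IsBraidDatum

namespace EllipticBraidGroup

/-- The homomorphism from the braid group of the punctured torus determined by the images of `X₁`,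
`Y₁` and the `σᵢ`. -/
def lift {x y : G} {σ : ∀ i, i + 1 < n → G} (h : IsBraidDatum x y σ) :
    EllipticBraidGroup n →* G :=
  PresentedGroup.toGroup (f := fun g => match g with
    | .X i => murphy σ x i i.2
    | .Y i => murphy σ y i i.2
    | .s i hi => σ i hi) (by
    rintro _ ⟨a, b, hab, rfl⟩
    rw [map_mul, map_inv, mul_inv_eq_one]
    cases hab with
    | X_comm i j =>
      simp only [map_mul, FreeGroup.lift_apply_of]
      exact murphy_commute h.comm h.braid h.comm_x (fun hn => (h.tuple hn).commute_murphy_x) _ _ _ _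
    | Y_comm i j =>
      simp only [map_mul, FreeGroup.lift_apply_of]
      exact murphy_commute h.comm h.braid h.comm_y (fun hn => (h.tuple hn).commute_murphy_y) _ _ _ _
    | s_comm i j hi hj hij =>
      simp only [map_mul, FreeGroup.lift_apply_of]
      exact h.comm i j hi hj hij
    | braid i hi hi' =>
      simp only [map_mul, FreeGroup.lift_apply_of]
      exact h.braid i hi hi'
    | X_succ i hi =>
      simp only [map_mul, FreeGroup.lift_apply_of]
      rfl
    | Y_succ i hi =>
      simp only [map_mul, FreeGroup.lift_apply_of]
      rfl
    | XY hn =>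
      simp only [map_mul, map_pow, FreeGroup.lift_apply_of]
      have := (h.tuple hn).ell
      change x * (σ 0 hn * y * σ 0 hn) = σ 0 hn * y * σ 0 hn * x * σ 0 hn ^ 2
      rw [pow_two, ← mul_assoc, ← mul_assoc, ← mul_assoc, this]
    | s_X i hi h1 =>
      simp only [map_mul, FreeGroup.lift_apply_of]
      exact h.comm_x i hi h1
    | s_Y i hi h1 =>
      simp only [map_mul, FreeGroup.lift_apply_of]
      exact h.comm_y i hi h1)

section
variable {x y : G} {σ : ∀ i, i + 1 < n → G} (h : IsBraidDatum x y σ)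

@[simp] theorem lift_X (hn : 0 < n) : lift h (X ⟨0, hn⟩) = x := PresentedGroup.toGroup.of _
@[simp] theorem lift_Y (hn : 0 < n) : lift h (Y ⟨0, hn⟩) = y := PresentedGroup.toGroup.of _
@[simp] theorem lift_s (i : ℕ) (hi : i + 1 < n) : lift h (s i hi) = σ i hi :=
  PresentedGroup.toGroup.of _
end

theorem eq_of_rel {a b : FreeGroup (EllipticBraidGen n)} (h : EllipticBraidRel n a b) :
    (PresentedGroup.mk _ a : EllipticBraidGroup n) = PresentedGroup.mk _ b := by
  rw [← mul_inv_eq_one, ← map_inv, ← map_mul]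
  exact PresentedGroup.one_of_mem ⟨a, b, h, rfl⟩

theorem X_succ (i : ℕ) (hi : i + 1 < n) :
    (X ⟨i + 1, hi⟩ : EllipticBraidGroup n) =
      s i hi * X ⟨i, Nat.lt_of_succ_lt hi⟩ * s i hi := by
  have := eq_of_rel (EllipticBraidRel.X_succ i hi)
  simp only [map_mul] at this
  exact this

theorem Y_succ (i : ℕ) (hi : i + 1 < n) :
    (Y ⟨i + 1, hi⟩ : EllipticBraidGroup n) =
      s i hi * Y ⟨i, Nat.lt_of_succ_lt hi⟩ * s i hi := by
  have := eq_of_rel (EllipticBraidRel.Y_succ i hi)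
  simp only [map_mul] at this
  exact this

theorem hom_ext {f g : EllipticBraidGroup n →* G}
    (hX : ∀ h : 0 < n, f (X ⟨0, h⟩) = g (X ⟨0, h⟩)) (hY : ∀ h : 0 < n, f (Y ⟨0, h⟩) = g (Y ⟨0, h⟩))
    (hs : ∀ i h, f (s i h) = g (s i h)) : f = g := by
  refine PresentedGroup.ext fun a => ?_
  cases a with
  | X i =>
    obtain ⟨i, hi⟩ := i
    change f (X ⟨i, hi⟩) = g (X ⟨i, hi⟩)
    induction i with
    | zero => exact hX hi
    | succ i ih => rw [X_succ, map_mul, map_mul, map_mul, map_mul, ih, hs]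
  | Y i =>
    obtain ⟨i, hi⟩ := i
    change f (Y ⟨i, hi⟩) = g (Y ⟨i, hi⟩)
    induction i with
    | zero => exact hY hi
    | succ i ih => rw [Y_succ, map_mul, map_mul, map_mul, map_mul, ih, hs]
  | s i h => exact hs i h

end EllipticBraidGroup

/-- The generator `X₁` of the braid group of the punctured torus; it is `1` when there are no
strands. -/
def braidX₁ (n : ℕ) : EllipticBraidGroup n := if h : 0 < n then EllipticBraidGroup.X ⟨0, h⟩ else 1

/-- The generator `Y₁` of the braid group of the punctured torus; it is `1` when there are no
strands. -/
def braidY₁ (n : ℕ) : EllipticBraidGroup n := if h : 0 < n then EllipticBraidGroup.Y ⟨0, h⟩ else 1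

open EllipticBraidGroup

@[simp] theorem braidX₁_of_pos (h : 0 < n) : braidX₁ n = X ⟨0, h⟩ := dif_pos h
@[simp] theorem braidY₁_of_pos (h : 0 < n) : braidY₁ n = Y ⟨0, h⟩ := dif_pos h

/-- The generators of the braid group of the punctured torus satisfy its relations. -/
theorem isBraidDatum_generators (n : ℕ) :
    IsBraidDatum (braidX₁ n) (braidY₁ n) (EllipticBraidGroup.s (n := n)) where
  comm i j hi hj hij := by
    have := eq_of_rel (EllipticBraidRel.s_comm i j hi hj hij)
    simp only [map_mul] at this
    exact this
  braid i hi hi' := by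
    have := eq_of_rel (EllipticBraidRel.braid i hi hi')
    simp only [map_mul] at this
    exact this
  comm_x i hi h1 := by
    have := eq_of_rel (EllipticBraidRel.s_X i hi h1)
    rw [braidX₁_of_pos (by omega)]
    simp only [map_mul] at this
    exact this
  comm_y i hi h1 := by
    have := eq_of_rel (EllipticBraidRel.s_Y i hi h1)
    rw [braidY₁_of_pos (by omega)]
    simp only [map_mul] at this
    exact this
  tuple hn := by
    have h0 : 0 < n := Nat.lt_of_succ_lt hn
    have hX : X ⟨0, h0⟩ * X ⟨0 + 1, hn⟩ = X ⟨0 + 1, hn⟩ * X ⟨0, h0⟩ := by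
      have := eq_of_rel (EllipticBraidRel.X_comm ⟨0, h0⟩ ⟨0 + 1, hn⟩)
      simp only [map_mul] at this
      exact this
    have hY : Y ⟨0, h0⟩ * Y ⟨0 + 1, hn⟩ = Y ⟨0 + 1, hn⟩ * Y ⟨0, h0⟩ := by
      have := eq_of_rel (EllipticBraidRel.Y_comm ⟨0, h0⟩ ⟨0 + 1, hn⟩)
      simp only [map_mul] at this
      exact this
    have hXY : X ⟨0, h0⟩ * Y ⟨0 + 1, hn⟩ = Y ⟨0 + 1, hn⟩ * X ⟨0, h0⟩ * s 0 hn ^ 2 := by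
      have := eq_of_rel (EllipticBraidRel.XY hn)
      simp only [map_mul, map_pow] at this
      exact this
    rw [X_succ] at hX
    rw [Y_succ] at hY hXY
    rw [braidX₁_of_pos h0, braidY₁_of_pos h0]
    generalize (X ⟨0, h0⟩ : EllipticBraidGroup n) = x at hX hXY ⊢
    generalize (Y ⟨0, h0⟩ : EllipticBraidGroup n) = y at hY hXY ⊢
    generalize s 0 hn = σ at hX hY hXY ⊢
    have e1 : σ * (σ * x * σ * x) = σ * x * σ * x * σ := by
      simpa only [mul_assoc] using congrArg (σ * ·) hX.symm
    have e2 : σ * (σ * y * σ * y) = σ * y * σ * y * σ := by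
      simpa only [mul_assoc] using congrArg (σ * ·) hY.symm
    have e3 : x * σ * y = σ * y * σ * x * σ := by
      rw [← mul_left_inj σ]
      simpa only [mul_assoc, pow_two] using hXY
    exact ⟨e1, e1, e2, e2, e3, e3⟩

end BraidLift

/-! ### The central extension of `SL₂(ℤ)` -/

namespace SL2Tilde
variable {G : Type*} [Group G]

/-- The homomorphism determined by the images of `A` and `B`. -/
def lift (a b : G) (h1 : (a * b) ^ 3 = a ^ 4) (h2 : a ^ 2 * b = b * a ^ 2) : SL2Tilde →* G :=
  PresentedGroup.toGroup (f := fun g => match g with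
    | .A => a
    | .B => b
    | .Z => a ^ 4) (by
    intro r hr
    rcases hr with rfl | rfl | rfl <;> simp [h1, h2])

variable (a b : G) (h1 : (a * b) ^ 3 = a ^ 4) (h2 : a ^ 2 * b = b * a ^ 2)
@[simp] theorem lift_A : lift a b h1 h2 A = a := PresentedGroup.toGroup.of _
@[simp] theorem lift_B : lift a b h1 h2 B = b := PresentedGroup.toGroup.of _

theorem Z_eq : (PresentedGroup.of SL2TildeGen.Z : SL2Tilde) = A ^ 4 := by
  have : (PresentedGroup.mk sl2TildeRels (FreeGroup.of SL2TildeGen.A ^ 4 *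
      (FreeGroup.of SL2TildeGen.Z)⁻¹)) = 1 := PresentedGroup.one_of_mem (Or.inl rfl)
  rw [map_mul, map_inv, mul_inv_eq_one, map_pow] at this
  exact this.symm

theorem hom_ext {f g : SL2Tilde →* G} (hA : f A = g A) (hB : f B = g B) : f = g := by
  refine PresentedGroup.ext fun a => ?_
  cases a with
  | A => exact hA
  | B => exact hB
  | Z => rw [Z_eq, map_pow, map_pow, hA]

/-- The elements `A` and `B` generate the group. -/
theorem induction {p : SL2Tilde → Prop} (hA : p A) (hB : p B) (h1 : p 1)
    (hmul : ∀ g g', p g → p g' → p (g * g')) (hinv : ∀ g, p g → p g⁻¹) (g : SL2Tilde) : p g := by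
  let S : Subgroup SL2Tilde :=
    { carrier := {g | p g}
      mul_mem' := fun {a b} => hmul a b
      one_mem' := h1
      inv_mem' := fun {a} => hinv a }
  suffices S = ⊤ from (this ▸ Subgroup.mem_top g : g ∈ S)
  rw [eq_top_iff, ← PresentedGroup.closure_range_of, Subgroup.closure_le]
  rintro _ ⟨a, rfl⟩
  cases a with
  | A => exact hA
  | B => exact hB
  | Z => rw [Z_eq]; exact pow_mem (show A ∈ S from hA) 4

end SL2Tilde

section BraidAction
variable (n : ℕ)
open EllipticBraidGroup

/-- The automorphism `X₁ ↦ Y₁`, `Y₁ ↦ Y₁ X₁⁻¹ Y₁⁻¹` of the braid group of the punctured torus. -/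
def braidAutA : MulAut (EllipticBraidGroup n) :=
  MonoidHom.toMulEquiv (lift (isBraidDatum_generators n).actA)
    (lift (isBraidDatum_generators n).actAInv)
    (hom_ext (fun h => by simp [h, mul_assoc]) (fun h => by simp [h, mul_assoc])
      (fun i h => by simp))
    (hom_ext (fun h => by simp [h, mul_assoc]) (fun h => by simp [h, mul_assoc])
      (fun i h => by simp))

/-- The automorphism `X₁ ↦ X₁`, `Y₁ ↦ Y₁ X₁⁻¹` of the braid group of the punctured torus. -/
def braidAutB : MulAut (EllipticBraidGroup n) :=
  MonoidHom.toMulEquiv (lift (isBraidDatum_generators n).actB)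
    (lift (isBraidDatum_generators n).actBInv)
    (hom_ext (fun h => by simp [h]) (fun h => by simp [h, mul_assoc]) (fun i h => by simp))
    (hom_ext (fun h => by simp [h]) (fun h => by simp [h, mul_assoc]) (fun i h => by simp))

variable {n}
theorem braidAutA_X (h : 0 < n) : braidAutA n (X ⟨0, h⟩) = Y ⟨0, h⟩ :=
  (lift_X (isBraidDatum_generators n).actA h).trans (braidY₁_of_pos h)
theorem braidAutA_Y (h : 0 < n) :
    braidAutA n (Y ⟨0, h⟩) = Y ⟨0, h⟩ * (X ⟨0, h⟩)⁻¹ * (Y ⟨0, h⟩)⁻¹ :=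
  (lift_Y (isBraidDatum_generators n).actA h).trans (by rw [braidX₁_of_pos h, braidY₁_of_pos h])
theorem braidAutA_s (i : ℕ) (h : i + 1 < n) : braidAutA n (s i h) = s i h :=
  lift_s (isBraidDatum_generators n).actA i h
theorem braidAutB_X (h : 0 < n) : braidAutB n (X ⟨0, h⟩) = X ⟨0, h⟩ :=
  (lift_X (isBraidDatum_generators n).actB h).trans (braidX₁_of_pos h)
theorem braidAutB_Y (h : 0 < n) : braidAutB n (Y ⟨0, h⟩) = Y ⟨0, h⟩ * (X ⟨0, h⟩)⁻¹ :=
  (lift_Y (isBraidDatum_generators n).actB h).trans (by rw [braidX₁_of_pos h, braidY₁_of_pos h])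
theorem braidAutB_s (i : ℕ) (h : i + 1 < n) : braidAutB n (s i h) = s i h :=
  lift_s (isBraidDatum_generators n).actB i h

variable (n) in
/-- The action of the central extension of `SL₂(ℤ)` on the braid group of the punctured torus. -/
def braidAction : SL2Tilde →* MulAut (EllipticBraidGroup n) :=
  SL2Tilde.lift (braidAutA n) (braidAutB n)
    (MulEquiv.toMonoidHom_injective <| hom_ext
      (fun h => by
        simp [pow_succ, MulAut.mul_apply, braidAutA_X, braidAutA_Y, braidAutB_X, braidAutB_Y,
          mul_assoc])
      (fun h => by
        simp [pow_succ, MulAut.mul_apply, braidAutA_X, braidAutA_Y, braidAutB_X, braidAutB_Y,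
          mul_assoc])
      (fun i h => by simp [pow_succ, MulAut.mul_apply, braidAutA_s, braidAutB_s]))
    (MulEquiv.toMonoidHom_injective <| hom_ext
      (fun h => by
        simp [pow_succ, MulAut.mul_apply, braidAutA_X, braidAutA_Y, braidAutB_X, braidAutB_Y,
          mul_assoc])
      (fun h => by
        simp [pow_succ, MulAut.mul_apply, braidAutA_X, braidAutA_Y, braidAutB_X, braidAutB_Y,
          mul_assoc])
      (fun i h => by simp [pow_succ, MulAut.mul_apply, braidAutA_s, braidAutB_s]))

theorem braidAction_isCanonical : IsCanonicalBraidAction (braidAction n) where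
  A_s i h := by rw [braidAction, SL2Tilde.lift_A, braidAutA_s]
  B_s i h := by rw [braidAction, SL2Tilde.lift_B, braidAutB_s]
  A_X h := by rw [braidAction, SL2Tilde.lift_A, braidAutA_X]
  A_Y h := by rw [braidAction, SL2Tilde.lift_A, braidAutA_Y]
  B_X h := by rw [braidAction, SL2Tilde.lift_B, braidAutB_X]
  B_Y h := by rw [braidAction, SL2Tilde.lift_B, braidAutB_Y]

end BraidAction

/-! ### Products with constants in the completed tensor product -/

section CompletedTensorBasics
open WithConv
variable {k : Type u} [Field k] {B : Type v} [Ring B] [Algebra k B] {A : Type w} [Ring A]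
  [Algebra k A]

/-- The functional `x ↦ f (a * x * b)`. -/
def RestrictedDual.translate (a b : A) (f : RestrictedDual k A) : RestrictedDual k A :=
  ⟨_, RestrictedDual.translate_mem a b f.2⟩

theorem RestrictedDual.translate_apply (a b : A) (f : RestrictedDual k A) (x : A) :
    (RestrictedDual.translate a b f).1 x = f.1 (a * (x * b)) := rfl

/-- Evaluation of the first tensor factor of `Δ(f) = ∑ f₁ ⊗ f₂` at `a` gives `x ↦ f (a x)`. -/
theorem RestrictedDual.lid_rTensor_eval_comul (a : A) (f : RestrictedDual k A) :
    TensorProduct.lid k _ ((LinearMap.applyₗ a ∘ₗ (RestrictedDual k A).subtype).rTensor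
      (RestrictedDual k A) (Coalgebra.comul (R := k) f)) = RestrictedDual.translate a 1 f := by
  refine Subtype.ext (LinearMap.ext fun x => ?_)
  have : ∀ t : RestrictedDual k A ⊗[k] RestrictedDual k A,
      (TensorProduct.lid k _ ((LinearMap.applyₗ a ∘ₗ (RestrictedDual k A).subtype).rTensor
        (RestrictedDual k A) t)).1 x = RestrictedDual.pair2 k A t (a ⊗ₜ x) := by
    intro t
    induction t with
    | zero => simp
    | tmul f g => simp [RestrictedDual.pair2]
    | add s t hs ht => simp only [map_add, LinearMap.add_apply, ← hs, ← ht]; rfl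
  rw [this, RestrictedDual.pair2_comul, RestrictedDual.translate_apply, mul_one]

/-- Evaluation of the second tensor factor of `Δ(f) = ∑ f₁ ⊗ f₂` at `a` gives `x ↦ f (x a)`. -/
theorem RestrictedDual.rid_lTensor_eval_comul (a : A) (f : RestrictedDual k A) :
    TensorProduct.rid k _ ((LinearMap.applyₗ a ∘ₗ (RestrictedDual k A).subtype).lTensor
      (RestrictedDual k A) (Coalgebra.comul (R := k) f)) = RestrictedDual.translate 1 a f := by
  refine Subtype.ext (LinearMap.ext fun x => ?_)
  have : ∀ t : RestrictedDual k A ⊗[k] RestrictedDual k A,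
      (TensorProduct.rid k _ ((LinearMap.applyₗ a ∘ₗ (RestrictedDual k A).subtype).lTensor
        (RestrictedDual k A) t)).1 x = RestrictedDual.pair2 k A t (x ⊗ₜ a) := by
    intro t
    induction t with
    | zero => simp
    | tmul f g => simp [RestrictedDual.pair2, mul_comm]
    | add s t hs ht => simp only [map_add, LinearMap.add_apply, ← hs, ← ht]; rfl
  rw [this, RestrictedDual.pair2_comul, RestrictedDual.translate_apply, one_mul]

namespace CompletedTensor

@[ext] theorem ext {F G : CompletedTensor k B A} (h : ∀ f, F.ofConv f = G.ofConv f) : F = G :=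
  WithConv.ext (LinearMap.ext h)

theorem mul_apply (F G : CompletedTensor k B A) (f : RestrictedDual k A) :
    (F * G).ofConv f = LinearMap.mul' k B (TensorProduct.map F.ofConv G.ofConv
      (Coalgebra.comul (R := k) f)) := rfl

theorem const_apply (a : A) (f : RestrictedDual k A) :
    (const a : CompletedTensor k B A).ofConv f = algebraMap k B (f.1 a) := rfl

theorem const_mul_apply (a : A) (F : CompletedTensor k B A) (f : RestrictedDual k A) :
    (const a * F).ofConv f = F.ofConv (RestrictedDual.translate a 1 f) := by
  rw [mul_apply, ← RestrictedDual.lid_rTensor_eval_comul]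
  generalize Coalgebra.comul (R := k) f = t
  induction t with
  | zero => simp
  | tmul f g => simp [const_apply, Algebra.smul_def]
  | add s t hs ht => simp only [map_add, hs, ht]

theorem mul_const_apply (a : A) (F : CompletedTensor k B A) (f : RestrictedDual k A) :
    (F * const a).ofConv f = F.ofConv (RestrictedDual.translate 1 a f) := by
  rw [mul_apply, ← RestrictedDual.rid_lTensor_eval_comul]
  generalize Coalgebra.comul (R := k) f = t
  induction t with
  | zero => simp
  | tmul f g => simp [const_apply, Algebra.smul_def, Algebra.commutes]
  | add s t hs ht => simp only [map_add, hs, ht]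

variable {A' : Type*} [Ring A'] [Algebra k A'] {A'' : Type*} [Ring A''] [Algebra k A'']
  {B' : Type*} [Ring B'] [Algebra k B']

theorem mapRight_apply (φ : A →ₐ[k] A') (F : CompletedTensor k B A) (f : RestrictedDual k A') :
    (mapRight φ F).ofConv f = F.ofConv (RestrictedDual.comap φ f) := rfl

theorem comap_apply (φ : A →ₐ[k] A') (f : RestrictedDual k A') (x : A) :
    (RestrictedDual.comap φ f).1 x = f.1 (φ x) := rfl

theorem mapRight_mapRight (ψ : A' →ₐ[k] A'') (φ : A →ₐ[k] A') (F : CompletedTensor k B A) :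
    mapRight ψ (mapRight φ F) = mapRight (ψ.comp φ) F := rfl

theorem mapLeft_const (α : B →ₐ[k] B') (a : A) :
    mapLeft α (const a : CompletedTensor k B A) = const a :=
  ext fun _ => α.commutes _

/-- If `a` and `a'` intertwine two homomorphisms, then `1 ⊗ a` and `1 ⊗ a'` intertwine the maps
they induce. -/
theorem const_mul_mapRight {a a' : A'} {φ ψ : A →ₐ[k] A'} (h : ∀ x, a * φ x = ψ x * a')
    (F : CompletedTensor k B A) : const a * mapRight φ F = mapRight ψ F * const a' := by
  ext f
  rw [const_mul_apply, mul_const_apply, mapRight_apply, mapRight_apply]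
  congr 1
  refine Subtype.ext (LinearMap.ext fun x => ?_)
  simp only [comap_apply, RestrictedDual.translate_apply, mul_one, one_mul, h]

end CompletedTensor
end CompletedTensorBasics

/-! ### Elliptic pairs of invertible elements -/

section EllipticPairs
variable {k : Type u} [Field k] {H : Type v} [Ring H] [HopfAlgebra k H] (𝓡 : QuasiTriangular k H)

section Abstract
variable {P Q : Type*} [Ring P] [Algebra k P] [Ring Q] [Algebra k Q]
  (leg1 leg2 cop : P →ₐ[k] Q) (c : H ⊗[k] H →ₐ[k] Q)

/-- The two legs and the coproduct `P → Q`, with `P` and `Q` in the role of `B ⊗ H` and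
`B ⊗ (H ⊗ H)`, are related as they should be by the exchange of the two factors `H` and by `R`. -/
structure QuasiTriangular.IsLegSystem (τ : Q →ₐ[k] Q) : Prop where
  swap_leg1 : ∀ Z, τ (leg1 Z) = leg2 Z
  swap_leg2 : ∀ Z, τ (leg2 Z) = leg1 Z
  swap_const : ∀ t, τ (c t) = c (TensorProduct.comm k H H t)
  const_mul_cop : ∀ Z, c 𝓡.R * cop Z = τ (cop Z) * c 𝓡.R

namespace QuasiTriangular
variable {𝓡 leg1 leg2 cop c}

theorem comm_R : TensorProduct.comm k H H 𝓡.R = 𝓡.R21 := rfl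

theorem comm_R21 : TensorProduct.comm k H H 𝓡.R21 = 𝓡.R :=
  (TensorProduct.comm k H H).symm_apply_apply _

/-- For the parameter `1`, the factor in front of the reflection axiom is `R²¹`. -/
theorem D_mul_inv : 𝓡.D ^ (1 : ℤ) * 𝓡.R⁻¹ = 𝓡.R21 := by
  rw [zpow_one, D, mul_inv_cancel_right]

/-- Elliptic pairs of units, in terms of relations in the group of units. The reflection equations
in the tuple come from applying `R Δ(x) = Δᵒᵖ(x) R` to both sides of the reflection axioms. -/
theorem IsLegSystem.relations_iff {τ : Q →ₐ[k] Q} (h : 𝓡.IsLegSystem leg1 leg2 cop c τ)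
    (X Y : Pˣ) : 𝓡.EllipticRelations leg1 leg2 cop c 1 (X : P) (Y : P) ↔
      IsEllipticTuple (Units.map (c : H ⊗[k] H →* Q) 𝓡.R) (Units.map (c : H ⊗[k] H →* Q) 𝓡.R21)
          (Units.map (leg1 : P →* Q) X) (Units.map (leg2 : P →* Q) X)
          (Units.map (leg1 : P →* Q) Y) (Units.map (leg2 : P →* Q) Y) ∧
        Units.map (cop : P →* Q) X =
          Units.map (c : H ⊗[k] H →* Q) 𝓡.R21 * Units.map (leg2 : P →* Q) X *
            Units.map (c : H ⊗[k] H →* Q) 𝓡.R * Units.map (leg1 : P →* Q) X ∧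
        Units.map (cop : P →* Q) Y =
          Units.map (c : H ⊗[k] H →* Q) 𝓡.R21 * Units.map (leg2 : P →* Q) Y *
            Units.map (c : H ⊗[k] H →* Q) 𝓡.R * Units.map (leg1 : P →* Q) Y := by
  set r := Units.map (c : H ⊗[k] H →* Q) 𝓡.R
  set s := Units.map (c : H ⊗[k] H →* Q) 𝓡.R21
  set x₁ := Units.map (leg1 : P →* Q) X
  set x₂ := Units.map (leg2 : P →* Q) X
  set y₁ := Units.map (leg1 : P →* Q) Y
  set y₂ := Units.map (leg2 : P →* Q) Y
  have hτr : Units.map (τ : Q →* Q) r = s := Units.ext (h.swap_const _)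
  have hτs : Units.map (τ : Q →* Q) s = r :=
    Units.ext ((h.swap_const _).trans (congrArg c comm_R21))
  have hτx₁ : Units.map (τ : Q →* Q) x₁ = x₂ := Units.ext (h.swap_leg1 _)
  have hτx₂ : Units.map (τ : Q →* Q) x₂ = x₁ := Units.ext (h.swap_leg2 _)
  have hτy₁ : Units.map (τ : Q →* Q) y₁ = y₂ := Units.ext (h.swap_leg1 _)
  have hτy₂ : Units.map (τ : Q →* Q) y₂ = y₁ := Units.ext (h.swap_leg2 _)
  have hcop : ∀ Z : Pˣ, r * Units.map (cop : P →* Q) Z =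
      Units.map (τ : Q →* Q) (Units.map (cop : P →* Q) Z) * r := fun Z =>
    Units.ext (h.const_mul_cop Z)
  constructor
  · intro hXY
    have cX : Units.map (cop : P →* Q) X = s * x₂ * r * x₁ :=
      Units.ext (by have := hXY.reflection_left; rwa [D_mul_inv] at this)
    have cY : Units.map (cop : P →* Q) Y = s * y₂ * r * y₁ :=
      Units.ext (by have := hXY.reflection_right; rwa [D_mul_inv] at this)
    have ell : x₁ * s * y₂ = s * y₂ * r * x₁ * s := Units.ext hXY.elliptic
    have rX := hcop X
    have rY := hcop Y
    rw [cX] at rX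
    rw [cY] at rY
    simp only [map_mul, hτr, hτs, hτx₁, hτx₂, hτy₁, hτy₂] at rX rY
    have rX' := congrArg (Units.map (τ : Q →* Q)) rX
    have rY' := congrArg (Units.map (τ : Q →* Q)) rY
    have ell' := congrArg (Units.map (τ : Q →* Q)) ell
    simp only [map_mul, hτr, hτs, hτx₁, hτx₂, hτy₁, hτy₂] at rX' rY' ell'
    exact ⟨⟨rX, rX', rY, rY', ell, ell'⟩, cX, cY⟩
  · rintro ⟨ht, cX, cY⟩
    refine ⟨?_, ?_, congrArg Units.val ht.ell⟩
    · rw [D_mul_inv]; exact congrArg Units.val cX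
    · rw [D_mul_inv]; exact congrArg Units.val cY

section
variable {τ : Q →ₐ[k] Q} (h : 𝓡.IsLegSystem leg1 leg2 cop c τ) {X Y : Pˣ}
  (hXY : 𝓡.EllipticRelations leg1 leg2 cop c 1 (X : P) (Y : P))
include h hXY

theorem IsLegSystem.actB : 𝓡.EllipticRelations leg1 leg2 cop c 1 (X : P) ↑(Y * X⁻¹) := by
  obtain ⟨ht, cX, cY⟩ := (h.relations_iff X Y).1 hXY
  refine (h.relations_iff _ _).2 ⟨?_, cX, ?_⟩
  · simpa only [map_mul, map_inv] using ht.actB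
  · simp only [map_mul, map_inv, cX, cY, ht.cop_mul_inv]

theorem IsLegSystem.actBInv : 𝓡.EllipticRelations leg1 leg2 cop c 1 (X : P) ↑(Y * X) := by
  obtain ⟨ht, cX, cY⟩ := (h.relations_iff X Y).1 hXY
  refine (h.relations_iff _ _).2 ⟨?_, cX, ?_⟩
  · simpa only [map_mul] using ht.actBInv
  · simp only [map_mul, cX, cY, ht.cop_mul]

theorem IsLegSystem.actA :
    𝓡.EllipticRelations leg1 leg2 cop c 1 (Y : P) ↑(Y * X⁻¹ * Y⁻¹) := by
  obtain ⟨ht, cX, cY⟩ := (h.relations_iff X Y).1 hXY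
  refine (h.relations_iff _ _).2 ⟨?_, cY, ?_⟩
  · simpa only [map_mul, map_inv] using ht.actA
  · simp only [map_mul, map_inv, cX, cY, ht.cop_actA]

theorem IsLegSystem.actAInv :
    𝓡.EllipticRelations leg1 leg2 cop c 1 ↑(X⁻¹ * Y⁻¹ * X) (X : P) := by
  obtain ⟨ht, cX, cY⟩ := (h.relations_iff X Y).1 hXY
  refine (h.relations_iff _ _).2 ⟨?_, ?_, cX⟩
  · simpa only [map_mul, map_inv] using ht.actAInv
  · simp only [map_mul, map_inv, cX, cY, ht.cop_actAInv]
end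
end QuasiTriangular
end Abstract

variable {B : Type w} [Ring B] [Algebra k B]

theorem QuasiTriangular.isLegSystem_tensor : 𝓡.IsLegSystem
    (Algebra.TensorProduct.map (AlgHom.id k B) Algebra.TensorProduct.includeLeft)
    (Algebra.TensorProduct.map (AlgHom.id k B) Algebra.TensorProduct.includeRight)
    (Algebra.TensorProduct.map (AlgHom.id k B) (Bialgebra.comulAlgHom k H))
    (Algebra.TensorProduct.includeRight : H ⊗[k] H →ₐ[k] B ⊗[k] (H ⊗[k] H))
    (Algebra.TensorProduct.map (AlgHom.id k B) (Algebra.TensorProduct.comm k H H).toAlgHom) where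
  swap_leg1 Z := by
    induction Z with
    | zero => simp
    | tmul b x => simp
    | add Z W hZ hW => simp only [map_add, hZ, hW]
  swap_leg2 Z := by
    induction Z with
    | zero => simp
    | tmul b x => simp
    | add Z W hZ hW => simp only [map_add, hZ, hW]
  swap_const t := by simp; rfl
  const_mul_cop Z := by
    induction Z with
    | zero => simp
    | tmul b x =>
      have := 𝓡.mul_comul x
      simp only [Algebra.TensorProduct.map_tmul, AlgHom.id_apply, Bialgebra.comulAlgHom_apply,
        Algebra.TensorProduct.includeRight_apply, Algebra.TensorProduct.tmul_mul_tmul, this,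
        one_mul, mul_one]
      rfl
    | add Z W hZ hW => simp only [map_add, mul_add, add_mul, hZ, hW]

theorem QuasiTriangular.isLegSystem_completed : 𝓡.IsLegSystem
    (CompletedTensor.mapRight (Algebra.TensorProduct.includeLeft : H →ₐ[k] H ⊗[k] H))
    (CompletedTensor.mapRight (Algebra.TensorProduct.includeRight : H →ₐ[k] H ⊗[k] H))
    (CompletedTensor.mapRight (Bialgebra.comulAlgHom k H))
    (CompletedTensor.const : H ⊗[k] H →ₐ[k] CompletedTensor k B (H ⊗[k] H))
    (CompletedTensor.mapRight (Algebra.TensorProduct.comm k H H).toAlgHom) where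
  swap_leg1 Z := by
    rw [CompletedTensor.mapRight_mapRight]
    congr 1
  swap_leg2 Z := by
    rw [CompletedTensor.mapRight_mapRight]
    congr 1
  swap_const t := rfl
  const_mul_cop Z := by
    rw [CompletedTensor.mapRight_mapRight]
    exact CompletedTensor.const_mul_mapRight (fun x => 𝓡.mul_comul x) Z

end EllipticPairs

/-! ### The antipode and the universal `R`-matrix -/

section AntipodeR
variable {k : Type u} [Field k] {H : Type v} [Ring H] [HopfAlgebra k H] (𝓡 : QuasiTriangular k H)
open HopfAlgebra

namespace QuasiTriangular

theorem lid_counit_left : TensorProduct.map (Algebra.linearMap k H ∘ₗ Coalgebra.counit)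
    LinearMap.id (𝓡.R : H ⊗[k] H) = 1 := by
  have : ∀ t : H ⊗[k] H, TensorProduct.map (Algebra.linearMap k H ∘ₗ Coalgebra.counit)
      LinearMap.id t = (1 : H) ⊗ₜ[k] TensorProduct.lid k H
        (TensorProduct.map Coalgebra.counit LinearMap.id t) := by
    intro t
    induction t with
    | zero => simp
    | tmul a b => simp [Algebra.algebraMap_eq_smul_one, TensorProduct.smul_tmul]
    | add s t hs ht => simp only [map_add, TensorProduct.tmul_add, hs, ht]
  rw [this, 𝓡.counit_left]; rfl

theorem rid_counit_right : TensorProduct.map LinearMap.id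
    (Algebra.linearMap k H ∘ₗ Coalgebra.counit) (𝓡.R : H ⊗[k] H) = 1 := by
  have : ∀ t : H ⊗[k] H, TensorProduct.map LinearMap.id
      (Algebra.linearMap k H ∘ₗ Coalgebra.counit) t = TensorProduct.rid k H
        (TensorProduct.map LinearMap.id Coalgebra.counit t) ⊗ₜ[k] (1 : H) := by
    intro t
    induction t with
    | zero => simp
    | tmul a b => simp [Algebra.algebraMap_eq_smul_one, TensorProduct.smul_tmul]
    | add s t hs ht => simp only [map_add, TensorProduct.add_tmul, hs, ht]
  rw [this, 𝓡.counit_right]; rfl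

/-- `(S ⊗ id)(R) = R⁻¹`. -/
theorem antipode_left : TensorProduct.map (antipode k) LinearMap.id (𝓡.R : H ⊗[k] H) =
    ↑𝓡.R⁻¹ := by
  -- `a ⊗ b ⊗ c ↦ S(a) b ⊗ c`
  let K : H ⊗[k] (H ⊗[k] H) →ₗ[k] H ⊗[k] H :=
    TensorProduct.map (LinearMap.mul' k H ∘ₗ (antipode k).rTensor H) LinearMap.id ∘ₗ
      (TensorProduct.assoc k H H H).symm.toLinearMap
  have hK : ∀ a b c, K (a ⊗ₜ (b ⊗ₜ c)) = (antipode k a * b) ⊗ₜ c := fun a b c => by simp [K]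
  have h1 : ∀ s t : H ⊗[k] H, K (leg13 s * leg23 t) =
      TensorProduct.map (antipode k) LinearMap.id s * t := by
    intro s t
    induction s with
    | zero => simp
    | add s s' h h' => simp only [map_add, add_mul, h, h']
    | tmul a c =>
      induction t with
      | zero => simp
      | add t t' h h' => simp only [map_add, mul_add, h, h']
      | tmul b d => simp [leg13, leg23, hK]
  have h2 : ∀ t : H ⊗[k] H, K (TensorProduct.assoc k H H H
      (TensorProduct.map Coalgebra.comul LinearMap.id t)) =
      TensorProduct.map (Algebra.linearMap k H ∘ₗ Coalgebra.counit) LinearMap.id t := by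
    intro t
    induction t with
    | zero => simp
    | add s s' h h' => simp only [map_add, h, h']
    | tmul a c =>
      have := LinearMap.congr_fun (HopfAlgebra.mul_antipode_rTensor_comul (R := k) (A := H)) a
      simp only [LinearMap.comp_apply] at this
      simp [K, this]
  have h := congrArg K 𝓡.comul_left
  rw [h2, lid_counit_left] at h
  exact (Units.inv_eq_of_mul_eq_one_left ((h1 _ _).symm.trans h.symm)).symm

/-- `(id ⊗ S)(R⁻¹) = R`. -/
theorem antipode_right : TensorProduct.map LinearMap.id (antipode k) (↑𝓡.R⁻¹ : H ⊗[k] H) =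
    𝓡.R := by
  -- `a ⊗ b ⊗ c ↦ a ⊗ b S(c)`
  let K : H ⊗[k] (H ⊗[k] H) →ₗ[k] H ⊗[k] H :=
    TensorProduct.map LinearMap.id (LinearMap.mul' k H ∘ₗ (antipode k).lTensor H)
  have hK : ∀ a b c, K (a ⊗ₜ (b ⊗ₜ c)) = a ⊗ₜ (b * antipode k c) := fun a b c => by simp [K]
  let U := 𝓡.pairUnit (fourActions k H 0) (fourActions k H 3)
    (fourActions_commute k H 0 3 (by decide))
  have h1 : ∀ s t : H ⊗[k] H, K (leg13 s * leg12 t) =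
      evalPair (fourActions k H 0).toLinearMap (fourActions k H 3).toLinearMap s t := by
    intro s t
    induction s with
    | zero => simp
    | add s s' h h' => simp only [map_add, add_mul, h, h', LinearMap.add_apply]
    | tmul a c =>
      induction t with
      | zero => simp
      | add t t' h h' => simp only [map_add, mul_add, h, h']
      | tmul b d => simp [leg13, leg12, hK, fourActions]
  have h2 : ∀ t : H ⊗[k] H, K (TensorProduct.map LinearMap.id Coalgebra.comul t) =
      TensorProduct.map LinearMap.id (Algebra.linearMap k H ∘ₗ Coalgebra.counit) t := by
    intro t
    induction t with
    | zero => simp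
    | add s s' h h' => simp only [map_add, h, h']
    | tmul a c =>
      have := LinearMap.congr_fun (HopfAlgebra.mul_antipode_lTensor_comul (R := k) (A := H)) c
      simp only [LinearMap.comp_apply] at this
      simp [K, this]
  have h := congrArg K 𝓡.comul_right
  rw [h2, rid_counit_right] at h
  have h3 : (U : Module.End k (H ⊗[k] H)) (𝓡.R : H ⊗[k] H) = 1 := by
    rw [QuasiTriangular.pairUnit_val]
    exact (h1 _ _).symm.trans h.symm
  have h4 : (↑U⁻¹ : Module.End k (H ⊗[k] H)) 1 = 𝓡.R := by
    rw [← h3, ← Module.End.mul_apply, Units.inv_mul, Module.End.one_apply]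
  rw [QuasiTriangular.pairUnit_inv] at h4
  rw [← h4]
  generalize (↑𝓡.R⁻¹ : H ⊗[k] H) = t
  induction t with
  | zero => simp
  | add s s' h h' => simp only [map_add, h, h', LinearMap.add_apply]
  | tmul a b => simp [fourActions, Algebra.TensorProduct.one_def]

/-- `(S ⊗ S)(R⁻¹) = R⁻¹`. -/
theorem antipode_both_inv : TensorProduct.map (antipode k) (antipode k) (↑𝓡.R⁻¹ : H ⊗[k] H) =
    ↑𝓡.R⁻¹ := by
  have h : ∀ t : H ⊗[k] H, TensorProduct.map (antipode k) (antipode k) t =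
      TensorProduct.map (antipode k) LinearMap.id
        (TensorProduct.map LinearMap.id (antipode k) t) := fun t => by
    rw [← LinearMap.comp_apply, ← TensorProduct.map_comp, LinearMap.id_comp, LinearMap.comp_id]
  rw [h, antipode_right, antipode_left]

theorem _root_.map_antipode_mul (s t : H ⊗[k] H) :
    TensorProduct.map (antipode k) (antipode k) (s * t) =
      TensorProduct.map (antipode k) (antipode k) t *
        TensorProduct.map (antipode k) (antipode k) s := by
  induction s with
  | zero => simp
  | add s s' h h' => simp only [map_add, add_mul, mul_add, h, h']
  | tmul a c =>
    induction t with
    | zero => simp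
    | add t t' h h' => simp only [map_add, add_mul, mul_add, h, h']
    | tmul b d => simp [HopfAlgebra.antipode_mul_antidistrib]

/-- `(S ⊗ S)(R) = R`. -/
theorem antipode_both : TensorProduct.map (antipode k) (antipode k) (𝓡.R : H ⊗[k] H) = 𝓡.R := by
  have h := map_antipode_mul (𝓡.R : H ⊗[k] H) (↑𝓡.R⁻¹ : H ⊗[k] H)
  rw [Units.mul_inv, antipode_both_inv] at h
  refine (Units.inv_mul_eq_one.1 (h.symm.trans ?_)).symm
  simp [Algebra.TensorProduct.one_def]

end QuasiTriangular
end AntipodeR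

/-! ### Products in the elliptic double -/

section Represents
variable {k : Type u} [Field k] {H : Type v} [Ring H] [HopfAlgebra k H] {𝓡 : QuasiTriangular k H}
variable {A : Type w} [Ring A] [Algebra k A]

variable (𝓡) in
/-- The elements of the elliptic double as functionals on `H ⊗ H`. -/
noncomputable def EllipticDouble.functional : EllipticDouble 𝓡 →ₗ[k] H ⊗[k] H →ₗ[k] k where
  toFun φ := φ.1.ofConv
  map_add' _ _ := rfl
  map_smul' _ _ := rfl

theorem EllipticDouble.functional_injective : Function.Injective (functional 𝓡) :=
  fun _ _ h => Subtype.ext (WithConv.ext h)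

theorem EllipticDouble.functional_mul (φ ψ : EllipticDouble 𝓡) (c : H ⊗[k] H) :
    functional 𝓡 (φ * ψ) c = TensorProduct.dualDistrib k (H ⊗[k] H) (H ⊗[k] H)
      (functional 𝓡 φ ⊗ₜ functional 𝓡 ψ) (ellipticComul 𝓡 c) := by
  have h : LinearMap.mul' k k ∘ₗ TensorProduct.map (functional 𝓡 φ) (functional 𝓡 ψ) =
      TensorProduct.dualDistrib k (H ⊗[k] H) (H ⊗[k] H)
        (functional 𝓡 φ ⊗ₜ functional 𝓡 ψ) :=
    TensorProduct.ext' fun a b => by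
      rw [LinearMap.comp_apply, TensorProduct.map_tmul]; rfl
  exact LinearMap.congr_fun h _

/-- The element `F` of `E ⊗̂ A` is the one given by a linear map `G : H ⊗ H → A`: at `f` in `A°` it
takes the value `f ∘ G`, a functional on `H ⊗ H`. -/
def Represents (F : CompletedTensor k (EllipticDouble 𝓡) A) (G : H ⊗[k] H →ₗ[k] A) : Prop :=
  ∀ (f : RestrictedDual k A) (c : H ⊗[k] H), EllipticDouble.functional 𝓡 (F.ofConv f) c = f.1 (G c)

variable (𝓡) in
/-- The convolution product of linear maps `H ⊗ H → A` for the coproduct `ellipticComul`. -/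
noncomputable def ellipticConv (G G' : H ⊗[k] H →ₗ[k] A) : H ⊗[k] H →ₗ[k] A :=
  LinearMap.mul' k A ∘ₗ TensorProduct.map G G' ∘ₗ ellipticComul 𝓡

theorem RestrictedDual.pair2_comul_apply (f : RestrictedDual k A) (z : A ⊗[k] A) :
    RestrictedDual.pair2 k A (Coalgebra.comul (R := k) f) z = f.1 (LinearMap.mul' k A z) := by
  induction z with
  | zero => simp
  | add s t hs ht => simp only [map_add, hs, ht]
  | tmul a b => rw [RestrictedDual.pair2_comul, LinearMap.mul'_apply]

namespace Represents
variable {F F' : CompletedTensor k (EllipticDouble 𝓡) A} {G G' : H ⊗[k] H →ₗ[k] A}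

theorem eq (h : Represents F G) (h' : Represents F' G) : F = F' := by
  refine CompletedTensor.ext fun f => EllipticDouble.functional_injective
    (LinearMap.ext fun c => (h f c).trans (h' f c).symm)

theorem mul (h : Represents F G) (h' : Represents F' G') :
    Represents (F * F') (ellipticConv 𝓡 G G') := by
  intro f c
  rw [CompletedTensor.mul_apply]
  have key : ∀ t : RestrictedDual k A ⊗[k] RestrictedDual k A,
      EllipticDouble.functional 𝓡 (LinearMap.mul' k (EllipticDouble 𝓡)
        (TensorProduct.map F.ofConv F'.ofConv t)) c =
        RestrictedDual.pair2 k A t (TensorProduct.map G G' (ellipticComul 𝓡 c)) := by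
    intro t
    induction t with
    | zero => simp only [map_zero, LinearMap.zero_apply]
    | add s t hs ht => simp only [map_add, LinearMap.add_apply, hs, ht]
    | tmul f g =>
      rw [TensorProduct.map_tmul, LinearMap.mul'_apply, EllipticDouble.functional_mul]
      generalize ellipticComul 𝓡 c = s
      induction s with
      | zero => simp only [map_zero]
      | add s s' hs hs' => simp only [map_add, hs, hs']
      | tmul c d =>
        rw [TensorProduct.dualDistrib_apply, h f c, h' g d]
        rfl
  rw [key, RestrictedDual.pair2_comul_apply]
  rfl

theorem const_mul (h : Represents F G) (a : A) :
    Represents (CompletedTensor.const a * F) (LinearMap.mulLeft k a ∘ₗ G) := by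
  intro f c
  rw [CompletedTensor.const_mul_apply, h, RestrictedDual.translate_apply]
  simp

theorem mul_const (h : Represents F G) (a : A) :
    Represents (F * CompletedTensor.const a) (LinearMap.mulRight k a ∘ₗ G) := by
  intro f c
  rw [CompletedTensor.mul_const_apply, h, RestrictedDual.translate_apply]
  simp

theorem mapRight {A' : Type*} [Ring A'] [Algebra k A'] (h : Represents F G) (φ : A →ₐ[k] A') :
    Represents (CompletedTensor.mapRight φ F) (φ.toLinearMap ∘ₗ G) := fun _ c => h _ c

end Represents

section Reductions
variable (k H) in
/-- The map `u ⊗ v ↦ ε(v) u`. -/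
noncomputable def counitSnd : H ⊗[k] H →ₗ[k] H :=
  (TensorProduct.rid k H).toLinearMap ∘ₗ TensorProduct.map LinearMap.id Coalgebra.counit

variable (k H) in
/-- The map `u ⊗ v ↦ ε(u) v`. -/
noncomputable def counitFst : H ⊗[k] H →ₗ[k] H :=
  (TensorProduct.lid k H).toLinearMap ∘ₗ TensorProduct.map Coalgebra.counit LinearMap.id

@[simp] theorem counitSnd_tmul (a b : H) :
    counitSnd k H (a ⊗ₜ b) = Coalgebra.counit (R := k) b • a := by simp [counitSnd]

@[simp] theorem counitFst_tmul (a b : H) :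
    counitFst k H (a ⊗ₜ b) = Coalgebra.counit (R := k) a • b := by simp [counitFst]

theorem represents_X : Represents (EllipticDouble.X 𝓡) (counitSnd k H) := by
  intro f c
  induction c with
  | zero => simp only [map_zero]
  | add s t hs ht => simp only [map_add, hs, ht]
  | tmul a b =>
    have : f.1 (counitSnd k H (a ⊗ₜ b)) = f.1 a * Coalgebra.counit (R := k) b := by
      simp [mul_comm]
    rw [this]; rfl

theorem represents_Y : Represents (EllipticDouble.Y 𝓡) (counitFst k H) := by
  intro f c
  induction c with
  | zero => simp only [map_zero]
  | add s t hs ht => simp only [map_add, hs, ht]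
  | tmul a b =>
    have : f.1 (counitFst k H (a ⊗ₜ b)) = Coalgebra.counit (R := k) a * f.1 b := by
      simp
    rw [this]; rfl

/-- The action of `∑ a ⊗ b` on `H ⊗ H` for which `a` acts by the `i`-th and `b` by the `j`-th of the
four actions of `H`. -/
noncomputable def pairAct (i j : Fin 4) (t : H ⊗[k] H) : Module.End k (H ⊗[k] H) :=
  evalPair (fourActions k H i).toLinearMap (fourActions k H j).toLinearMap t

variable (𝓡) in
/-- The operator `a ⊗ b ↦ ∑ a S(r'₁) S(r₂) ⊗ r₁ b S(r'₂)` that turns the coproduct of `H` into the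
one dual to the product of the twisted braided dual, where `∑ r₁ ⊗ r₂ = R` and
`∑ r'₁ ⊗ r'₂ = R⁻¹`. -/
noncomputable def braidedTwist : Module.End k (H ⊗[k] H) :=
  pairAct 2 1 (𝓡.R : H ⊗[k] H) * pairAct 1 3 (↑𝓡.R⁻¹ : H ⊗[k] H)

variable (𝓡) in
/-- The operator by which the coproduct `ellipticComul` couples the two copies of `H`: it composes
the four substitutions that turn `v' ⊗ u''` into `a ⊗ b` in the definition of the product of the
elliptic double. -/
noncomputable def crossTwist : Module.End k (H ⊗[k] H) :=
  pairAct 2 1 (𝓡.R : H ⊗[k] H) * pairAct 0 2 (↑𝓡.R⁻¹ : H ⊗[k] H) *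
    pairAct 1 3 (↑𝓡.R⁻¹ : H ⊗[k] H) * pairAct 0 3 (↑𝓡.R⁻¹ : H ⊗[k] H)

theorem map_counitSnd_counitSnd_comul (c : H ⊗[k] H) :
    TensorProduct.map (counitSnd k H) (counitSnd k H) (Coalgebra.comul (R := k) c) =
      Coalgebra.comul (counitSnd k H c) := by
  have h : ∀ s t : H ⊗[k] H, TensorProduct.map (counitSnd k H) (counitSnd k H)
      (TensorProduct.AlgebraTensorModule.tensorTensorTensorComm k k k k H H H H (s ⊗ₜ t)) =
      Coalgebra.counit (R := k) (TensorProduct.rid k H (Coalgebra.counit.lTensor H t)) • s := by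
    intro s t
    induction s with
    | zero => simp
    | add s s' h h' => simp only [map_add, TensorProduct.add_tmul, smul_add, h, h']
    | tmul a b =>
      induction t with
      | zero => simp
      | add t t' h h' => simp only [map_add, TensorProduct.tmul_add, add_smul, h, h']
      | tmul d e => simp [TensorProduct.smul_tmul, TensorProduct.tmul_smul, smul_smul]
  induction c with
  | zero => simp
  | add s t hs ht => simp only [map_add, hs, ht]
  | tmul u v =>
    rw [TensorProduct.comul_tmul, h, Coalgebra.lTensor_counit_comul]
    simp

theorem map_counitFst_counitFst_comul (c : H ⊗[k] H) :
    TensorProduct.map (counitFst k H) (counitFst k H) (Coalgebra.comul (R := k) c) =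
      Coalgebra.comul (counitFst k H c) := by
  have h : ∀ s t : H ⊗[k] H, TensorProduct.map (counitFst k H) (counitFst k H)
      (TensorProduct.AlgebraTensorModule.tensorTensorTensorComm k k k k H H H H (s ⊗ₜ t)) =
      Coalgebra.counit (R := k) (TensorProduct.rid k H (Coalgebra.counit.lTensor H s)) • t := by
    intro s t
    induction s with
    | zero => simp
    | add s s' h h' => simp only [map_add, TensorProduct.add_tmul, add_smul, h, h']
    | tmul a b =>
      induction t with
      | zero => simp
      | add t t' h h' => simp only [map_add, TensorProduct.tmul_add, smul_add, h, h']
      | tmul d e => simp [TensorProduct.smul_tmul, TensorProduct.tmul_smul, smul_smul]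
  induction c with
  | zero => simp
  | add s t hs ht => simp only [map_add, hs, ht]
  | tmul u v =>
    rw [TensorProduct.comul_tmul, h, Coalgebra.lTensor_counit_comul]
    simp

theorem map_counitSnd_counitFst_comul (c : H ⊗[k] H) :
    TensorProduct.map (counitSnd k H) (counitFst k H) (Coalgebra.comul (R := k) c) = c := by
  have h : ∀ s t : H ⊗[k] H, TensorProduct.map (counitSnd k H) (counitFst k H)
      (TensorProduct.AlgebraTensorModule.tensorTensorTensorComm k k k k H H H H (s ⊗ₜ t)) =
      TensorProduct.rid k H (Coalgebra.counit.lTensor H s) ⊗ₜ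
        TensorProduct.lid k H (Coalgebra.counit.rTensor H t) := by
    intro s t
    induction s with
    | zero => simp
    | add s s' h h' => simp only [map_add, TensorProduct.add_tmul, h, h']
    | tmul a b =>
      induction t with
      | zero => simp
      | add t t' h h' => simp only [map_add, TensorProduct.tmul_add, h, h']
      | tmul d e => simp [TensorProduct.smul_tmul, TensorProduct.tmul_smul, smul_smul, mul_comm]
  induction c with
  | zero => simp
  | add s t hs ht => simp only [map_add, hs, ht]
  | tmul u v =>
    rw [TensorProduct.comul_tmul, h, Coalgebra.lTensor_counit_comul,
      Coalgebra.rTensor_counit_comul]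
    simp

theorem map_counitFst_counitSnd_comul (c : H ⊗[k] H) :
    TensorProduct.map (counitFst k H) (counitSnd k H) (Coalgebra.comul (R := k) c) =
      TensorProduct.comm k H H c := by
  have h : ∀ s t : H ⊗[k] H, TensorProduct.map (counitFst k H) (counitSnd k H)
      (TensorProduct.AlgebraTensorModule.tensorTensorTensorComm k k k k H H H H (s ⊗ₜ t)) =
      TensorProduct.rid k H (Coalgebra.counit.lTensor H t) ⊗ₜ
        TensorProduct.lid k H (Coalgebra.counit.rTensor H s) := by
    intro s t
    induction s with
    | zero => simp
    | add s s' h h' =>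
      simp only [map_add, TensorProduct.add_tmul, TensorProduct.tmul_add, h, h']
    | tmul a b =>
      induction t with
      | zero => simp
      | add t t' h h' =>
        simp only [map_add, TensorProduct.tmul_add, TensorProduct.add_tmul, h, h']
      | tmul d e => simp [TensorProduct.smul_tmul, TensorProduct.tmul_smul, smul_smul, mul_comm]
  induction c with
  | zero => simp
  | add s t hs ht => simp only [map_add, hs, ht]
  | tmul u v =>
    rw [TensorProduct.comul_tmul, h, Coalgebra.lTensor_counit_comul,
      Coalgebra.rTensor_counit_comul]
    simp

/-- The counit of the second copy of `H` makes trivial all copies of `R` that act on it, and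
`ellipticComul` reduces to the coproduct of the twisted braided dual. -/
theorem map_counitSnd_counitSnd_ellipticComul (c : H ⊗[k] H) :
    TensorProduct.map (counitSnd k H) (counitSnd k H) (ellipticComul 𝓡 c) =
      braidedTwist 𝓡 (Coalgebra.comul (counitSnd k H c)) := by
  have h := 𝓡.twistWord_intertwine (TensorProduct.map (counitSnd k H) (counitSnd k H))
    (fun a => (copies2 k H 0 a).toLinearMap) (fun a => (copies2 k H 1 a).toLinearMap)
    (fun a => (![fourActions k H 0, fourActions k H 1, trivHom k H _, trivHom k H _] a).toLinearMap)
    (fun a => (![fourActions k H 2, fourActions k H 3, trivHom k H _, trivHom k H _] a).toLinearMap)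
    ?_ ?_
  · simp only [QuasiTriangular.twistWord, Matrix.cons_val, evalPair_triv, mul_one, one_mul] at h
    exact (LinearMap.congr_fun h _).trans
      (congrArg (braidedTwist 𝓡) (map_counitSnd_counitSnd_comul c))
  all_goals
    intro a x
    refine TensorProduct.ext_fourfold' fun c d e f => ?_
    fin_cases a <;> simp [copies2, fourActions, trivHom_apply, ← TensorProduct.smul_tmul',
      smul_smul, mul_comm, mul_left_comm]

theorem map_counitFst_counitFst_ellipticComul (c : H ⊗[k] H) :
    TensorProduct.map (counitFst k H) (counitFst k H) (ellipticComul 𝓡 c) =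
      braidedTwist 𝓡 (Coalgebra.comul (counitFst k H c)) := by
  have h := 𝓡.twistWord_intertwine (TensorProduct.map (counitFst k H) (counitFst k H))
    (fun a => (copies2 k H 0 a).toLinearMap) (fun a => (copies2 k H 1 a).toLinearMap)
    (fun a => (![trivHom k H _, trivHom k H _, fourActions k H 0, fourActions k H 1] a).toLinearMap)
    (fun a => (![trivHom k H _, trivHom k H _, fourActions k H 2, fourActions k H 3] a).toLinearMap)
    ?_ ?_
  · simp only [QuasiTriangular.twistWord, Matrix.cons_val, evalPair_triv, mul_one, one_mul] at h
    exact (LinearMap.congr_fun h _).trans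
      (congrArg (braidedTwist 𝓡) (map_counitFst_counitFst_comul c))
  all_goals
    intro a x
    refine TensorProduct.ext_fourfold' fun c d e f => ?_
    fin_cases a <;> simp [copies2, fourActions, trivHom_apply, ← TensorProduct.smul_tmul',
      smul_smul, mul_comm, mul_left_comm]

/-- The reduction of `ellipticComul` that determines the products `X(f) Y(g)`: no copy of `R`
survives. -/
theorem map_counitSnd_counitFst_ellipticComul (c : H ⊗[k] H) :
    TensorProduct.map (counitSnd k H) (counitFst k H) (ellipticComul 𝓡 c) = c := by
  have h := 𝓡.twistWord_intertwine (TensorProduct.map (counitSnd k H) (counitFst k H))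
    (fun a => (copies2 k H 0 a).toLinearMap) (fun a => (copies2 k H 1 a).toLinearMap)
    (fun a => (![fourActions k H 0, fourActions k H 1, trivHom k H _, trivHom k H _] a).toLinearMap)
    (fun a => (![trivHom k H _, trivHom k H _, fourActions k H 2, fourActions k H 3] a).toLinearMap)
    ?_ ?_
  · simp only [QuasiTriangular.twistWord, Matrix.cons_val, evalPair_triv, mul_one] at h
    exact (LinearMap.congr_fun h _).trans (map_counitSnd_counitFst_comul c)
  all_goals
    intro a x
    refine TensorProduct.ext_fourfold' fun c d e f => ?_
    fin_cases a <;> simp [copies2, fourActions, trivHom_apply, ← TensorProduct.smul_tmul',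
      smul_smul, mul_comm, mul_left_comm]

/-- The reduction of `ellipticComul` that determines the products `Y(f) X(g)`. -/
theorem map_counitFst_counitSnd_ellipticComul (c : H ⊗[k] H) :
    TensorProduct.map (counitFst k H) (counitSnd k H) (ellipticComul 𝓡 c) =
      crossTwist 𝓡 (TensorProduct.comm k H H c) := by
  have h := 𝓡.twistWord_intertwine (TensorProduct.map (counitFst k H) (counitSnd k H))
    (fun a => (copies2 k H 0 a).toLinearMap) (fun a => (copies2 k H 1 a).toLinearMap)
    (fun a => (![trivHom k H _, trivHom k H _, fourActions k H 0, fourActions k H 1] a).toLinearMap)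
    (fun a => (![fourActions k H 2, fourActions k H 3, trivHom k H _, trivHom k H _] a).toLinearMap)
    ?_ ?_
  · simp only [QuasiTriangular.twistWord, Matrix.cons_val, evalPair_triv, mul_one] at h
    exact (LinearMap.congr_fun h _).trans
      (congrArg (crossTwist 𝓡) (map_counitFst_counitSnd_comul c))
  all_goals
    intro a x
    refine TensorProduct.ext_fourfold' fun c d e f => ?_
    fin_cases a <;> simp [copies2, fourActions, trivHom_apply, ← TensorProduct.smul_tmul',
      smul_smul, mul_comm, mul_left_comm]
end Reductions
end Represents

/-! ### The canonical elements form an elliptic pair -/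

section CanonicalPair
variable {k : Type u} [Field k] {H : Type v} [Ring H] [HopfAlgebra k H] (𝓡 : QuasiTriangular k H)
open HopfAlgebra

theorem pairAct_inv_mul {i j : Fin 4} (h : i ≠ j) :
    pairAct i j (↑𝓡.R⁻¹ : H ⊗[k] H) * pairAct i j (𝓡.R : H ⊗[k] H) = 1 := by
  rw [pairAct, pairAct, ← 𝓡.pairUnit_val _ _ (fourActions_commute k H i j h),
    ← 𝓡.pairUnit_inv _ _ (fourActions_commute k H i j h), Units.inv_mul]

theorem pairAct_add (i j : Fin 4) (s t : H ⊗[k] H) :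
    pairAct i j (s + t) = pairAct i j s + pairAct i j t := map_add _ _ _

theorem pairAct_zero (i j : Fin 4) : pairAct i j (0 : H ⊗[k] H) = 0 := map_zero _

theorem pairAct_two_one_tmul (a b c d : H) :
    pairAct 2 1 (a ⊗ₜ[k] b) (c ⊗ₜ[k] d) = (c * antipode k b) ⊗ₜ (a * d) := by
  simp [pairAct, fourActions]

theorem pairAct_zero_three_tmul (a b c d : H) :
    pairAct 0 3 (a ⊗ₜ[k] b) (c ⊗ₜ[k] d) = (a * c) ⊗ₜ (d * antipode k b) := by
  simp [pairAct, fourActions]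

theorem pairAct_zero_two (t z : H ⊗[k] H) : pairAct 0 2 t z = t * z := by
  induction t with
  | zero => rw [pairAct_zero]; simp
  | add s t hs ht => rw [pairAct_add, LinearMap.add_apply, hs, ht, add_mul]
  | tmul a b => simp [pairAct, fourActions, ← mul_assoc]

theorem pairAct_one_three (t z : H ⊗[k] H) :
    pairAct 1 3 t z = z * TensorProduct.map (antipode k) (antipode k) t := by
  induction t with
  | zero => rw [pairAct_zero]; simp
  | add s t hs ht => rw [pairAct_add, LinearMap.add_apply, hs, ht, map_add, mul_add]
  | tmul a b => simp [pairAct, fourActions, mul_assoc]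

theorem comm_mul (s t : H ⊗[k] H) : TensorProduct.comm k H H (s * t) =
    TensorProduct.comm k H H s * TensorProduct.comm k H H t :=
  map_mul (Algebra.TensorProduct.comm k H H) s t

/-- The linear map `a ⊗ b ↦ (1 ⊗ a) R (b ⊗ 1)`. -/
noncomputable def mulAcrossR : H ⊗[k] H →ₗ[k] H ⊗[k] H :=
  LinearMap.mul' k (H ⊗[k] H) ∘ₗ TensorProduct.map
    (LinearMap.mulRight k (𝓡.R : H ⊗[k] H) ∘ₗ
      (Algebra.TensorProduct.includeRight : H →ₐ[k] H ⊗[k] H).toLinearMap)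
    (Algebra.TensorProduct.includeLeft : H →ₐ[k] H ⊗[k] H).toLinearMap

theorem mulAcrossR_apply (z : H ⊗[k] H) : mulAcrossR 𝓡 z = LinearMap.mul' k (H ⊗[k] H)
    (TensorProduct.map (LinearMap.mulRight k (𝓡.R : H ⊗[k] H) ∘ₗ
      (Algebra.TensorProduct.includeRight : H →ₐ[k] H ⊗[k] H).toLinearMap)
    (Algebra.TensorProduct.includeLeft : H →ₐ[k] H ⊗[k] H).toLinearMap z) := rfl

/-- As `R = (id ⊗ S)(R⁻¹)`, multiplication across `R` is an action of `R⁻¹`. -/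
theorem mulAcrossR_eq (z : H ⊗[k] H) : mulAcrossR 𝓡 z =
    TensorProduct.comm k H H (pairAct 2 1 (↑𝓡.R⁻¹ : H ⊗[k] H) z) := by
  induction z with
  | zero => simp
  | add s t hs ht => simp only [map_add, hs, ht]
  | tmul c d =>
    have h : ∀ t : H ⊗[k] H, ((1 : H) ⊗ₜ[k] c) *
        TensorProduct.map LinearMap.id (antipode k) t * (d ⊗ₜ[k] (1 : H)) =
        TensorProduct.comm k H H (pairAct 2 1 t (c ⊗ₜ d)) := by
      intro t
      induction t with
      | zero => rw [pairAct_zero]; simp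
      | add s t hs ht =>
        rw [pairAct_add, LinearMap.add_apply, map_add, map_add, mul_add, add_mul, hs, ht]
      | tmul a b => rw [pairAct_two_one_tmul]; simp
    rw [← h, 𝓡.antipode_right]
    simp [mulAcrossR]

theorem mulAcrossR_braidedTwist (z : H ⊗[k] H) : mulAcrossR 𝓡 (braidedTwist 𝓡 z) =
    TensorProduct.comm k H H z * ↑𝓡.R21⁻¹ := by
  rw [mulAcrossR_eq, braidedTwist, ← Module.End.mul_apply, ← mul_assoc,
    pairAct_inv_mul 𝓡 (by decide), one_mul, pairAct_one_three, 𝓡.antipode_both_inv, comm_mul]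
  rfl

theorem mulAcrossR_crossTwist (z : H ⊗[k] H) : mulAcrossR 𝓡 (crossTwist 𝓡 z) =
    ↑𝓡.R21⁻¹ * TensorProduct.comm k H H (pairAct 0 3 (↑𝓡.R⁻¹ : H ⊗[k] H) z) * ↑𝓡.R21⁻¹ := by
  rw [mulAcrossR_eq, crossTwist, ← Module.End.mul_apply, ← mul_assoc, ← mul_assoc, ← mul_assoc,
    pairAct_inv_mul 𝓡 (by decide), one_mul, Module.End.mul_apply, Module.End.mul_apply,
    pairAct_zero_two, pairAct_one_three, 𝓡.antipode_both_inv, ← mul_assoc, comm_mul, comm_mul]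
  rfl

theorem R21_mul_comul_op (x : H) : (𝓡.R21 : H ⊗[k] H) *
    TensorProduct.comm k H H (Coalgebra.comul (R := k) x) =
      Coalgebra.comul (R := k) x * (𝓡.R21 : H ⊗[k] H) := by
  have h := congrArg (TensorProduct.comm k H H) (𝓡.mul_comul x)
  rw [comm_mul, comm_mul, QuasiTriangular.comm_R] at h
  exact h.trans (congrArg (· * (𝓡.R21 : H ⊗[k] H))
    ((TensorProduct.comm k H H).symm_apply_apply (Coalgebra.comul x)))

theorem ellipticConv_comp {A' A : Type*} [Ring A'] [Algebra k A'] [AddCommGroup A] [Module k A]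
    (P Q : A →ₗ[k] A') (G G' : H ⊗[k] H →ₗ[k] A) (c : H ⊗[k] H) :
    ellipticConv 𝓡 (P ∘ₗ G) (Q ∘ₗ G') c =
      LinearMap.mul' k A' (TensorProduct.map P Q (TensorProduct.map G G' (ellipticComul 𝓡 c))) := by
  rw [ellipticConv, TensorProduct.map_comp]; rfl

open CompletedTensor QuasiTriangular Algebra.TensorProduct in
/-- The reflection axiom for an element of `E ⊗̂ H` given by a map `G` that turns `ellipticComul`
into the coproduct of the twisted braided dual. -/
theorem Represents.reflection {F : CompletedTensor k (EllipticDouble 𝓡) H} {G : H ⊗[k] H →ₗ[k] H}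
    (hF : Represents F G) (hG : ∀ c, TensorProduct.map G G (ellipticComul 𝓡 c) =
      braidedTwist 𝓡 (Coalgebra.comul (G c))) :
    CompletedTensor.mapRight (Bialgebra.comulAlgHom k H) F =
      const (𝓡.R21 : H ⊗[k] H) * CompletedTensor.mapRight (includeRight : H →ₐ[k] H ⊗[k] H) F *
        const (𝓡.R : H ⊗[k] H) * CompletedTensor.mapRight (includeLeft : H →ₐ[k] H ⊗[k] H) F := by
  have h := (((hF.mapRight (includeRight : H →ₐ[k] H ⊗[k] H)).mul_const (𝓡.R : H ⊗[k] H)).mul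
    (hF.mapRight (includeLeft : H →ₐ[k] H ⊗[k] H))).const_mul (𝓡.R21 : H ⊗[k] H)
  rw [mul_assoc, mul_assoc, ← mul_assoc (CompletedTensor.mapRight _ F)]
  refine (hF.mapRight (Bialgebra.comulAlgHom k H)).eq fun f c => (h f c).trans (congrArg f.1 ?_)
  have e : ellipticConv 𝓡 (LinearMap.mulRight k (𝓡.R : H ⊗[k] H) ∘ₗ
      (includeRight : H →ₐ[k] H ⊗[k] H).toLinearMap ∘ₗ G)
      ((includeLeft : H →ₐ[k] H ⊗[k] H).toLinearMap ∘ₗ G) c =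
      mulAcrossR 𝓡 (TensorProduct.map G G (ellipticComul 𝓡 c)) := by
    rw [mulAcrossR_apply, ← ellipticConv_comp, LinearMap.comp_assoc]
  rw [LinearMap.comp_apply, e, hG, mulAcrossR_braidedTwist, LinearMap.mulLeft_apply, ← mul_assoc,
    R21_mul_comul_op, mul_assoc, Units.mul_inv, mul_one]
  rfl

/-- The canonical elements satisfy the elliptic relations. -/
theorem canonical_isEllipticPair :
    𝓡.IsCompletedEllipticPair 1 (EllipticDouble.X 𝓡) (EllipticDouble.Y 𝓡) := by
  refine ⟨?_, ?_, ?_⟩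
  · rw [QuasiTriangular.D_mul_inv]
    exact represents_X.reflection 𝓡 map_counitSnd_counitSnd_ellipticComul
  · rw [QuasiTriangular.D_mul_inv]
    exact represents_Y.reflection 𝓡 map_counitFst_counitFst_ellipticComul
  · have h1 := ((represents_X (𝓡 := 𝓡)).mapRight
      (Algebra.TensorProduct.includeLeft : H →ₐ[k] H ⊗[k] H)).mul_const (𝓡.R21 : H ⊗[k] H)
    have h1 := h1.mul ((represents_Y (𝓡 := 𝓡)).mapRight
      (Algebra.TensorProduct.includeRight : H →ₐ[k] H ⊗[k] H))
    have h2 := ((((represents_Y (𝓡 := 𝓡)).mapRight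
      (Algebra.TensorProduct.includeRight : H →ₐ[k] H ⊗[k] H)).mul_const (𝓡.R : H ⊗[k] H)).mul
      ((represents_X (𝓡 := 𝓡)).mapRight
        (Algebra.TensorProduct.includeLeft : H →ₐ[k] H ⊗[k] H))).const_mul (𝓡.R21 : H ⊗[k] H)
    have h2 := h2.mul_const (𝓡.R21 : H ⊗[k] H)
    rw [mul_assoc (CompletedTensor.const _), mul_assoc (CompletedTensor.const _)]
    refine h1.eq fun f c => (h2 f c).trans (congrArg f.1 ?_)
    have e2 : ellipticConv 𝓡 (LinearMap.mulRight k (𝓡.R : H ⊗[k] H) ∘ₗ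
        (Algebra.TensorProduct.includeRight : H →ₐ[k] H ⊗[k] H).toLinearMap ∘ₗ counitFst k H)
        ((Algebra.TensorProduct.includeLeft : H →ₐ[k] H ⊗[k] H).toLinearMap ∘ₗ counitSnd k H) c =
        mulAcrossR 𝓡 (TensorProduct.map (counitFst k H) (counitSnd k H) (ellipticComul 𝓡 c)) := by
      rw [mulAcrossR_apply, ← ellipticConv_comp, LinearMap.comp_assoc]
    have e1 : ellipticConv 𝓡 (LinearMap.mulRight k (𝓡.R21 : H ⊗[k] H) ∘ₗ
        (Algebra.TensorProduct.includeLeft : H →ₐ[k] H ⊗[k] H).toLinearMap ∘ₗ counitSnd k H)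
        ((Algebra.TensorProduct.includeRight : H →ₐ[k] H ⊗[k] H).toLinearMap ∘ₗ counitFst k H) c =
        LinearMap.mul' k (H ⊗[k] H) (TensorProduct.map
          (LinearMap.mulRight k (𝓡.R21 : H ⊗[k] H) ∘ₗ
            (Algebra.TensorProduct.includeLeft : H →ₐ[k] H ⊗[k] H).toLinearMap)
          (Algebra.TensorProduct.includeRight : H →ₐ[k] H ⊗[k] H).toLinearMap
          (TensorProduct.map (counitSnd k H) (counitFst k H) (ellipticComul 𝓡 c))) := by
      rw [← ellipticConv_comp, LinearMap.comp_assoc]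
    rw [e1, LinearMap.comp_apply, LinearMap.comp_apply, e2, map_counitFst_counitSnd_ellipticComul,
      map_counitSnd_counitFst_ellipticComul, mulAcrossR_crossTwist, LinearMap.mulLeft_apply,
      LinearMap.mulRight_apply, ← mul_assoc, ← mul_assoc, Units.mul_inv, one_mul,
      mul_assoc, Units.inv_mul, mul_one]
    have key : ∀ (t : H ⊗[k] H) (u v : H),
        TensorProduct.comm k H H (pairAct 0 3 t (v ⊗ₜ u)) =
        (u ⊗ₜ[k] (1 : H)) * TensorProduct.comm k H H
          (TensorProduct.map LinearMap.id (antipode k) t) * ((1 : H) ⊗ₜ[k] v) := by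
      intro t u v
      induction t with
      | zero => rw [pairAct_zero]; simp
      | add s t hs ht =>
        rw [pairAct_add, LinearMap.add_apply, map_add, map_add, map_add, mul_add, add_mul, hs, ht]
      | tmul a b => rw [pairAct_zero_three_tmul]; simp
    clear e1 e2
    induction c with
    | zero => simp
    | add s t hs ht => simp only [map_add, hs, ht]
    | tmul u v =>
      rw [TensorProduct.comm_tmul, key, 𝓡.antipode_right]
      simp [QuasiTriangular.comm_R]

theorem EllipticDouble.X_mul_Y (f g : RestrictedDual k H) :
    (EllipticDouble.X 𝓡).ofConv f * (EllipticDouble.Y 𝓡).ofConv g =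
      EllipticDouble.ofTensor 𝓡 (f ⊗ₜ[k] g) := by
  refine EllipticDouble.functional_injective (LinearMap.ext fun c => ?_)
  have hX : EllipticDouble.functional 𝓡 ((EllipticDouble.X 𝓡).ofConv f) = f.1 ∘ₗ counitSnd k H :=
    LinearMap.ext (represents_X f)
  have hY : EllipticDouble.functional 𝓡 ((EllipticDouble.Y 𝓡).ofConv g) = g.1 ∘ₗ counitFst k H :=
    LinearMap.ext (represents_Y g)
  have h : ∀ s, TensorProduct.dualDistrib k (H ⊗[k] H) (H ⊗[k] H)
      ((f.1 ∘ₗ counitSnd k H) ⊗ₜ (g.1 ∘ₗ counitFst k H)) s =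
      EllipticDouble.functional 𝓡 (EllipticDouble.ofTensor 𝓡 (f ⊗ₜ g))
        (TensorProduct.map (counitSnd k H) (counitFst k H) s) := by
    intro s
    induction s with
    | zero => simp only [map_zero]
    | add s t hs ht => simp only [map_add, hs, ht]
    | tmul c d => rfl
  rw [EllipticDouble.functional_mul, hX, hY, h, map_counitSnd_counitFst_ellipticComul]

theorem EllipticDouble.ofTensor_counit :
    EllipticDouble.ofTensor 𝓡 (counitFunctional ⊗ₜ[k] counitFunctional) = 1 := by
  refine EllipticDouble.functional_injective (TensorProduct.ext' fun a b => ?_)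
  have : Coalgebra.counit (R := k) (a ⊗ₜ[k] b) = Coalgebra.counit a * Coalgebra.counit b := by
    simp [mul_comm]
  exact this.symm

theorem EllipticDouble.ofTensor_bijective : Function.Bijective (EllipticDouble.ofTensor 𝓡) := by
  refine ⟨fun s t h => RestrictedDual.pair2_injective k H ?_, fun ⟨φ, t, ht⟩ => ⟨t, ?_⟩⟩
  · exact congrArg (EllipticDouble.functional 𝓡) h
  · exact Subtype.ext (WithConv.ext ht)

end CanonicalPair

/-! ### Inverses of the canonical elements -/

section Inverses
variable {k : Type u} [Field k] {H : Type v} [Ring H] [HopfAlgebra k H] (𝓡 : QuasiTriangular k H)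
open HopfAlgebra

variable (k H) in
/-- The map `a ⊗ b ↦ a S(b)`. -/
noncomputable def mulAntipode : H ⊗[k] H →ₗ[k] H :=
  LinearMap.mul' k H ∘ₗ (antipode k).lTensor H

@[simp] theorem mulAntipode_tmul (a b : H) : mulAntipode k H (a ⊗ₜ b) = a * antipode k b := by
  simp [mulAntipode]

theorem mulAntipode_comul (x : H) : mulAntipode k H (Coalgebra.comul x) =
    algebraMap k H (Coalgebra.counit x) :=
  LinearMap.congr_fun (HopfAlgebra.mul_antipode_lTensor_comul (R := k) (A := H)) x

theorem mulAntipode_one : mulAntipode k H 1 = 1 := by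
  rw [Algebra.TensorProduct.one_def, mulAntipode_tmul, HopfAlgebra.antipode_one, mul_one]

/-- `mulAntipode` is a map of modules over `H ⊗ H`, which acts on `H` by `x ↦ a x S(b)`. -/
theorem mulAntipode_tmul_mul (a b : H) (t : H ⊗[k] H) :
    mulAntipode k H ((a ⊗ₜ b) * t) = a * mulAntipode k H t * antipode k b := by
  induction t with
  | zero => simp
  | add s t hs ht => simp only [mul_add, map_add, add_mul, hs, ht]
  | tmul c d => simp [HopfAlgebra.antipode_mul_antidistrib, mul_assoc]

theorem mulAntipode_mul (s t : H ⊗[k] H) (y : H) (h : mulAntipode k H t = y) :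
    mulAntipode k H (s * t) =
      mulAntipode k H (TensorProduct.map (LinearMap.mulRight k y) LinearMap.id s) := by
  induction s with
  | zero => simp
  | add s s' hs hs' => simp only [add_mul, map_add, hs, hs']
  | tmul a b => rw [mulAntipode_tmul_mul, h]; simp

namespace QuasiTriangular

/-- The element `∑ r₁ S(r₂)`. -/
noncomputable def drinfeldElement : H := mulAntipode k H (𝓡.R : H ⊗[k] H)

/-- `∑ x₂ γ S(x₁) = ε(x) γ` for the element `γ = ∑ r₁ S(r₂)`. -/
theorem mulAntipode_comul_op (x : H) :
    mulAntipode k H (TensorProduct.map (LinearMap.mulRight k 𝓡.drinfeldElement) LinearMap.id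
      (TensorProduct.comm k H H (Coalgebra.comul (R := k) x))) =
      Coalgebra.counit (R := k) x • 𝓡.drinfeldElement := by
  rw [← mulAntipode_mul _ (𝓡.R : H ⊗[k] H) 𝓡.drinfeldElement rfl, ← 𝓡.mul_comul, drinfeldElement]
  generalize (𝓡.R : H ⊗[k] H) = t
  induction t with
  | zero => simp
  | add s t hs ht => simp only [add_mul, map_add, smul_add, hs, ht]
  | tmul a b =>
    rw [mulAntipode_tmul_mul, mulAntipode_comul, Algebra.algebraMap_eq_smul_one]
    simp

/-- The square of the antipode is inner up to invertibility of `γ = ∑ r₁ S(r₂)`: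
`x γ = γ S²(x)`. -/
theorem mul_drinfeldElement (x : H) :
    x * 𝓡.drinfeldElement = 𝓡.drinfeldElement * antipode k (antipode k x) := by
  set γ := 𝓡.drinfeldElement
  -- `T (a ⊗ (b ⊗ c)) = c γ S(b) S²(a)`, evaluated in two ways at `∑ x₁ ⊗ x₂ ⊗ x₃`
  let W : H ⊗[k] H →ₗ[k] H := mulAntipode k H ∘ₗ
    TensorProduct.map (LinearMap.mulRight k γ) LinearMap.id ∘ₗ
      (TensorProduct.comm k H H).toLinearMap
  let T : H ⊗[k] (H ⊗[k] H) →ₗ[k] H := LinearMap.mul' k H ∘ₗ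
    TensorProduct.map W (antipode k ∘ₗ antipode k) ∘ₗ
      (TensorProduct.comm k H (H ⊗[k] H)).toLinearMap
  have hT : ∀ a b c, T (a ⊗ₜ (b ⊗ₜ c)) = c * γ * antipode k b * antipode k (antipode k a) := by
    intro a b c; simp [T, W]
  have h1 : ∀ s : H ⊗[k] H, T (Coalgebra.comul.lTensor H s) =
      γ * antipode k (antipode k (TensorProduct.rid k H (Coalgebra.counit.lTensor H s))) := by
    intro s
    induction s with
    | zero => simp
    | add s t hs ht => simp only [map_add, mul_add, hs, ht]
    | tmul a b =>
      have : W (Coalgebra.comul b) = Coalgebra.counit (R := k) b • γ := 𝓡.mulAntipode_comul_op b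
      simp [T, this]
  have h3 : ∀ (s : H ⊗[k] H) (c : H), T (TensorProduct.assoc k H H H (s ⊗ₜ c)) =
      c * γ * antipode k (LinearMap.mul' k H ((antipode k).rTensor H s)) := by
    intro s c
    induction s with
    | zero => simp
    | add s t hs ht => simp only [TensorProduct.add_tmul, map_add, mul_add, hs, ht]
    | tmul a b =>
      rw [TensorProduct.assoc_tmul, hT, LinearMap.rTensor_tmul, LinearMap.mul'_apply,
        HopfAlgebra.antipode_mul_antidistrib, mul_assoc]
  have h2 : ∀ s : H ⊗[k] H, T (TensorProduct.assoc k H H H (Coalgebra.comul.rTensor H s)) =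
      TensorProduct.lid k H (Coalgebra.counit.rTensor H s) * γ := by
    intro s
    induction s with
    | zero => simp
    | add s t hs ht => simp only [map_add, add_mul, hs, ht]
    | tmul a b =>
      have := LinearMap.congr_fun (HopfAlgebra.mul_antipode_rTensor_comul (R := k) (A := H)) a
      simp only [LinearMap.comp_apply] at this
      rw [LinearMap.rTensor_tmul, h3, this]
      simp [Algebra.algebraMap_eq_smul_one]
  have h := congrArg T (Coalgebra.coassoc_apply (R := k) x)
  rw [h1, h2, Coalgebra.rTensor_counit_comul, Coalgebra.lTensor_counit_comul] at h
  simpa using h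

/-- `∑ r'₁ γ S(r'₂) = 1`, where `∑ r'₁ ⊗ r'₂ = R⁻¹`. -/
theorem mulAntipode_mulRight_inv : mulAntipode k H (TensorProduct.map
    (LinearMap.mulRight k 𝓡.drinfeldElement) LinearMap.id (↑𝓡.R⁻¹ : H ⊗[k] H)) = 1 := by
  rw [← mulAntipode_mul _ (𝓡.R : H ⊗[k] H) 𝓡.drinfeldElement rfl, Units.inv_mul, mulAntipode_one]

/-- `γ ∑ S(r'₁) r'₂ = 1`, where `∑ r'₁ ⊗ r'₂ = R⁻¹`. -/
theorem drinfeldElement_mul_inv : 𝓡.drinfeldElement *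
    LinearMap.mul' k H ((antipode k).rTensor H (↑𝓡.R⁻¹ : H ⊗[k] H)) = 1 := by
  have h : ∀ t : H ⊗[k] H, 𝓡.drinfeldElement * LinearMap.mul' k H ((antipode k).rTensor H
      (TensorProduct.map (antipode k) (antipode k) t)) =
      mulAntipode k H (TensorProduct.map (LinearMap.mulRight k 𝓡.drinfeldElement)
        LinearMap.id t) := by
    intro t
    induction t with
    | zero => simp
    | add s t hs ht => simp only [map_add, mul_add, hs, ht]
    | tmul a b => simp [mul_drinfeldElement, mul_assoc]
  rw [← 𝓡.mulAntipode_mulRight_inv, ← h, 𝓡.antipode_both_inv]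

end QuasiTriangular

/-- The operator `x ↦ ∑ t₂ x t₁`. -/
noncomputable def sandwich (t : H ⊗[k] H) : Module.End k H :=
  evalPair (LinearMap.mul k H).flip (LinearMap.mul k H) t

@[simp] theorem sandwich_tmul (a b x : H) : sandwich (a ⊗ₜ[k] b) x = b * x * a := by
  simp [sandwich]

theorem sandwich_add (s t : H ⊗[k] H) : sandwich (s + t) = sandwich s + sandwich t :=
  map_add _ _ _

theorem sandwich_zero : sandwich (0 : H ⊗[k] H) = 0 := map_zero _

theorem sandwich_one (x : H) : sandwich (1 : H ⊗[k] H) x = x := by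
  simp [Algebra.TensorProduct.one_def]

theorem sandwich_mul_tmul (s : H ⊗[k] H) (a b x : H) :
    sandwich (s * a ⊗ₜ b) x = sandwich s (b * x) * a := by
  induction s with
  | zero => simp [sandwich_zero]
  | add s s' h h' => simp only [add_mul, sandwich_add, LinearMap.add_apply, h, h']
  | tmul c d => simp [mul_assoc]

theorem sandwich_tmul_mul (s : H ⊗[k] H) (a b x : H) :
    sandwich (a ⊗ₜ b * s) x = b * sandwich s (x * a) := by
  induction s with
  | zero => simp [sandwich_zero]
  | add s s' h h' => simp only [mul_add, sandwich_add, LinearMap.add_apply, h, h']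
  | tmul c d => simp [mul_assoc]

/-- The antipode of the twisted braided dual, on the level of `H`: the map
`w ↦ ∑ r'₂ γ S(w) r'₁` with `γ = ∑ r₁ S(r₂)` and `∑ r'₁ ⊗ r'₂ = R⁻¹`. -/
noncomputable def braidedAntipode : H →ₗ[k] H :=
  sandwich (↑𝓡.R⁻¹ : H ⊗[k] H) ∘ₗ LinearMap.mulLeft k 𝓡.drinfeldElement ∘ₗ antipode k

/-- The copy of `R` in `pairAct 2 1 R` cancels against the `R⁻¹` in `braidedAntipode`. -/
theorem mul_map_id_pairAct (z : H ⊗[k] H) :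
    LinearMap.mul' k H (TensorProduct.map LinearMap.id (braidedAntipode 𝓡)
      (pairAct 2 1 (𝓡.R : H ⊗[k] H) z)) =
      mulAntipode k H (TensorProduct.map (LinearMap.mulRight k 𝓡.drinfeldElement)
        LinearMap.id z) := by
  have h : ∀ (t : H ⊗[k] H) (a b : H),
      LinearMap.mul' k H (TensorProduct.map LinearMap.id (braidedAntipode 𝓡)
        (pairAct 2 1 t (a ⊗ₜ b))) = a * sandwich (TensorProduct.map (antipode k) (antipode k) t *
          (↑𝓡.R⁻¹ : H ⊗[k] H)) (𝓡.drinfeldElement * antipode k b) := by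
    intro t a b
    induction t with
    | zero => simp [pairAct_zero, sandwich_zero]
    | add s t hs ht =>
      simp only [pairAct_add, LinearMap.add_apply, map_add, add_mul, mul_add, sandwich_add, hs, ht]
    | tmul c d =>
      rw [pairAct_two_one_tmul, TensorProduct.map_tmul, TensorProduct.map_tmul,
        LinearMap.mul'_apply, sandwich_tmul_mul]
      simp [braidedAntipode, HopfAlgebra.antipode_mul_antidistrib, mul_assoc]
  induction z with
  | zero => simp
  | add s t hs ht => simp only [map_add, hs, ht]
  | tmul a b =>
    rw [h, 𝓡.antipode_both, Units.mul_inv, sandwich_one]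
    simp [mul_assoc]

/-- The copy of `R` in `pairAct 2 1 R` cancels against the `R⁻¹` in `braidedAntipode`, after `γ` is
moved to the left by `x γ = γ S²(x)`. -/
theorem mul_map_pairAct_id (z : H ⊗[k] H) :
    LinearMap.mul' k H (TensorProduct.map (braidedAntipode 𝓡) LinearMap.id
      (pairAct 2 1 (𝓡.R : H ⊗[k] H) z)) =
      𝓡.drinfeldElement * LinearMap.mul' k H ((antipode k).rTensor H z) := by
  have h : ∀ (t : H ⊗[k] H) (a b : H),
      LinearMap.mul' k H (TensorProduct.map (braidedAntipode 𝓡) LinearMap.id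
        (pairAct 2 1 t (a ⊗ₜ b))) =
        sandwich ((↑𝓡.R⁻¹ : H ⊗[k] H) * t) (𝓡.drinfeldElement * antipode k a) * b := by
    intro t a b
    induction t with
    | zero => simp [pairAct_zero, sandwich_zero]
    | add s t hs ht =>
      simp only [pairAct_add, LinearMap.add_apply, map_add, add_mul, mul_add, sandwich_add, hs, ht]
    | tmul c d =>
      rw [pairAct_two_one_tmul, TensorProduct.map_tmul, LinearMap.mul'_apply, sandwich_mul_tmul]
      simp only [braidedAntipode, LinearMap.comp_apply, LinearMap.mulLeft_apply,
        HopfAlgebra.antipode_mul_antidistrib, LinearMap.id_apply, ← mul_assoc,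
        𝓡.mul_drinfeldElement]
  induction z with
  | zero => simp
  | add s t hs ht => simp only [map_add, mul_add, hs, ht]
  | tmul a b =>
    rw [h, Units.inv_mul, sandwich_one]
    simp [mul_assoc]

theorem mulAntipode_mul_comul (z : H ⊗[k] H) (x : H) :
    mulAntipode k H (TensorProduct.map (LinearMap.mulRight k 𝓡.drinfeldElement) LinearMap.id
      (Coalgebra.comul (R := k) x * z)) = mulAntipode k H (Coalgebra.comul (R := k) x *
        (mulAntipode k H (TensorProduct.map (LinearMap.mulRight k 𝓡.drinfeldElement)
          LinearMap.id z) ⊗ₜ 1)) := by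
  generalize Coalgebra.comul (R := k) x = s
  induction z with
  | zero => simp
  | add z z' h h' => simp only [mul_add, map_add, TensorProduct.add_tmul, h, h']
  | tmul c d =>
    induction s with
    | zero => simp
    | add s s' h h' => simp only [add_mul, map_add, h, h']
    | tmul a b => simp [HopfAlgebra.antipode_mul_antidistrib, mul_assoc]

theorem mul_antipode_comul_mul (z : H ⊗[k] H) (x : H) :
    LinearMap.mul' k H ((antipode k).rTensor H (Coalgebra.comul (R := k) x * z)) =
      Coalgebra.counit (R := k) x • LinearMap.mul' k H ((antipode k).rTensor H z) := by
  have hx := LinearMap.congr_fun (HopfAlgebra.mul_antipode_rTensor_comul (R := k) (A := H)) x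
  simp only [LinearMap.comp_apply] at hx
  have h : ∀ (s : H ⊗[k] H) (c d : H),
      LinearMap.mul' k H ((antipode k).rTensor H (s * c ⊗ₜ d)) =
        antipode k c * LinearMap.mul' k H ((antipode k).rTensor H s) * d := by
    intro s c d
    induction s with
    | zero => simp
    | add s s' h h' => simp only [add_mul, mul_add, map_add, h, h']
    | tmul a b => simp [HopfAlgebra.antipode_mul_antidistrib, mul_assoc]
  induction z with
  | zero => simp
  | add z z' h h' => simp only [mul_add, map_add, smul_add, h, h']
  | tmul c d => rw [h, hx]; simp [Algebra.algebraMap_eq_smul_one]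

/-- `braidedAntipode` is a right convolution inverse of the identity for the coproduct of the
twisted braided dual. -/
theorem mul_map_id_braidedAntipode (x : H) :
    LinearMap.mul' k H (TensorProduct.map LinearMap.id (braidedAntipode 𝓡)
      (braidedTwist 𝓡 (Coalgebra.comul x))) = algebraMap k H (Coalgebra.counit x) := by
  rw [braidedTwist, Module.End.mul_apply, mul_map_id_pairAct, pairAct_one_three,
    𝓡.antipode_both_inv, mulAntipode_mul_comul, 𝓡.mulAntipode_mulRight_inv,
    ← Algebra.TensorProduct.one_def, mul_one, mulAntipode_comul]

/-- `braidedAntipode` is a left convolution inverse of the identity for the coproduct of the twisted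
braided dual. -/
theorem mul_map_braidedAntipode_id (x : H) :
    LinearMap.mul' k H (TensorProduct.map (braidedAntipode 𝓡) LinearMap.id
      (braidedTwist 𝓡 (Coalgebra.comul x))) = algebraMap k H (Coalgebra.counit x) := by
  rw [braidedTwist, Module.End.mul_apply, mul_map_pairAct_id, pairAct_one_three,
    𝓡.antipode_both_inv, mul_antipode_comul_mul, mul_smul_comm, 𝓡.drinfeldElement_mul_inv,
    Algebra.algebraMap_eq_smul_one]

theorem RestrictedDual.antipode_mem {f : Module.Dual k H} (hf : f ∈ RestrictedDual k H) :
    f ∘ₗ antipode k ∈ RestrictedDual k H := by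
  obtain ⟨t, ht⟩ := RestrictedDual.mem_iff.1 hf
  refine RestrictedDual.mem_iff.2 ⟨TensorProduct.comm k _ _ (TensorProduct.map
    (antipode k).dualMap (antipode k).dualMap t), fun x y => ?_⟩
  have : ∀ s, TensorProduct.dualDistrib k H H (TensorProduct.comm k _ _
      (TensorProduct.map (antipode k).dualMap (antipode k).dualMap s)) (x ⊗ₜ y) =
      TensorProduct.dualDistrib k H H s (antipode k y ⊗ₜ antipode k x) := by
    intro s
    induction s with
    | zero => simp
    | tmul a b => simp [mul_comm]
    | add a b ha hb => simp only [map_add, LinearMap.add_apply, ha, hb]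
  rw [this, ht, LinearMap.comp_apply, HopfAlgebra.antipode_mul_antidistrib]

/-- `braidedAntipode` is a sum of maps `x ↦ b γ S(x) a`, so its transpose preserves the restricted
dual. -/
theorem RestrictedDual.braidedAntipode_mem {f : Module.Dual k H} (hf : f ∈ RestrictedDual k H) :
    f ∘ₗ braidedAntipode 𝓡 ∈ RestrictedDual k H := by
  rw [braidedAntipode]
  generalize (↑𝓡.R⁻¹ : H ⊗[k] H) = t
  induction t with
  | zero => simp [sandwich_zero]
  | add s t hs ht =>
    rw [sandwich_add, LinearMap.add_comp, LinearMap.comp_add]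
    exact add_mem hs ht
  | tmul a b =>
    convert RestrictedDual.antipode_mem
      (RestrictedDual.translate_mem (b * 𝓡.drinfeldElement) a hf) using 1
    ext x
    simp [mul_assoc]

/-- The element `(id ⊗ F)(Z)` of `B ⊗̂ H` for the map `F = braidedAntipode`. -/
noncomputable def CompletedTensor.antipodeRight {B : Type*} [Ring B] [Algebra k B]
    (Z : CompletedTensor k B H) : CompletedTensor k B H :=
  WithConv.toConv (Z.ofConv ∘ₗ ((braidedAntipode 𝓡).dualMap ∘ₗ
    (RestrictedDual k H).subtype).codRestrict _ fun f => RestrictedDual.braidedAntipode_mem 𝓡 f.2)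

section
variable {𝓡}
theorem Represents.antipodeRight {F : CompletedTensor k (EllipticDouble 𝓡) H}
    {G : H ⊗[k] H →ₗ[k] H} (h : Represents F G) :
    Represents (F.antipodeRight 𝓡) (braidedAntipode 𝓡 ∘ₗ G) := fun _ c => h _ c

theorem represents_one {A : Type*} [Ring A] [Algebra k A] :
    Represents (1 : CompletedTensor k (EllipticDouble 𝓡) A)
      (Algebra.linearMap k A ∘ₗ Coalgebra.counit) := by
  intro f c
  have h : (1 : CompletedTensor k (EllipticDouble 𝓡) A).ofConv f =
      algebraMap k (EllipticDouble 𝓡) (f.1 1) := rfl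
  rw [h, Algebra.algebraMap_eq_smul_one, map_smul]
  have h1 : EllipticDouble.functional 𝓡 1 c = Coalgebra.counit (R := k) c := rfl
  rw [LinearMap.smul_apply, h1, LinearMap.comp_apply, Algebra.linearMap_apply,
    Algebra.algebraMap_eq_smul_one, map_smul, smul_eq_mul, smul_eq_mul, mul_comm]

/-- An element given by a coalgebra map to the twisted braided dual is invertible. -/
theorem Represents.mul_antipodeRight {F : CompletedTensor k (EllipticDouble 𝓡) H}
    {G : H ⊗[k] H →ₗ[k] H} (hF : Represents F G)
    (hG : ∀ c, TensorProduct.map G G (ellipticComul 𝓡 c) =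
      braidedTwist 𝓡 (Coalgebra.comul (G c)))
    (hε : ∀ c, Coalgebra.counit (R := k) (G c) = Coalgebra.counit (R := k) c) :
    F * F.antipodeRight 𝓡 = 1 ∧ F.antipodeRight 𝓡 * F = 1 := by
  constructor
  · refine (hF.mul hF.antipodeRight).eq ?_
    convert represents_one using 1
    refine LinearMap.ext fun c => ?_
    have := ellipticConv_comp 𝓡 LinearMap.id (braidedAntipode 𝓡) G G c
    rw [LinearMap.id_comp, hG, mul_map_id_braidedAntipode, hε] at this
    exact this
  · refine (hF.antipodeRight.mul hF).eq ?_
    convert represents_one using 1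
    refine LinearMap.ext fun c => ?_
    have := ellipticConv_comp 𝓡 (braidedAntipode 𝓡) LinearMap.id G G c
    rw [LinearMap.id_comp, hG, mul_map_braidedAntipode_id, hε] at this
    exact this
end

theorem counit_counitSnd (c : H ⊗[k] H) : Coalgebra.counit (R := k) (counitSnd k H c) =
    Coalgebra.counit (R := k) c := by
  induction c with
  | zero => simp
  | add s t hs ht => simp only [map_add, hs, ht]
  | tmul a b => simp [mul_comm]

theorem counit_counitFst (c : H ⊗[k] H) : Coalgebra.counit (R := k) (counitFst k H c) =
    Coalgebra.counit (R := k) c := by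
  induction c with
  | zero => simp
  | add s t hs ht => simp only [map_add, hs, ht]
  | tmul a b => simp [mul_comm]

/-- The canonical element `X` as a unit. -/
noncomputable def EllipticDouble.unitX : (CompletedTensor k (EllipticDouble 𝓡) H)ˣ where
  val := EllipticDouble.X 𝓡
  inv := (EllipticDouble.X 𝓡).antipodeRight 𝓡
  val_inv := (represents_X.mul_antipodeRight map_counitSnd_counitSnd_ellipticComul
    counit_counitSnd).1
  inv_val := (represents_X.mul_antipodeRight map_counitSnd_counitSnd_ellipticComul
    counit_counitSnd).2

/-- The canonical element `Y` as a unit. -/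
noncomputable def EllipticDouble.unitY : (CompletedTensor k (EllipticDouble 𝓡) H)ˣ where
  val := EllipticDouble.Y 𝓡
  inv := (EllipticDouble.Y 𝓡).antipodeRight 𝓡
  val_inv := (represents_Y.mul_antipodeRight map_counitFst_counitFst_ellipticComul
    counit_counitFst).1
  inv_val := (represents_Y.mul_antipodeRight map_counitFst_counitFst_ellipticComul
    counit_counitFst).2

end Inverses

/-! ### Products of values of an elliptic pair -/

section Exchange
variable {k : Type u} [Field k]

namespace CompletedTensor
variable {B : Type*} [Ring B] [Algebra k B] {B' : Type*} [Ring B'] [Algebra k B']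
  {A : Type*} [Ring A] [Algebra k A] {A' : Type*} [Ring A'] [Algebra k A']

/-- The map `ψ ⊗ id` on the completed tensor product, for a linear map `ψ`. -/
noncomputable def postcomp (ψ : B →ₗ[k] B') :
    CompletedTensor k B A →ₗ[k] CompletedTensor k B' A where
  toFun F := WithConv.toConv (ψ ∘ₗ F.ofConv)
  map_add' _ _ := ext fun _ => map_add ψ _ _
  map_smul' c _ := ext fun _ => map_smul ψ c _

theorem postcomp_apply (ψ : B →ₗ[k] B') (F : CompletedTensor k B A) (f : RestrictedDual k A) :
    (postcomp ψ F).ofConv f = ψ (F.ofConv f) := rfl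

theorem postcomp_const_mul (ψ : B →ₗ[k] B') (a : A) (F : CompletedTensor k B A) :
    postcomp ψ (const a * F) = const a * postcomp ψ F := by
  ext f
  rw [postcomp_apply, const_mul_apply, const_mul_apply, postcomp_apply]

theorem postcomp_mul_const (ψ : B →ₗ[k] B') (a : A) (F : CompletedTensor k B A) :
    postcomp ψ (F * const a) = postcomp ψ F * const a := by
  ext f
  rw [postcomp_apply, mul_const_apply, mul_const_apply, postcomp_apply]

theorem postcomp_mapRight (ψ : B →ₗ[k] B') (φ : A →ₐ[k] A') (F : CompletedTensor k B A) :
    postcomp ψ (mapRight φ F) = mapRight φ (postcomp ψ F) := rfl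

theorem postcomp_mul_congr {B'' : Type*} [Ring B''] [Algebra k B''] {ψ : B →ₗ[k] B''}
    {ψ' : B' →ₗ[k] B''} {U V : CompletedTensor k B A} {U' V' : CompletedTensor k B' A}
    (h : ∀ f g, ψ (U.ofConv f * V.ofConv g) = ψ' (U'.ofConv f * V'.ofConv g)) :
    postcomp ψ (U * V) = postcomp ψ' (U' * V') := by
  ext f
  rw [postcomp_apply, postcomp_apply, mul_apply, mul_apply]
  generalize Coalgebra.comul (R := k) f = t
  induction t with
  | zero => simp
  | tmul f g => simpa using h f g
  | add s t hs ht => simp only [map_add, hs, ht]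

theorem postcomp_mapRight_mul_congr {B'' : Type*} [Ring B''] [Algebra k B''] {ψ : B →ₗ[k] B''}
    {ψ' : B' →ₗ[k] B''} {U V : CompletedTensor k B A} {U' V' : CompletedTensor k B' A}
    (h : ∀ f g, ψ (U.ofConv f * V.ofConv g) = ψ' (U'.ofConv f * V'.ofConv g))
    (φ φ' : A →ₐ[k] A') (a : A') :
    postcomp ψ (mapRight φ U * const a * mapRight φ' V) =
      postcomp ψ' (mapRight φ U' * const a * mapRight φ' V') :=
  postcomp_mul_congr fun f g => by
    rw [mul_const_apply, mul_const_apply]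
    exact h _ _

end CompletedTensor

variable {H : Type v} [Ring H] [HopfAlgebra k H] {𝓡 : QuasiTriangular k H}
variable {B : Type*} [Ring B] [Algebra k B] {B' : Type*} [Ring B'] [Algebra k B']
  {B'' : Type*} [Ring B''] [Algebra k B'']
open CompletedTensor Algebra.TensorProduct

/-- The functional `a ⊗ b ↦ f(a) g(b)`. -/
noncomputable def RestrictedDual.tensor (f g : RestrictedDual k H) :
    RestrictedDual k (H ⊗[k] H) := ⟨_, RestrictedDual.tensor_mem f.2 g.2⟩

/-- The values of `V⁰² U⁰¹` on the functionals `f ⊗ g` are the products of values of `V` and `U`. -/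
theorem CompletedTensor.mul_legs_apply (V U : CompletedTensor k B H) (f g : RestrictedDual k H) :
    (mapRight (includeRight : H →ₐ[k] H ⊗[k] H) V *
      mapRight (includeLeft : H →ₐ[k] H ⊗[k] H) U).ofConv (RestrictedDual.tensor f g) =
      V.ofConv g * U.ofConv f := by
  have h : TensorProduct.map
      (RestrictedDual.comap (includeRight : H →ₐ[k] H ⊗[k] H)).toLinearMap
      (RestrictedDual.comap (includeLeft : H →ₐ[k] H ⊗[k] H)).toLinearMap
      (Coalgebra.comul (R := k) (RestrictedDual.tensor f g)) = g ⊗ₜ f := by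
    refine RestrictedDual.pair2_injective k H (TensorProduct.ext' fun x y => ?_)
    have h : ∀ t : RestrictedDual k (H ⊗[k] H) ⊗[k] RestrictedDual k (H ⊗[k] H),
        RestrictedDual.pair2 k H (TensorProduct.map
          (RestrictedDual.comap (includeRight : H →ₐ[k] H ⊗[k] H)).toLinearMap
          (RestrictedDual.comap (includeLeft : H →ₐ[k] H ⊗[k] H)).toLinearMap t) (x ⊗ₜ y) =
        RestrictedDual.pair2 k (H ⊗[k] H) t ((1 ⊗ₜ x) ⊗ₜ (y ⊗ₜ 1)) := by
      intro t
      induction t with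
      | zero => simp
      | tmul a b => rfl
      | add a b ha hb => simp only [map_add, LinearMap.add_apply, ha, hb]
    rw [h, RestrictedDual.pair2_comul]
    simp [RestrictedDual.pair2, RestrictedDual.tensor, mul_comm]
  have h' := congrArg (fun t => LinearMap.mul' k B (TensorProduct.map V.ofConv U.ofConv t)) h
  simp only [TensorProduct.map_tmul, LinearMap.mul'_apply] at h'
  rw [← h', mul_apply]
  generalize Coalgebra.comul (R := k) (RestrictedDual.tensor f g) = t
  induction t with
  | zero => simp
  | tmul a b => rfl
  | add a b ha hb => simp only [map_add, ha, hb]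

variable (k H B) in
/-- The action of `H ⊗ H` on `B ⊗̂ (H ⊗ H)` by `N ↦ (a ⊗ 1) N (1 ⊗ S(b))`. -/
noncomputable def legAct (t : H ⊗[k] H) : Module.End k (CompletedTensor k B (H ⊗[k] H)) :=
  evalPair (leftMulAction k ((const : H ⊗[k] H →ₐ[k] CompletedTensor k B (H ⊗[k] H)).comp
      includeLeft)).toLinearMap
    (rightMulAction k ((const : H ⊗[k] H →ₐ[k] CompletedTensor k B (H ⊗[k] H)).comp
      includeRight)).toLinearMap t

theorem legAct_tmul (a b : H) (N : CompletedTensor k B (H ⊗[k] H)) :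
    legAct k H B (a ⊗ₜ b) N =
      const (a ⊗ₜ[k] (1 : H)) * N * const ((1 : H) ⊗ₜ[k] HopfAlgebra.antipode k b) := by
  simp [legAct, mul_assoc]

theorem legAct_add (s t : H ⊗[k] H) : legAct k H B (s + t) = legAct k H B s + legAct k H B t :=
  map_add _ _ _

theorem legAct_zero : legAct k H B 0 = 0 := map_zero _

variable (𝓡) in
theorem legAct_inv_injective : Function.Injective (legAct k H B (↑𝓡.R⁻¹ : H ⊗[k] H)) := by
  have h : ∀ x y, Commute (leftMulAction k ((const : H ⊗[k] H →ₐ[k]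
      CompletedTensor k B (H ⊗[k] H)).comp includeLeft) x)
      (rightMulAction k ((const : H ⊗[k] H →ₐ[k] CompletedTensor k B (H ⊗[k] H)).comp
        includeRight) y) := fun x y => LinearMap.ext fun N => by
    simp [mul_assoc]
  rw [legAct, ← 𝓡.pairUnit_inv _ _ h]
  refine Function.LeftInverse.injective (g := (𝓡.pairUnit _ _ h : Module.End k _)) fun N => ?_
  rw [← Module.End.mul_apply, Units.mul_inv, Module.End.one_apply]

/-- The legs `V⁰²` and `U⁰¹` commute with `a ⊗ 1` and `1 ⊗ S(b)` respectively, so the action of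
`∑ a ⊗ b` on `V⁰² U⁰¹` inserts `∑ a ⊗ S(b)` in between. -/
theorem legAct_legs (t : H ⊗[k] H) (V U : CompletedTensor k B H) :
    legAct k H B t (mapRight (includeRight : H →ₐ[k] H ⊗[k] H) V *
      mapRight (includeLeft : H →ₐ[k] H ⊗[k] H) U) =
      mapRight (includeRight : H →ₐ[k] H ⊗[k] H) V *
        const (TensorProduct.map LinearMap.id (HopfAlgebra.antipode k) t) *
        mapRight (includeLeft : H →ₐ[k] H ⊗[k] H) U := by
  induction t with
  | zero => simp [legAct_zero]
  | add s t hs ht =>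
    rw [legAct_add, LinearMap.add_apply, hs, ht, map_add, map_add, mul_add, add_mul]
  | tmul a b =>
    have h1 : const (a ⊗ₜ[k] (1 : H)) * mapRight (includeRight : H →ₐ[k] H ⊗[k] H) V =
        mapRight (includeRight : H →ₐ[k] H ⊗[k] H) V * const (a ⊗ₜ[k] (1 : H)) :=
      const_mul_mapRight (fun x => by simp) V
    have h2 : const ((1 : H) ⊗ₜ[k] HopfAlgebra.antipode k b) *
        mapRight (includeLeft : H →ₐ[k] H ⊗[k] H) U =
        mapRight (includeLeft : H →ₐ[k] H ⊗[k] H) U *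
          const ((1 : H) ⊗ₜ[k] HopfAlgebra.antipode k b) :=
      const_mul_mapRight (fun x => by simp) U
    have h3 : (const (a ⊗ₜ[k] HopfAlgebra.antipode k b) : CompletedTensor k B (H ⊗[k] H)) =
        const (a ⊗ₜ[k] (1 : H)) * const ((1 : H) ⊗ₜ[k] HopfAlgebra.antipode k b) := by
      rw [← map_mul]; simp
    rw [legAct_tmul, ← mul_assoc, h1, TensorProduct.map_tmul, LinearMap.id_apply, h3,
      mul_assoc, ← h2]
    simp only [mul_assoc]

theorem postcomp_legAct (ψ : B →ₗ[k] B') (t : H ⊗[k] H) (N : CompletedTensor k B (H ⊗[k] H)) :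
    postcomp ψ (legAct k H B t N) = legAct k H B' t (postcomp ψ N) := by
  induction t with
  | zero => simp [legAct_zero]
  | add s t hs ht => simp only [legAct_add, LinearMap.add_apply, map_add, hs, ht]
  | tmul a b => rw [legAct_tmul, legAct_tmul, postcomp_mul_const, postcomp_const_mul]

variable (𝓡) in
/-- The product `V⁰² R U⁰¹` determines all products of values of `V` and of `U`, because
`R = (id ⊗ S)(R⁻¹)` can be stripped off. -/
theorem map_mul_eq_of_postcomp_eq {ψ : B →ₗ[k] B''} {ψ' : B' →ₗ[k] B''}
    {V U : CompletedTensor k B H} {V' U' : CompletedTensor k B' H}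
    (h : postcomp ψ (mapRight (includeRight : H →ₐ[k] H ⊗[k] H) V * const (𝓡.R : H ⊗[k] H) *
        mapRight (includeLeft : H →ₐ[k] H ⊗[k] H) U) =
      postcomp ψ' (mapRight (includeRight : H →ₐ[k] H ⊗[k] H) V' * const (𝓡.R : H ⊗[k] H) *
        mapRight (includeLeft : H →ₐ[k] H ⊗[k] H) U')) (g f : RestrictedDual k H) :
    ψ (V.ofConv g * U.ofConv f) = ψ' (V'.ofConv g * U'.ofConv f) := by
  rw [← 𝓡.antipode_right, ← legAct_legs, ← legAct_legs, postcomp_legAct, postcomp_legAct] at h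
  have h := congrArg (fun F => F.ofConv (RestrictedDual.tensor f g)) (legAct_inv_injective 𝓡 h)
  simpa only [postcomp_apply, mul_legs_apply] using h

/-- The reflection axiom expresses products of values of `U` by values of `U`. -/
theorem map_mul_eq_of_reflection {ψ : B →ₗ[k] B''} {ψ' : B' →ₗ[k] B''}
    {U : CompletedTensor k B H} {U' : CompletedTensor k B' H}
    (hU : mapRight (Bialgebra.comulAlgHom k H) U = const (𝓡.R21 : H ⊗[k] H) *
      mapRight (includeRight : H →ₐ[k] H ⊗[k] H) U * const (𝓡.R : H ⊗[k] H) *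
        mapRight (includeLeft : H →ₐ[k] H ⊗[k] H) U)
    (hU' : mapRight (Bialgebra.comulAlgHom k H) U' = const (𝓡.R21 : H ⊗[k] H) *
      mapRight (includeRight : H →ₐ[k] H ⊗[k] H) U' * const (𝓡.R : H ⊗[k] H) *
        mapRight (includeLeft : H →ₐ[k] H ⊗[k] H) U')
    (h : ∀ f, ψ (U.ofConv f) = ψ' (U'.ofConv f)) (g f : RestrictedDual k H) :
    ψ (U.ofConv g * U.ofConv f) = ψ' (U'.ofConv g * U'.ofConv f) := by
  refine map_mul_eq_of_postcomp_eq 𝓡 ?_ g f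
  rw [mul_assoc (const _), mul_assoc (const _)] at hU hU'
  have h1 := congrArg (fun Z => postcomp ψ (const (↑𝓡.R21⁻¹ : H ⊗[k] H) * Z)) hU
  have h2 := congrArg (fun Z => postcomp ψ' (const (↑𝓡.R21⁻¹ : H ⊗[k] H) * Z)) hU'
  simp only [← mul_assoc (const (↑𝓡.R21⁻¹ : H ⊗[k] H)) (const (𝓡.R21 : H ⊗[k] H)), ← map_mul,
    Units.inv_mul, map_one, one_mul] at h1 h2
  have h0 : postcomp ψ U = postcomp ψ' U' := ext h
  rw [← h1, ← h2, postcomp_const_mul, postcomp_const_mul, postcomp_mapRight,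
    postcomp_mapRight, h0]

/-- The elliptic commutation relation expresses products of values of `Y` and `X` by products of
values of `X` and `Y`. -/
theorem map_mul_eq_of_elliptic {ψ : B →ₗ[k] B''} {ψ' : B' →ₗ[k] B''}
    {X Y : CompletedTensor k B H} {X' Y' : CompletedTensor k B' H}
    (hXY : 𝓡.IsCompletedEllipticPair 1 X Y) (hXY' : 𝓡.IsCompletedEllipticPair 1 X' Y')
    (h : ∀ f g, ψ (X.ofConv f * Y.ofConv g) = ψ' (X'.ofConv f * Y'.ofConv g))
    (g f : RestrictedDual k H) :
    ψ (Y.ofConv g * X.ofConv f) = ψ' (Y'.ofConv g * X'.ofConv f) := by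
  refine map_mul_eq_of_postcomp_eq 𝓡 ?_ g f
  have h0 := postcomp_mapRight_mul_congr h (includeLeft : H →ₐ[k] H ⊗[k] H)
    (includeRight : H →ₐ[k] H ⊗[k] H) (𝓡.R21 : H ⊗[k] H)
  have e1 := hXY.elliptic
  have e2 := hXY'.elliptic
  rw [mul_assoc (const _), mul_assoc (const _)] at e1 e2
  rw [e1, e2, postcomp_mul_const, postcomp_mul_const, postcomp_const_mul, postcomp_const_mul] at h0
  have h1 := congrArg
    (fun Z => const (↑𝓡.R21⁻¹ : H ⊗[k] H) * Z * const (↑𝓡.R21⁻¹ : H ⊗[k] H)) h0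
  simpa only [mul_assoc, ← map_mul, Units.mul_inv, map_one, mul_one, Units.inv_mul_cancel_left,
    ← mul_assoc (const (↑𝓡.R21⁻¹ : H ⊗[k] H)) (const (𝓡.R21 : H ⊗[k] H)), Units.inv_mul,
    one_mul] using h1

end Exchange

/-! ### The universal property of the elliptic double -/

section Universal
variable {k : Type u} [Field k] {H : Type v} [Ring H] [HopfAlgebra k H] (𝓡 : QuasiTriangular k H)
variable {B : Type*} [Ring B] [Algebra k B] {E : Type*} [Ring E] [Algebra k E]
open CompletedTensor

/-- The linear map `H° ⊗ H° → B` that takes `f ⊗ g` to `X(f) Y(g)`. -/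
noncomputable def CompletedTensor.mulMap (X Y : CompletedTensor k B H) :
    RestrictedDual k H ⊗[k] RestrictedDual k H →ₗ[k] B :=
  LinearMap.mul' k B ∘ₗ TensorProduct.map X.ofConv Y.ofConv

theorem CompletedTensor.mulMap_tmul (X Y : CompletedTensor k B H) (f g : RestrictedDual k H) :
    mulMap X Y (f ⊗ₜ g) = X.ofConv f * Y.ofConv g := by
  rw [mulMap, LinearMap.comp_apply, TensorProduct.map_tmul, LinearMap.mul'_apply]

/-- An algebra `E` with an invertible elliptic pair `X`, `Y` is a model of the elliptic double:
multiplication of the values of `X` and of `Y` identifies it with `H° ⊗ H°`. -/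
structure IsEllipticDouble (X Y : (CompletedTensor k E H)ˣ) : Prop where
  elliptic : 𝓡.IsCompletedEllipticPair 1 (X : CompletedTensor k E H) (Y : CompletedTensor k E H)
  bijective : Function.Bijective
    (mulMap (X : CompletedTensor k E H) (Y : CompletedTensor k E H))
  X_counit : (X : CompletedTensor k E H).ofConv counitFunctional = 1
  Y_counit : (Y : CompletedTensor k E H).ofConv counitFunctional = 1

theorem EllipticDouble.isEllipticDouble :
    IsEllipticDouble 𝓡 (EllipticDouble.unitX 𝓡) (EllipticDouble.unitY 𝓡) where
  elliptic := canonical_isEllipticPair 𝓡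
  bijective := by
    convert EllipticDouble.ofTensor_bijective 𝓡 using 1
    exact congrArg DFunLike.coe
      (TensorProduct.ext' fun f g => (mulMap_tmul _ _ f g).trans (EllipticDouble.X_mul_Y 𝓡 f g))
  X_counit := EllipticDouble.ofTensor_counit 𝓡
  Y_counit := EllipticDouble.ofTensor_counit 𝓡

/-- An element of `B` that acts as the identity on the values of an invertible element of `B ⊗̂ H`
is the unit of `B`. -/
theorem CompletedTensor.eq_one_of_mul_apply (W : (CompletedTensor k B H)ˣ) (b : B)
    (h : ∀ f, b * (W : CompletedTensor k B H).ofConv f = (W : CompletedTensor k B H).ofConv f) :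
    b = 1 := by
  have h1 := postcomp_mul_congr (ψ := LinearMap.mulLeft k b) (ψ' := LinearMap.id)
    (U := (W : CompletedTensor k B H)) (V := (↑W⁻¹ : CompletedTensor k B H))
    (U' := (W : CompletedTensor k B H)) (V' := (↑W⁻¹ : CompletedTensor k B H))
    (fun f g => by rw [LinearMap.mulLeft_apply, ← mul_assoc, h, LinearMap.id_apply])
  rw [Units.mul_inv] at h1
  have h2 := congrArg (fun F => F.ofConv (counitFunctional : RestrictedDual k H)) h1
  have h3 : (1 : CompletedTensor k B H).ofConv counitFunctional = 1 := by
    rw [← map_one (const : H →ₐ[k] CompletedTensor k B H), const_apply]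
    exact (congrArg _ (Bialgebra.counit_one (R := k) (A := H))).trans (map_one _)
  simpa only [postcomp_apply, h3, LinearMap.mulLeft_apply, mul_one, LinearMap.id_apply] using h2

namespace IsEllipticDouble
variable {𝓡} {X Y : (CompletedTensor k E H)ˣ} (hE : IsEllipticDouble 𝓡 X Y)
include hE

/-- `E` is spanned by the products of a value of `X` and a value of `Y`. -/
theorem induction_on {P : E → Prop} (e : E) (zero : P 0) (add : ∀ a b, P a → P b → P (a + b))
    (mul : ∀ f g, P ((X : CompletedTensor k E H).ofConv f * (Y : CompletedTensor k E H).ofConv g)) :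
    P e := by
  obtain ⟨t, rfl⟩ := hE.bijective.2 e
  induction t with
  | zero => rwa [map_zero]
  | add s t hs ht => rw [map_add]; exact add _ _ hs ht
  | tmul f g => rw [mulMap_tmul]; exact mul f g

/-- The linear map `E → B` that takes `X(f) Y(g)` to `X'(f) Y'(g)`. -/
noncomputable def liftLinear (X' Y' : CompletedTensor k B H) : E →ₗ[k] B :=
  mulMap X' Y' ∘ₗ (LinearEquiv.ofBijective _ hE.bijective).symm.toLinearMap

theorem liftLinear_mul (X' Y' : CompletedTensor k B H) (f g : RestrictedDual k H) :
    hE.liftLinear X' Y'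
      ((X : CompletedTensor k E H).ofConv f * (Y : CompletedTensor k E H).ofConv g) =
      X'.ofConv f * Y'.ofConv g := by
  have h := (LinearEquiv.ofBijective _ hE.bijective).symm_apply_apply (f ⊗ₜ g)
  rw [LinearEquiv.ofBijective_apply, mulMap_tmul] at h
  rw [liftLinear, LinearMap.comp_apply, LinearEquiv.coe_coe, h, mulMap_tmul]

section
variable {X' Y' : CompletedTensor k B H} (h : 𝓡.IsCompletedEllipticPair 1 X' Y')
include h

/-- The reflection axiom for `X` makes `liftLinear` compatible with left multiplication by values of
`X`. -/
theorem liftLinear_X_mul (f : RestrictedDual k H) (e : E) :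
    hE.liftLinear X' Y' ((X : CompletedTensor k E H).ofConv f * e) =
      X'.ofConv f * hE.liftLinear X' Y' e := by
  induction e using hE.induction_on with
  | zero => simp only [mul_zero, map_zero]
  | add a b ha hb => simp only [mul_add, map_add, ha, hb]
  | mul f' g =>
    have := map_mul_eq_of_reflection (𝓡 := 𝓡)
      (ψ := hE.liftLinear X' Y' ∘ₗ LinearMap.mulRight k ((Y : CompletedTensor k E H).ofConv g))
      (ψ' := LinearMap.mulRight k (Y'.ofConv g))
      (by simpa only [QuasiTriangular.D_mul_inv] using hE.elliptic.reflection_left)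
      (by simpa only [QuasiTriangular.D_mul_inv] using h.reflection_left)
      (fun f => hE.liftLinear_mul X' Y' f g) f f'
    rw [liftLinear_mul, ← mul_assoc, ← mul_assoc]
    exact this

/-- The product `Y(g) X(f) Y(g')` is reduced to a sum of terms `X(f) Y(g) Y(g')` by the elliptic
commutation relation, and these to terms `X(f) Y(g)` by the reflection axiom for `Y`. -/
theorem liftLinear_Y_mul (g : RestrictedDual k H) (e : E) :
    hE.liftLinear X' Y' ((Y : CompletedTensor k E H).ofConv g * e) =
      Y'.ofConv g * hE.liftLinear X' Y' e := by
  induction e using hE.induction_on with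
  | zero => simp only [mul_zero, map_zero]
  | add a b ha hb => simp only [mul_add, map_add, ha, hb]
  | mul f g' =>
    have hYY := fun f => map_mul_eq_of_reflection (𝓡 := 𝓡)
      (ψ := hE.liftLinear X' Y' ∘ₗ LinearMap.mulLeft k ((X : CompletedTensor k E H).ofConv f))
      (ψ' := LinearMap.mulLeft k (X'.ofConv f))
      (by simpa only [QuasiTriangular.D_mul_inv] using hE.elliptic.reflection_right)
      (by simpa only [QuasiTriangular.D_mul_inv] using h.reflection_right)
      (fun g => hE.liftLinear_mul X' Y' f g)
    have := map_mul_eq_of_elliptic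
      (ψ := hE.liftLinear X' Y' ∘ₗ LinearMap.mulRight k ((Y : CompletedTensor k E H).ofConv g'))
      (ψ' := LinearMap.mulRight k (Y'.ofConv g')) hE.elliptic h
      (fun f g => by
        have := hYY f g g'
        simp only [LinearMap.comp_apply, LinearMap.mulLeft_apply, LinearMap.mulRight_apply,
          mul_assoc] at this ⊢
        exact this) g f
    rw [liftLinear_mul, ← mul_assoc, ← mul_assoc]
    exact this

theorem liftLinear_map_mul (a b : E) :
    hE.liftLinear X' Y' (a * b) = hE.liftLinear X' Y' a * hE.liftLinear X' Y' b := by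
  induction a using hE.induction_on with
  | zero => simp only [zero_mul, map_zero]
  | add a b ha hb => simp only [add_mul, map_add, ha, hb]
  | mul f g =>
    rw [mul_assoc, hE.liftLinear_X_mul h, hE.liftLinear_Y_mul h, liftLinear_mul, mul_assoc]

end

section
variable {X' Y' : (CompletedTensor k B H)ˣ}
  (h : 𝓡.IsCompletedEllipticPair 1 (X' : CompletedTensor k B H) (Y' : CompletedTensor k B H))
include h

/-- The value of `X'` at the unit `ε` of `H°` acts as the identity on the values of the invertible
element `X' Y'`, so it is `1`. -/
theorem apply_counit_left : (X' : CompletedTensor k B H).ofConv counitFunctional = 1 := by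
  refine CompletedTensor.eq_one_of_mul_apply (X' * Y') _ fun f => ?_
  refine congrArg (fun F => F.ofConv f) (postcomp_mul_congr (ψ := LinearMap.mulLeft k _)
    (ψ' := LinearMap.id) (U := (X' : CompletedTensor k B H)) (V := (Y' : CompletedTensor k B H))
    fun f g => ?_)
  rw [LinearMap.mulLeft_apply, LinearMap.id_apply, ← hE.liftLinear_mul,
    ← hE.liftLinear_X_mul h, hE.X_counit, one_mul]

/-- The value of `Y'` at `ε` is `1`. Since `Y'(ε) X'(f) Y'(g) = X'(f) Y'(g)`, it acts as the
identity on the values of `X' Y'`, as in `apply_counit_left`. -/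
theorem apply_counit_right : (Y' : CompletedTensor k B H).ofConv counitFunctional = 1 := by
  refine CompletedTensor.eq_one_of_mul_apply (X' * Y') _ fun f => ?_
  refine congrArg (fun F => F.ofConv f) (postcomp_mul_congr (ψ := LinearMap.mulLeft k _)
    (ψ' := LinearMap.id) (U := (X' : CompletedTensor k B H)) (V := (Y' : CompletedTensor k B H))
    fun f g => ?_)
  rw [LinearMap.mulLeft_apply, LinearMap.id_apply, ← hE.liftLinear_mul,
    ← hE.liftLinear_Y_mul h, hE.Y_counit, one_mul]

theorem liftLinear_X (f : RestrictedDual k H) :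
    hE.liftLinear (X' : CompletedTensor k B H) Y' ((X : CompletedTensor k E H).ofConv f) =
      (X' : CompletedTensor k B H).ofConv f := by
  have := hE.liftLinear_mul (X' : CompletedTensor k B H) Y' f counitFunctional
  rwa [hE.Y_counit, mul_one, hE.apply_counit_right h, mul_one] at this

theorem liftLinear_Y (g : RestrictedDual k H) :
    hE.liftLinear (X' : CompletedTensor k B H) Y' ((Y : CompletedTensor k E H).ofConv g) =
      (Y' : CompletedTensor k B H).ofConv g := by
  have := hE.liftLinear_mul (X' : CompletedTensor k B H) Y' counitFunctional g
  rwa [hE.X_counit, one_mul, hE.apply_counit_left h, one_mul] at this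

/-- The universal property of the elliptic double: the homomorphism `E → B` given by an elliptic
pair of invertible elements of `B ⊗̂ H`. -/
noncomputable def lift : E →ₐ[k] B :=
  AlgHom.ofLinearMap (hE.liftLinear (X' : CompletedTensor k B H) Y')
    (by rw [← hE.X_counit, hE.liftLinear_X h, hE.apply_counit_left h]) (hE.liftLinear_map_mul h)
end

end IsEllipticDouble

/-- The map `α ⊗ id` on units of the completed tensor product. -/
noncomputable def CompletedTensor.mapUnits (A : Type*) [Ring A] [Algebra k A] (α : E →ₐ[k] B) :
    (CompletedTensor k E A)ˣ →* (CompletedTensor k B A)ˣ :=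
  Units.map (mapLeft α : CompletedTensor k E A →ₐ[k] CompletedTensor k B A).toMonoidHom

section
variable {A : Type*} [Ring A] [Algebra k A] {B' : Type*} [Ring B'] [Algebra k B']
theorem CompletedTensor.mapUnits_comp (α : B →ₐ[k] B') (β : E →ₐ[k] B)
    (Z : (CompletedTensor k E A)ˣ) :
    mapUnits A (α.comp β) Z = mapUnits A α (mapUnits A β Z) := rfl

theorem CompletedTensor.mapUnits_id (Z : (CompletedTensor k E A)ˣ) :
    mapUnits A (AlgHom.id k E) Z = Z := rfl

@[simp] theorem CompletedTensor.mapUnits_mul_equiv (α β : E ≃ₐ[k] E)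
    (Z : (CompletedTensor k E A)ˣ) :
    mapUnits A ((α * β : E ≃ₐ[k] E) : E →ₐ[k] E) Z =
      mapUnits A (α : E →ₐ[k] E) (mapUnits A (β : E →ₐ[k] E) Z) := rfl
end

namespace IsEllipticDouble
variable {𝓡} {X Y : (CompletedTensor k E H)ˣ} (hE : IsEllipticDouble 𝓡 X Y)

section
variable {X' Y' : (CompletedTensor k B H)ˣ}
  (h : 𝓡.IsCompletedEllipticPair 1 (X' : CompletedTensor k B H) (Y' : CompletedTensor k B H))

@[simp] theorem mapUnits_lift_X : mapUnits H (hE.lift h) X = X' :=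
  Units.ext (CompletedTensor.ext (hE.liftLinear_X h))

@[simp] theorem mapUnits_lift_Y : mapUnits H (hE.lift h) Y = Y' :=
  Units.ext (CompletedTensor.ext (hE.liftLinear_Y h))
end

include hE in
theorem algHom_ext {α β : E →ₐ[k] B} (hX : mapUnits H α X = mapUnits H β X)
    (hY : mapUnits H α Y = mapUnits H β Y) : α = β := by
  refine AlgHom.ext fun e => ?_
  induction e using hE.induction_on with
  | zero => simp only [map_zero]
  | add a b ha hb => simp only [map_add, ha, hb]
  | mul f g =>
    have h1 : α ((X : CompletedTensor k E H).ofConv f) = β ((X : CompletedTensor k E H).ofConv f) :=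
      congrArg (fun F : (CompletedTensor k B H)ˣ => (F : CompletedTensor k B H).ofConv f) hX
    have h2 : α ((Y : CompletedTensor k E H).ofConv g) = β ((Y : CompletedTensor k E H).ofConv g) :=
      congrArg (fun F : (CompletedTensor k B H)ˣ => (F : CompletedTensor k B H).ofConv g) hY
    rw [map_mul, map_mul, h1, h2]

include hE in
theorem algEquiv_ext {α β : E ≃ₐ[k] E}
    (hX : mapUnits H (α : E →ₐ[k] E) X = mapUnits H (β : E →ₐ[k] E) X)
    (hY : mapUnits H (α : E →ₐ[k] E) Y = mapUnits H (β : E →ₐ[k] E) Y) : α = β :=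
  AlgEquiv.coe_toAlgHom_injective (hE.algHom_ext hX hY)

/-! ### The action on the elliptic double -/

/-- The automorphism of `E` with `X ↦ Y` and `Y ↦ Y X⁻¹ Y⁻¹`. -/
noncomputable def autA : E ≃ₐ[k] E :=
  AlgEquiv.ofAlgHom (hE.lift (𝓡.isLegSystem_completed.actA hE.elliptic))
    (hE.lift (𝓡.isLegSystem_completed.actAInv hE.elliptic))
    (hE.algHom_ext (by simp [mapUnits_comp, mapUnits_id, mul_assoc])
      (by simp [mapUnits_comp, mapUnits_id, mul_assoc]))
    (hE.algHom_ext (by simp [mapUnits_comp, mapUnits_id, mul_assoc])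
      (by simp [mapUnits_comp, mapUnits_id, mul_assoc]))

include hE in
theorem elliptic_actB : 𝓡.IsCompletedEllipticPair 1 (X : CompletedTensor k E H)
    (↑(Y * X⁻¹) : CompletedTensor k E H) := 𝓡.isLegSystem_completed.actB hE.elliptic

include hE in
theorem elliptic_actBInv : 𝓡.IsCompletedEllipticPair 1 (X : CompletedTensor k E H)
    (↑(Y * X) : CompletedTensor k E H) := 𝓡.isLegSystem_completed.actBInv hE.elliptic

/-- The automorphism of `E` with `X ↦ X` and `Y ↦ Y X⁻¹`. -/
noncomputable def autB : E ≃ₐ[k] E :=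
  AlgEquiv.ofAlgHom (hE.lift hE.elliptic_actB) (hE.lift hE.elliptic_actBInv)
    (hE.algHom_ext
      (by rw [mapUnits_comp, hE.mapUnits_lift_X hE.elliptic_actBInv,
        hE.mapUnits_lift_X hE.elliptic_actB, mapUnits_id])
      (by rw [mapUnits_comp, hE.mapUnits_lift_Y hE.elliptic_actBInv, map_mul,
        hE.mapUnits_lift_X hE.elliptic_actB, hE.mapUnits_lift_Y hE.elliptic_actB,
        inv_mul_cancel_right, mapUnits_id]))
    (hE.algHom_ext
      (by rw [mapUnits_comp, hE.mapUnits_lift_X hE.elliptic_actB,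
        hE.mapUnits_lift_X hE.elliptic_actBInv, mapUnits_id])
      (by rw [mapUnits_comp, hE.mapUnits_lift_Y hE.elliptic_actB, map_mul, map_inv,
        hE.mapUnits_lift_X hE.elliptic_actBInv, hE.mapUnits_lift_Y hE.elliptic_actBInv,
        mul_inv_cancel_right, mapUnits_id]))

@[simp] theorem autA_X : mapUnits H (hE.autA : E →ₐ[k] E) X = Y :=
  hE.mapUnits_lift_X (𝓡.isLegSystem_completed.actA hE.elliptic)
@[simp] theorem autA_Y : mapUnits H (hE.autA : E →ₐ[k] E) Y = Y * X⁻¹ * Y⁻¹ :=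
  hE.mapUnits_lift_Y (𝓡.isLegSystem_completed.actA hE.elliptic)
@[simp] theorem autB_X : mapUnits H (hE.autB : E →ₐ[k] E) X = X :=
  hE.mapUnits_lift_X hE.elliptic_actB
@[simp] theorem autB_Y : mapUnits H (hE.autB : E →ₐ[k] E) Y = Y * X⁻¹ :=
  hE.mapUnits_lift_Y hE.elliptic_actB

/-- The action of the central extension of `SL₂(ℤ)` on the elliptic double. -/
noncomputable def action : SL2Tilde →* (E ≃ₐ[k] E) :=
  SL2Tilde.lift hE.autA hE.autB
    (hE.algEquiv_ext (by simp [pow_succ, mul_assoc]) (by simp [pow_succ, mul_assoc]))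
    (hE.algEquiv_ext (by simp [pow_succ, mul_assoc]) (by simp [pow_succ, mul_assoc]))

theorem action_A : hE.action SL2Tilde.A = hE.autA := SL2Tilde.lift_A _ _ _ _
theorem action_B : hE.action SL2Tilde.B = hE.autB := SL2Tilde.lift_B _ _ _ _

theorem action_A_X : mapUnits H (hE.action SL2Tilde.A : E →ₐ[k] E) X = Y := by
  rw [action_A, autA_X]
theorem action_A_Y : mapUnits H (hE.action SL2Tilde.A : E →ₐ[k] E) Y = Y * X⁻¹ * Y⁻¹ := by
  rw [action_A, autA_Y]
theorem action_B_X : mapUnits H (hE.action SL2Tilde.B : E →ₐ[k] E) X = X := by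
  rw [action_B, autB_X]
theorem action_B_Y : mapUnits H (hE.action SL2Tilde.B : E →ₐ[k] E) Y = Y * X⁻¹ := by
  rw [action_B, autB_Y]

end IsEllipticDouble

/-- The action on the elliptic double is determined by its effect on the canonical elements. -/
theorem EllipticDouble.isCanonicalAction_iff
    (act : SL2Tilde →* (EllipticDouble 𝓡 ≃ₐ[k] EllipticDouble 𝓡)) :
    𝓡.IsCanonicalAction (EllipticDouble.unitX 𝓡) (EllipticDouble.unitY 𝓡) act ↔
      act = (EllipticDouble.isEllipticDouble 𝓡).action := by
  have hE := EllipticDouble.isEllipticDouble 𝓡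
  constructor
  · intro h
    exact SL2Tilde.hom_ext
      (hE.algEquiv_ext ((Units.ext h.A_X).trans hE.action_A_X.symm)
        ((Units.ext h.A_Y).trans hE.action_A_Y.symm))
      (hE.algEquiv_ext ((Units.ext h.B_X).trans hE.action_B_X.symm)
        ((Units.ext h.B_Y).trans hE.action_B_Y.symm))
  · rintro rfl
    exact ⟨congrArg Units.val hE.action_A_X, congrArg Units.val hE.action_A_Y,
      congrArg Units.val hE.action_B_X, congrArg Units.val hE.action_B_Y⟩

end Universal

/-! ### Braid groups and permutations of the legs -/

section EllipticFamily
variable {G : Type*} [Group G] {n : ℕ}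

/-- If the involution `p` exchanges the two legs, the elliptic relations become relations of the
braid group of the punctured torus for `σ = p r`. -/
theorem IsEllipticTuple.mul_swap {p r s x₁ x₂ y₁ y₂ : G} (h : IsEllipticTuple r s x₁ x₂ y₁ y₂)
    (hp : p * p = 1) (hr : p * r = s * p) (hx : p * x₁ = x₂ * p) (hy : p * y₁ = y₂ * p) :
    IsEllipticTuple (p * r) (p * r) x₁ x₁ y₁ y₁ := by
  have key : ∀ {z₁ z₂ : G}, p * z₁ = z₂ * p → p * r * z₁ * (p * r) = s * z₂ * r := by
    intro z₁ z₂ hz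
    calc p * r * z₁ * (p * r) = p * r * z₁ * p * r := by simp only [mul_assoc]
      _ = s * (p * z₁) * p * r := by rw [hr]; simp only [mul_assoc]
      _ = s * z₂ * (p * p) * r := by rw [hz]; simp only [mul_assoc]
      _ = _ := by rw [hp, mul_one]
  have inv : ∀ {a b : G}, p * a = b * p → a * p = p * b := by
    intro a b hab
    calc a * p = (p * p) * a * p := by rw [hp, one_mul]
      _ = p * (p * a) * p := by simp only [mul_assoc]
      _ = p * b * (p * p) := by rw [hab]; simp only [mul_assoc]
      _ = _ := by rw [hp, mul_one]
  have refl : ∀ {z₁ z₂ : G}, p * z₁ = z₂ * p → r * (s * z₂ * r * z₁) = r * z₁ * s * z₂ * r →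
      p * r * (p * r * z₁ * (p * r) * z₁) = p * r * z₁ * (p * r) * z₁ * (p * r) := by
    intro z₁ z₂ hz h
    rw [key hz]
    have hs : p * s = r * p := (inv hr).symm
    have hz' : p * z₂ = z₁ * p := (inv hz).symm
    have e : s * z₂ * r * z₁ * p = p * (r * z₁ * s * z₂) := by
      calc s * z₂ * r * z₁ * p = s * z₂ * r * (z₁ * p) := by simp only [mul_assoc]
        _ = s * z₂ * (r * p) * z₂ := by rw [inv hz]; simp only [mul_assoc]
        _ = s * (z₂ * p) * s * z₂ := by rw [inv hr]; simp only [mul_assoc]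
        _ = (s * p) * z₁ * s * z₂ := by rw [← hz]; simp only [mul_assoc]
        _ = _ := by rw [← hr]; simp only [mul_assoc]
    calc p * r * (s * z₂ * r * z₁) = p * (r * z₁ * s * z₂ * r) := by rw [mul_assoc, h]
      _ = (p * (r * z₁ * s * z₂)) * r := by simp only [mul_assoc]
      _ = _ := by rw [← e]; simp only [mul_assoc]
  have ell : x₁ * (p * r) * y₁ = p * r * y₁ * (p * r) * x₁ * (p * r) := by
    rw [key hy]
    calc x₁ * (p * r) * y₁ = (x₁ * p) * r * y₁ := by simp only [mul_assoc]
      _ = p * (x₂ * r * y₁) := by rw [inv hx]; simp only [mul_assoc]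
      _ = (p * r) * y₁ * s * x₂ * r := by rw [h.ell']; simp only [mul_assoc]
      _ = s * (p * y₁) * s * x₂ * r := by rw [hr]; simp only [mul_assoc]
      _ = s * y₂ * (p * s) * x₂ * r := by rw [hy]; simp only [mul_assoc]
      _ = s * y₂ * r * (p * x₂) * r := by rw [← inv hr]; simp only [mul_assoc]
      _ = _ := by rw [← inv hx]; simp only [mul_assoc]
  exact ⟨refl hx h.refl_x, refl hx h.refl_x, refl hy h.refl_y, refl hy h.refl_y, ell, ell⟩

/-- Elements `r i j`, `x i`, `y i` of a group that are permuted by a copy of the symmetric group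
and satisfy the relations between `R^{i,j}`, `X^{0,i}` and `Y^{0,i}`. -/
structure IsEllipticFamily (P : Equiv.Perm (Fin n) →* G) (r : Fin n → Fin n → G)
    (x y : Fin n → G) : Prop where
  yangBaxter : IsYB r
  perm_r : ∀ s i j, P s * r i j = r (s i) (s j) * P s
  perm_x : ∀ s i, P s * x i = x (s i) * P s
  perm_y : ∀ s i, P s * y i = y (s i) * P s
  comm_x : ∀ i j a, a ≠ i → a ≠ j → Commute (r i j) (x a)
  comm_y : ∀ i j a, a ≠ i → a ≠ j → Commute (r i j) (y a)
  tuple : ∀ i j, i ≠ j → IsEllipticTuple (r i j) (r j i) (x i) (x j) (y i) (y j)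

/-- The entry with index `0`, or `1` if there is none. -/
def firstEntry (x : Fin n → G) : G := if h : 0 < n then x ⟨0, h⟩ else 1

theorem firstEntry_of_pos (x : Fin n → G) (h : 0 < n) : firstEntry x = x ⟨0, h⟩ := dif_pos h

/-- An elliptic family gives elements that satisfy the relations of the braid group of the punctured
torus, the `σᵢ` being the products of transpositions and `r i (i + 1)`. -/
theorem IsEllipticFamily.isBraidDatum {P : Equiv.Perm (Fin n) →* G} {r : Fin n → Fin n → G}
    {x y : Fin n → G} (h : IsEllipticFamily P r x y) :
    IsBraidDatum (firstEntry x) (firstEntry y) (fun i hi =>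
      P (Equiv.swap ⟨i, Nat.lt_of_succ_lt hi⟩ ⟨i + 1, hi⟩) *
        r ⟨i, Nat.lt_of_succ_lt hi⟩ ⟨i + 1, hi⟩) := by
  have move : ∀ a b c d, r a b * P (Equiv.swap c d) =
      P (Equiv.swap c d) * r (Equiv.swap c d a) (Equiv.swap c d b) := fun a b c d => by
    rw [h.perm_r, Equiv.swap_apply_self, Equiv.swap_apply_self]
  have comm : ∀ z : Fin n → G, (∀ s i, P s * z i = z (s i) * P s) →
      (∀ i j a, a ≠ i → a ≠ j → Commute (r i j) (z a)) → ∀ i (hi : i + 1 < n), 1 ≤ i →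
      Commute (P (Equiv.swap ⟨i, Nat.lt_of_succ_lt hi⟩ ⟨i + 1, hi⟩) *
        r ⟨i, Nat.lt_of_succ_lt hi⟩ ⟨i + 1, hi⟩) (firstEntry z) := by
    intro z hP hz i hi h1
    rw [firstEntry_of_pos z (by omega)]
    have hne : (⟨0, by omega⟩ : Fin n) ≠ ⟨i, Nat.lt_of_succ_lt hi⟩ := by simp; omega
    have hne' : (⟨0, by omega⟩ : Fin n) ≠ ⟨i + 1, hi⟩ := by simp
    have := hP (Equiv.swap ⟨i, Nat.lt_of_succ_lt hi⟩ ⟨i + 1, hi⟩) ⟨0, by omega⟩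
    rw [Equiv.swap_apply_of_ne_of_ne hne hne'] at this
    exact Commute.mul_left this (hz _ _ _ hne hne')
  refine ⟨fun i j hi hj hij => ?_, fun i hi hi' => ?_, comm x h.perm_x h.comm_x,
    comm y h.perm_y h.comm_y, fun hn => ?_⟩
  · have h1 : (⟨i, Nat.lt_of_succ_lt hi⟩ : Fin n) ≠ ⟨j, Nat.lt_of_succ_lt hj⟩ := by simp; omega
    have h2 : (⟨i, Nat.lt_of_succ_lt hi⟩ : Fin n) ≠ ⟨j + 1, hj⟩ := by simp; omega
    have h3 : (⟨i + 1, hi⟩ : Fin n) ≠ ⟨j, Nat.lt_of_succ_lt hj⟩ := by simp; omega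
    have h4 : (⟨i + 1, hi⟩ : Fin n) ≠ ⟨j + 1, hj⟩ := by simp; omega
    have hd : Commute (P (Equiv.swap ⟨i, Nat.lt_of_succ_lt hi⟩ ⟨i + 1, hi⟩))
        (P (Equiv.swap ⟨j, Nat.lt_of_succ_lt hj⟩ ⟨j + 1, hj⟩)) := by
      refine Commute.map (Equiv.Perm.Disjoint.commute fun a => ?_) P
      by_cases ha : a = ⟨i, Nat.lt_of_succ_lt hi⟩
      · subst ha; exact Or.inr (Equiv.swap_apply_of_ne_of_ne h1 h2)
      by_cases ha' : a = ⟨i + 1, hi⟩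
      · subst ha'; exact Or.inr (Equiv.swap_apply_of_ne_of_ne h3 h4)
      exact Or.inl (Equiv.swap_apply_of_ne_of_ne ha ha')
    refine Commute.mul_left (Commute.mul_right hd ?_) (Commute.mul_right ?_ ?_)
    · have := h.perm_r (Equiv.swap ⟨i, Nat.lt_of_succ_lt hi⟩ ⟨i + 1, hi⟩)
        ⟨j, Nat.lt_of_succ_lt hj⟩ ⟨j + 1, hj⟩
      rwa [Equiv.swap_apply_of_ne_of_ne h1.symm h3.symm,
        Equiv.swap_apply_of_ne_of_ne h2.symm h4.symm] at this
    · have := h.perm_r (Equiv.swap ⟨j, Nat.lt_of_succ_lt hj⟩ ⟨j + 1, hj⟩)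
        ⟨i, Nat.lt_of_succ_lt hi⟩ ⟨i + 1, hi⟩
      rw [Equiv.swap_apply_of_ne_of_ne h1 h2, Equiv.swap_apply_of_ne_of_ne h3 h4] at this
      exact this.symm
    · exact h.yangBaxter.comm _ _ _ _ h1 h2 h3 h4
  · have h1 : (⟨i, Nat.lt_of_succ_lt hi⟩ : Fin n) ≠ ⟨i + 1, hi⟩ := by simp
    have h2 : (⟨i, Nat.lt_of_succ_lt hi⟩ : Fin n) ≠ ⟨i + 1 + 1, hi'⟩ := by simp; omega
    have h3 : (⟨i + 1, hi⟩ : Fin n) ≠ ⟨i + 1 + 1, hi'⟩ := by simp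
    generalize (⟨i, Nat.lt_of_succ_lt hi⟩ : Fin n) = a at h1 h2 ⊢
    generalize (⟨i + 1, hi⟩ : Fin n) = b at h1 h3 ⊢
    generalize (⟨i + 1 + 1, hi'⟩ : Fin n) = c at h2 h3 ⊢
    have e1 : r a b * P (Equiv.swap b c) = P (Equiv.swap b c) * r a c := by
      rw [move, Equiv.swap_apply_of_ne_of_ne h1 h2, Equiv.swap_apply_left]
    have e2 : r b c * P (Equiv.swap a b) = P (Equiv.swap a b) * r a c := by
      rw [move, Equiv.swap_apply_of_ne_of_ne h2.symm h3.symm, Equiv.swap_apply_right]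
    have e3 : r a c * P (Equiv.swap a b) = P (Equiv.swap a b) * r b c := by
      rw [move, Equiv.swap_apply_of_ne_of_ne h2.symm h3.symm, Equiv.swap_apply_left]
    have e4 : r a c * P (Equiv.swap b c) = P (Equiv.swap b c) * r a b := by
      rw [move, Equiv.swap_apply_of_ne_of_ne h1 h2, Equiv.swap_apply_right]
    have hP : P (Equiv.swap a b) * P (Equiv.swap b c) * P (Equiv.swap a b) =
        P (Equiv.swap b c) * P (Equiv.swap a b) * P (Equiv.swap b c) := by
      rw [← map_mul, ← map_mul, ← map_mul, ← map_mul, Equiv.swap_mul_swap_mul_swap h1 h2,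
        Equiv.swap_comm a b, Equiv.swap_comm b c,
        Equiv.swap_mul_swap_mul_swap h3.symm h2.symm, Equiv.swap_comm]
    calc P (Equiv.swap a b) * r a b * (P (Equiv.swap b c) * r b c) * (P (Equiv.swap a b) * r a b)
        = P (Equiv.swap a b) * (r a b * P (Equiv.swap b c)) * (r b c * P (Equiv.swap a b)) *
          r a b := by simp only [mul_assoc]
      _ = P (Equiv.swap a b) * P (Equiv.swap b c) * (r a c * P (Equiv.swap a b)) *
          r a c * r a b := by rw [e1, e2]; simp only [mul_assoc]
      _ = P (Equiv.swap a b) * P (Equiv.swap b c) * P (Equiv.swap a b) *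
          (r b c * r a c * r a b) := by rw [e3]; simp only [mul_assoc]
      _ = P (Equiv.swap b c) * P (Equiv.swap a b) * (P (Equiv.swap b c) * r a b) * r a c *
          r b c := by rw [hP, ← h.yangBaxter.yb a b c h1 h2 h3]; simp only [mul_assoc]
      _ = P (Equiv.swap b c) * (P (Equiv.swap a b) * r a c) * (P (Equiv.swap b c) * r a c) *
          r b c := by rw [← e4]; simp only [mul_assoc]
      _ = _ := by rw [← e2, ← e1]; simp only [mul_assoc]
  · rw [firstEntry_of_pos x (by omega), firstEntry_of_pos y (by omega)]
    refine (h.tuple ⟨0, by omega⟩ ⟨0 + 1, hn⟩ (by simp)).mul_swap ?_ ?_ ?_ ?_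
    · rw [← map_mul, Equiv.swap_mul_self, map_one]
    · rw [h.perm_r, Equiv.swap_apply_left, Equiv.swap_apply_right]
    · rw [h.perm_x, Equiv.swap_apply_left]
    · rw [h.perm_y, Equiv.swap_apply_left]

/-- Elliptic families in a semidirect product `N ⋊ Sₙ`. -/
theorem IsEllipticFamily.inl {N : Type*} [Group N] {φ : Equiv.Perm (Fin n) →* MulAut N}
    {r : Fin n → Fin n → N} {x y : Fin n → N} (hr : IsYB r)
    (perm_r : ∀ s i j, φ s (r i j) = r (s i) (s j)) (perm_x : ∀ s i, φ s (x i) = x (s i))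
    (perm_y : ∀ s i, φ s (y i) = y (s i))
    (comm_x : ∀ i j a, a ≠ i → a ≠ j → Commute (r i j) (x a))
    (comm_y : ∀ i j a, a ≠ i → a ≠ j → Commute (r i j) (y a))
    (tuple : ∀ i j, i ≠ j → IsEllipticTuple (r i j) (r j i) (x i) (x j) (y i) (y j)) :
    IsEllipticFamily (SemidirectProduct.inr : _ →* N ⋊[φ] Equiv.Perm (Fin n))
      (fun i j => SemidirectProduct.inl (r i j)) (fun i => SemidirectProduct.inl (x i))
      (fun i => SemidirectProduct.inl (y i)) := by
  have perm : ∀ s u, (SemidirectProduct.inr s * SemidirectProduct.inl u : N ⋊[φ] _) =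
      SemidirectProduct.inl (φ s u) * SemidirectProduct.inr s := fun s u => by
    rw [SemidirectProduct.inl_aut, mul_assoc, ← map_mul, inv_mul_cancel, map_one, mul_one]
  refine ⟨⟨fun i j a b h1 h2 h3 h4 => (hr.comm i j a b h1 h2 h3 h4).map SemidirectProduct.inl,
    fun i j a h1 h2 h3 => ?_⟩, fun s i j => ?_, fun s i => ?_, fun s i => ?_,
    fun i j a hi hj => (comm_x i j a hi hj).map SemidirectProduct.inl,
    fun i j a hi hj => (comm_y i j a hi hj).map SemidirectProduct.inl,
    fun i j hij => (tuple i j hij).map SemidirectProduct.inl⟩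
  · simp only [← map_mul, hr.yb i j a h1 h2 h3]
  · rw [perm, perm_r]
  · rw [perm, perm_x]
  · rw [perm, perm_y]

theorem map_mul_inv_mul_inv {N : Type*} [Group N] (f : N →* G) (a b : N) :
    f (a * b⁻¹ * a⁻¹) = f a * (f b)⁻¹ * (f a)⁻¹ := by
  simp only [map_mul, map_inv]

open EllipticBraidGroup in
/-- A homomorphism from the braid group is compatible with the actions of the central extension of
`SL₂(ℤ)` if it is so on generators. -/
theorem map_braidAction {M : Type*} [Group M] (act : SL2Tilde →* M) (Θ : M →* Monoid.End G)
    (ρ : EllipticBraidGroup n →* G)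
    (A_X : ∀ h, Θ (act SL2Tilde.A) (ρ (X ⟨0, h⟩)) = ρ (Y ⟨0, h⟩))
    (A_Y : ∀ h, Θ (act SL2Tilde.A) (ρ (Y ⟨0, h⟩)) =
      ρ (Y ⟨0, h⟩) * (ρ (X ⟨0, h⟩))⁻¹ * (ρ (Y ⟨0, h⟩))⁻¹)
    (A_s : ∀ i h, Θ (act SL2Tilde.A) (ρ (s i h)) = ρ (s i h))
    (B_X : ∀ h, Θ (act SL2Tilde.B) (ρ (X ⟨0, h⟩)) = ρ (X ⟨0, h⟩))
    (B_Y : ∀ h, Θ (act SL2Tilde.B) (ρ (Y ⟨0, h⟩)) = ρ (Y ⟨0, h⟩) * (ρ (X ⟨0, h⟩))⁻¹)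
    (B_s : ∀ i h, Θ (act SL2Tilde.B) (ρ (s i h)) = ρ (s i h))
    (g : SL2Tilde) (b : EllipticBraidGroup n) :
    ρ (braidAction n g b) = Θ (act g) (ρ b) := by
  have hs := braidAction_isCanonical (n := n)
  induction g using SL2Tilde.induction generalizing b with
  | hA =>
    have : ρ.comp (braidAction n SL2Tilde.A).toMonoidHom = (Θ (act SL2Tilde.A)).comp ρ := by
      refine hom_ext (fun h => ?_) (fun h => ?_) (fun i h => ?_)
      · exact (congrArg ρ (hs.A_X h)).trans (A_X h).symm
      · refine (congrArg ρ (hs.A_Y h)).trans (Eq.trans ?_ (A_Y h).symm)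
        simp only [map_mul, map_inv]
      · exact (congrArg ρ (hs.A_s i h)).trans (A_s i h).symm
    exact DFunLike.congr_fun this b
  | hB =>
    have : ρ.comp (braidAction n SL2Tilde.B).toMonoidHom = (Θ (act SL2Tilde.B)).comp ρ := by
      refine hom_ext (fun h => ?_) (fun h => ?_) (fun i h => ?_)
      · exact (congrArg ρ (hs.B_X h)).trans (B_X h).symm
      · refine (congrArg ρ (hs.B_Y h)).trans (Eq.trans ?_ (B_Y h).symm)
        simp only [map_mul, map_inv]
      · exact (congrArg ρ (hs.B_s i h)).trans (B_s i h).symm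
    exact DFunLike.congr_fun this b
  | h1 => rw [map_one, map_one, map_one]; rfl
  | hmul g g' hg hg' =>
    rw [map_mul, map_mul, map_mul, MulAut.mul_apply, hg, hg']; rfl
  | hinv g hg =>
    have h := congrArg (Θ (act g⁻¹)) (hg (braidAction n g⁻¹ b))
    have e : Θ (act g⁻¹) * Θ (act g) = 1 := by
      rw [← map_mul, ← map_mul, inv_mul_cancel, map_one, map_one]
    rw [← MulAut.mul_apply, ← map_mul, mul_inv_cancel, map_one] at h
    exact (h.trans (DFunLike.congr_fun e _)).symm

end EllipticFamily

section BraidRep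
variable {k : Type u} [Field k] {H : Type v} [Ring H] [HopfAlgebra k H] {𝓡 : QuasiTriangular k H}
variable {E : Type*} [Ring E] [Algebra k E]
open CompletedTensor

variable (k H E) in
/-- The group `(E ⊗̂ H ⊗ ⋯ ⊗ H)ˣ ⋊ Sₙ`, for any algebra `E`. -/
abbrev BraidTargetOf (n : ℕ) : Type _ :=
  (CompletedTensor k E (TensorPow k H n))ˣ
    ⋊[CompletedTensor.unitsAut.comp (permAut k H n)] Equiv.Perm (Fin n)

variable {n : ℕ}

variable (k E) in
/-- `t ↦ 1 ⊗ t`, on units. -/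
noncomputable def constUnits (A : Type*) [Ring A] [Algebra k A] :
    Aˣ →* (CompletedTensor k E A)ˣ :=
  Units.map (const : A →ₐ[k] CompletedTensor k E A).toMonoidHom

/-- `id ⊗ φ`, on units. -/
noncomputable def mapRightUnits {A A' : Type*} [Ring A] [Algebra k A] [Ring A'] [Algebra k A']
    (φ : A →ₐ[k] A') : (CompletedTensor k E A)ˣ →* (CompletedTensor k E A')ˣ :=
  Units.map (mapRight φ : CompletedTensor k E A →ₐ[k] CompletedTensor k E A').toMonoidHom

theorem permAut_factorHom (s : Equiv.Perm (Fin n)) (i : Fin n) (x : H) :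
    permAut k H n s (factorHom k H i x) = factorHom k H (s i) x := by
  refine (permAut_tprod k H n s _).trans ?_
  refine congrArg (PiTensorProduct.tprod k) (funext fun j => ?_)
  by_cases hj : j = s i
  · subst hj; simp
  · have : s.symm j ≠ i := fun h => hj (by rw [← h, Equiv.apply_symm_apply])
    simp [Pi.mulSingle_eq_of_ne, hj, this]

section Perm
variable (s : Equiv.Perm (Fin n))

theorem mapRightUnits_permAut_factorHom (i : Fin n) (Z : (CompletedTensor k E H)ˣ) :
    mapRightUnits (permAut k H n s : TensorPow k H n →ₐ[k] _) (mapRightUnits (factorHom k H i) Z) =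
      mapRightUnits (factorHom k H (s i)) Z := by
  have h : (permAut k H n s : TensorPow k H n →ₐ[k] _).comp (factorHom k H i) =
      factorHom k H (s i) := AlgHom.ext fun x => permAut_factorHom s i x
  rw [← h]; rfl

theorem mapRightUnits_constUnits {A A' : Type*} [Ring A] [Algebra k A] [Ring A'] [Algebra k A']
    (φ : A →ₐ[k] A') (u : Aˣ) : mapRightUnits φ (constUnits k E A u) =
      constUnits k E A' (Units.map φ.toMonoidHom u) := rfl

variable (𝓡) in
/-- `R^{i,j}` in `H ⊗ ⋯ ⊗ H`; it is `1` for `i = j`. -/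
noncomputable def factorR (i j : Fin n) : (TensorPow k H n)ˣ :=
  𝓡.famUnit (factorHom k H) (factorHom_commute k H) i j

theorem factorR_of_ne {i j : Fin n} (h : i ≠ j) :
    factorR 𝓡 i j = 𝓡.pairUnit (factorHom k H i) (factorHom k H j) (factorHom_commute k H i j h) :=
  𝓡.famUnit_of_ne _ _ h

theorem map_permAut_factorR (i j : Fin n) :
    Units.map (permAut k H n s : TensorPow k H n →ₐ[k] _).toMonoidHom (factorR 𝓡 i j) =
      factorR 𝓡 (s i) (s j) := by
  by_cases h : i = j
  · subst h; simp [factorR, QuasiTriangular.famUnit]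
  · rw [factorR_of_ne h, factorR_of_ne (fun e => h (s.injective e))]
    refine Units.ext ?_
    rw [QuasiTriangular.pairUnit_val]
    have := map_evalPair (permAut k H n s : TensorPow k H n →ₐ[k] TensorPow k H n)
      (factorHom k H i).toLinearMap (factorHom k H j).toLinearMap (𝓡.R : H ⊗[k] H)
    rw [← QuasiTriangular.pairUnit_val 𝓡 _ _ (factorHom_commute k H i j h)] at this
    refine Eq.trans this ?_
    have e : ∀ a, (permAut k H n s : TensorPow k H n →ₐ[k] TensorPow k H n).toLinearMap ∘ₗ
        (factorHom k H a).toLinearMap = (factorHom k H (s a)).toLinearMap := fun a =>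
      LinearMap.ext fun x => permAut_factorHom s a x
    rw [e, e]

end Perm

/-- The image of an elliptic pair in any two positions of `E ⊗̂ H ⊗ ⋯ ⊗ H`. -/
theorem isEllipticTuple_factorHom {X Y : (CompletedTensor k E H)ˣ}
    (h : 𝓡.IsCompletedEllipticPair 1 (X : CompletedTensor k E H) (Y : CompletedTensor k E H))
    {i j : Fin n} (hij : i ≠ j) :
    IsEllipticTuple (constUnits k E _ (factorR 𝓡 i j)) (constUnits k E _ (factorR 𝓡 j i))
      (mapRightUnits (factorHom k H i) X) (mapRightUnits (factorHom k H j) X)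
      (mapRightUnits (factorHom k H i) Y) (mapRightUnits (factorHom k H j) Y) := by
  let φ : H ⊗[k] H →ₐ[k] TensorPow k H n :=
    Algebra.TensorProduct.lift (factorHom k H i) (factorHom k H j) (factorHom_commute k H i j hij)
  have h1 := ((𝓡.isLegSystem_completed.relations_iff X Y).1 h).1.map (mapRightUnits (E := E) φ)
  have hleg1 : φ.comp Algebra.TensorProduct.includeLeft = factorHom k H i :=
    AlgHom.ext fun x => by simp [φ]
  have hleg2 : φ.comp Algebra.TensorProduct.includeRight = factorHom k H j :=
    AlgHom.ext fun x => by simp [φ]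
  have hs : ∀ t : H ⊗[k] H, φ (TensorProduct.comm k H H t) = Algebra.TensorProduct.lift
      (factorHom k H j) (factorHom k H i) (factorHom_commute k H j i hij.symm) t := by
    intro t
    induction t with
    | zero => simp
    | add s t hs ht => simp only [map_add, hs, ht]
    | tmul a b => simpa [φ] using (factorHom_commute k H i j hij b a).eq
  have hs' : constUnits k E _ (factorR 𝓡 j i) =
      mapRightUnits φ
        (Units.map (const : H ⊗[k] H →ₐ[k] CompletedTensor k E (H ⊗[k] H)) 𝓡.R21) := by
    rw [factorR_of_ne hij.symm]
    have e : 𝓡.pairUnit (factorHom k H j) (factorHom k H i) (factorHom_commute k H j i hij.symm) =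
        Units.map φ.toMonoidHom 𝓡.R21 := Units.ext (hs (𝓡.R : H ⊗[k] H)).symm
    rw [e]; rfl
  have hr' : constUnits k E _ (factorR 𝓡 i j) =
      mapRightUnits φ (Units.map (const : H ⊗[k] H →ₐ[k] CompletedTensor k E (H ⊗[k] H)) 𝓡.R) := by
    rw [factorR_of_ne hij]; rfl
  rw [hr', hs', ← hleg1, ← hleg2]
  exact h1

/-- The elements `R^{i,j}`, `X^{0,i}` and `Y^{0,i}` for an elliptic pair `X`, `Y` form an elliptic
family in the semidirect product. -/
theorem isEllipticFamily {X Y : (CompletedTensor k E H)ˣ}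
    (h : 𝓡.IsCompletedEllipticPair 1 (X : CompletedTensor k E H) (Y : CompletedTensor k E H))
    (n : ℕ) :
    IsEllipticFamily (G := BraidTargetOf k H E n) SemidirectProduct.inr
      (fun i j => SemidirectProduct.inl (constUnits k E _ (factorR 𝓡 i j)))
      (fun i => SemidirectProduct.inl (mapRightUnits (factorHom k H i) X))
      (fun i => SemidirectProduct.inl (mapRightUnits (factorHom k H i) Y)) := by
  have hleg : ∀ (Z : (CompletedTensor k E H)ˣ) (i j a : Fin n), a ≠ i → a ≠ j →
      Commute (constUnits k E _ (factorR 𝓡 i j)) (mapRightUnits (factorHom k H a) Z) := by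
    intro Z i j a hi hj
    by_cases hij : i = j
    · subst hij
      simp [factorR, QuasiTriangular.famUnit]
    refine Units.ext (const_mul_mapRight (fun x => ?_) (Z : CompletedTensor k E H))
    rw [factorR_of_ne hij, QuasiTriangular.pairUnit_val]
    generalize (𝓡.R : H ⊗[k] H) = t
    induction t with
    | zero => simp
    | add s t hs ht => simp only [map_add, add_mul, mul_add, hs, ht]
    | tmul b c =>
      rw [evalPair_tmul]
      exact (((factorHom_commute k H a i hi x b).mul_right
        (factorHom_commute k H a j hj x c)).symm).eq
  have hperm : ∀ (Z : (CompletedTensor k E H)ˣ) (s : Equiv.Perm (Fin n)) (i : Fin n),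
      CompletedTensor.unitsAut.comp (permAut k H n) s (mapRightUnits (factorHom k H i) Z) =
        mapRightUnits (factorHom k H (s i)) Z := fun Z s i =>
    mapRightUnits_permAut_factorHom s i Z
  have hR : IsYB (factorR (n := n) 𝓡) := 𝓡.famUnit_isYB _ _
  exact IsEllipticFamily.inl
    ⟨fun i j a b h1 h2 h3 h4 => (hR.comm i j a b h1 h2 h3 h4).map (constUnits k E _),
      fun i j a h1 h2 h3 => by simp only [← map_mul, hR.yb i j a h1 h2 h3]⟩
    (fun s i j => (mapRightUnits_constUnits _ _).trans
      (congrArg (constUnits k E _) (map_permAut_factorR s i j)))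
    (hperm X) (hperm Y) (hleg X) (hleg Y) (fun i j hij => isEllipticTuple_factorHom h hij)

variable (k H E) in
/-- The homomorphism `Z ↦ Z^{0,i}` to `(E ⊗̂ H ⊗ ⋯ ⊗ H)ˣ ⋊ Sₙ`. -/
noncomputable def legHom (i : Fin n) : (CompletedTensor k E H)ˣ →* BraidTargetOf k H E n :=
  SemidirectProduct.inl.comp (mapRightUnits (factorHom k H i))

/-- The homomorphism from the braid group of the punctured torus given by an elliptic pair. -/
noncomputable def braidRep {X Y : (CompletedTensor k E H)ˣ}
    (h : 𝓡.IsCompletedEllipticPair 1 (X : CompletedTensor k E H) (Y : CompletedTensor k E H))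
    (n : ℕ) : EllipticBraidGroup n →* BraidTargetOf k H E n :=
  EllipticBraidGroup.lift (isEllipticFamily h n).isBraidDatum

section
variable {X Y : (CompletedTensor k E H)ˣ}
  (h : 𝓡.IsCompletedEllipticPair 1 (X : CompletedTensor k E H) (Y : CompletedTensor k E H))

theorem braidRep_X (hn : 0 < n) : braidRep h n (EllipticBraidGroup.X ⟨0, hn⟩) =
    legHom k H E ⟨0, hn⟩ X :=
  (EllipticBraidGroup.lift_X (isEllipticFamily h n).isBraidDatum hn).trans
    (firstEntry_of_pos _ hn)

theorem braidRep_Y (hn : 0 < n) : braidRep h n (EllipticBraidGroup.Y ⟨0, hn⟩) =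
    legHom k H E ⟨0, hn⟩ Y :=
  (EllipticBraidGroup.lift_Y (isEllipticFamily h n).isBraidDatum hn).trans
    (firstEntry_of_pos _ hn)

theorem braidRep_s (i : ℕ) (hi : i + 1 < n) : braidRep h n (EllipticBraidGroup.s i hi) =
    SemidirectProduct.inr (Equiv.swap ⟨i, Nat.lt_of_succ_lt hi⟩ ⟨i + 1, hi⟩) *
      SemidirectProduct.inl (constUnits k E _
        (𝓡.RUnit ⟨i, Nat.lt_of_succ_lt hi⟩ ⟨i + 1, hi⟩ (by simp))) :=
  (EllipticBraidGroup.lift_s (isEllipticFamily h n).isBraidDatum i hi).trans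
    (congrArg (fun u => SemidirectProduct.inr _ * SemidirectProduct.inl (constUnits k E _ u))
      (factorR_of_ne (by simp)))
end

/-! ### Compatibility of the two actions -/

variable (k H E n) in
/-- The action of automorphisms of `E` on `(E ⊗̂ H ⊗ ⋯ ⊗ H)ˣ ⋊ Sₙ`. -/
noncomputable def targetMap : (E ≃ₐ[k] E) →* Monoid.End (BraidTargetOf k H E n) where
  toFun α := SemidirectProduct.map (mapUnits (TensorPow k H n) (α : E →ₐ[k] E)) (MonoidHom.id _)
    fun _ => MonoidHom.ext fun _ => rfl
  map_one' := rfl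
  map_mul' _ _ := rfl

theorem targetMap_inl (α : E ≃ₐ[k] E) (u : (CompletedTensor k E (TensorPow k H n))ˣ) :
    targetMap k H E n α (SemidirectProduct.inl u) =
      SemidirectProduct.inl (mapUnits (TensorPow k H n) (α : E →ₐ[k] E) u) :=
  SemidirectProduct.ext rfl rfl

theorem targetMap_inr (α : E ≃ₐ[k] E) (s : Equiv.Perm (Fin n)) :
    targetMap k H E n α (SemidirectProduct.inr s) = SemidirectProduct.inr s :=
  SemidirectProduct.ext (map_one (mapUnits (TensorPow k H n) (α : E →ₐ[k] E))) rfl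

theorem targetMap_leg (α : E ≃ₐ[k] E) (i : Fin n) (Z : (CompletedTensor k E H)ˣ) :
    targetMap k H E n α (legHom k H E i Z) = legHom k H E i (mapUnits H (α : E →ₐ[k] E) Z) :=
  targetMap_inl α _

theorem mapUnits_constUnits {A : Type*} [Ring A] [Algebra k A] (α : E →ₐ[k] E) (u : Aˣ) :
    mapUnits A α (constUnits k E A u) = constUnits k E A u :=
  Units.ext (mapLeft_const α (u : A))

section
variable {X Y : (CompletedTensor k E H)ˣ}

theorem targetMap_braidRep_s
    (h : 𝓡.IsCompletedEllipticPair 1 (X : CompletedTensor k E H) (Y : CompletedTensor k E H))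
    (α : E ≃ₐ[k] E) (i : ℕ) (hi : i + 1 < n) :
    targetMap k H E n α (braidRep h n (EllipticBraidGroup.s i hi)) =
      braidRep h n (EllipticBraidGroup.s i hi) := by
  rw [braidRep_s]
  exact (map_mul (targetMap k H E n α) _ _).trans
    (congrArg₂ (· * ·) (targetMap_inr α _) ((targetMap_inl α _).trans
      (congrArg SemidirectProduct.inl (mapUnits_constUnits _ _))))

theorem braidRep_action (hE : IsEllipticDouble 𝓡 X Y) (g : SL2Tilde) (b : EllipticBraidGroup n) :
    braidRep hE.elliptic n (braidAction n g b) =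
      targetMap k H E n (hE.action g) (braidRep hE.elliptic n b) := by
  refine map_braidAction hE.action (targetMap k H E n) (braidRep hE.elliptic n) (fun h => ?_)
    (fun h => ?_) (fun i h => targetMap_braidRep_s _ _ i h) (fun h => ?_) (fun h => ?_)
    (fun i h => targetMap_braidRep_s _ _ i h) g b
  · rw [braidRep_X, braidRep_Y, targetMap_leg]
    exact congrArg (legHom k H E _) hE.action_A_X
  · rw [braidRep_X, braidRep_Y, targetMap_leg]
    exact (congrArg (legHom k H E _) hE.action_A_Y).trans
      (map_mul_inv_mul_inv (legHom k H E _) Y X)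
  · rw [braidRep_X, targetMap_leg]
    exact congrArg (legHom k H E _) hE.action_B_X
  · rw [braidRep_X, braidRep_Y, targetMap_leg]
    exact (congrArg (legHom k H E _) hE.action_B_Y).trans
      (map_mul_inv (legHom k H E _) Y X)
end

end BraidRep

theorem mainTheorem4 {k : Type u} [Field k] {H : Type v} [Ring H] [HopfAlgebra k H]
    (𝓡 : QuasiTriangular k H) :
    -- the relations pass to the pairs `(X, Y X⁻¹)` and `(Y, Y X⁻¹ Y⁻¹)`
    (∀ (B : Type w) [Ring B] [Algebra k B] (X Y : (B ⊗[k] H)ˣ),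
      𝓡.IsEllipticPair 1 (X : B ⊗[k] H) (Y : B ⊗[k] H) →
        𝓡.IsEllipticPair 1 (X : B ⊗[k] H) (↑(Y * X⁻¹) : B ⊗[k] H) ∧
        𝓡.IsEllipticPair 1 (Y : B ⊗[k] H) (↑(Y * X⁻¹ * Y⁻¹) : B ⊗[k] H)) ∧
    (∀ (B : Type w) [Ring B] [Algebra k B] (X Y : (CompletedTensor k B H)ˣ),
      𝓡.IsCompletedEllipticPair 1 (X : CompletedTensor k B H) (Y : CompletedTensor k B H) →
        𝓡.IsCompletedEllipticPair 1 (X : CompletedTensor k B H)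
          (↑(Y * X⁻¹) : CompletedTensor k B H) ∧
        𝓡.IsCompletedEllipticPair 1 (Y : CompletedTensor k B H)
          (↑(Y * X⁻¹ * Y⁻¹) : CompletedTensor k B H)) ∧
    -- the elliptic double is `H° ⊗ H°`, and its canonical elements are an invertible such pair
    Function.Bijective (EllipticDouble.ofTensor 𝓡) ∧
    EllipticDouble.ofTensor 𝓡 (counitFunctional ⊗ₜ[k] counitFunctional) = 1 ∧
    (∀ f g : RestrictedDual k H,
      (EllipticDouble.X 𝓡).ofConv f * (EllipticDouble.Y 𝓡).ofConv g =
        EllipticDouble.ofTensor 𝓡 (f ⊗ₜ[k] g)) ∧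
    𝓡.IsCompletedEllipticPair 1 (EllipticDouble.X 𝓡) (EllipticDouble.Y 𝓡) ∧
    ∃ X Y : (CompletedTensor k (EllipticDouble 𝓡) H)ˣ,
      (X : CompletedTensor k (EllipticDouble 𝓡) H) = EllipticDouble.X 𝓡 ∧
      (Y : CompletedTensor k (EllipticDouble 𝓡) H) = EllipticDouble.Y 𝓡 ∧
      -- the action on the elliptic double
      ∃ act : SL2Tilde →* (EllipticDouble 𝓡 ≃ₐ[k] EllipticDouble 𝓡),
        𝓡.IsCanonicalAction X Y act ∧
        (∀ act' : SL2Tilde →* (EllipticDouble 𝓡 ≃ₐ[k] EllipticDouble 𝓡),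
          𝓡.IsCanonicalAction X Y act' → act' = act) ∧
        -- its compatibility with the action on the braid groups of the punctured torus
        ∀ n : ℕ, ∃ (braidAct : SL2Tilde →* MulAut (EllipticBraidGroup n))
          (φ : EllipticBraidGroup n →* 𝓡.BraidTarget n),
          IsCanonicalBraidAction braidAct ∧ 𝓡.IsCanonicalBraidRep X Y φ ∧
          ∀ (g : SL2Tilde) (b : EllipticBraidGroup n),
            (φ (braidAct g b)).left =
              Units.map (CompletedTensor.mapLeft
                (act g : EllipticDouble 𝓡 →ₐ[k] EllipticDouble 𝓡)).toMonoidHom (φ b).left ∧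
            (φ (braidAct g b)).right = (φ b).right := by
  have hE := EllipticDouble.isEllipticDouble 𝓡
  refine ⟨fun B _ _ X Y h => ⟨𝓡.isLegSystem_tensor.actB h, 𝓡.isLegSystem_tensor.actA h⟩,
    fun B _ _ X Y h => ⟨𝓡.isLegSystem_completed.actB h, 𝓡.isLegSystem_completed.actA h⟩,
    EllipticDouble.ofTensor_bijective 𝓡, EllipticDouble.ofTensor_counit 𝓡,
    EllipticDouble.X_mul_Y 𝓡, canonical_isEllipticPair 𝓡,
    EllipticDouble.unitX 𝓡, EllipticDouble.unitY 𝓡, rfl, rfl, hE.action,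
    (EllipticDouble.isCanonicalAction_iff 𝓡 _).2 rfl,
    fun act' => (EllipticDouble.isCanonicalAction_iff 𝓡 act').1,
    fun n => ⟨braidAction n, braidRep hE.elliptic n, braidAction_isCanonical,
      ⟨braidRep_X _, braidRep_Y _, braidRep_s _⟩, fun g b => ?_⟩⟩
  have h := braidRep_action hE g b
  exact ⟨congrArg SemidirectProduct.left h, (congrArg SemidirectProduct.right h).trans rfl⟩
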